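/- Let $\mathfrak g$ be a finite-dimensional simply-laced semisimple Lie algebra over $\mathbb C$ with a fixed Cartan subalgebra, simple roots $\{\alpha_i\}_{i\in I}$, and inner product on roots normalized by $\alpha_i\cdot\alpha_i=2$; write $\langle\alpha_i,\gamma\rangle=\alpha_i\cdot\gamma$ for a root $\gamma$. A coweight is a homomorphism $\mu=\langle\mu,-\rangle$ from the root lattice to $\mathbb Z$; it is antidominant if $\langle\mu,\alpha_i\rangle\le 0$ for all $i\in I$. For a coweight $\mu$, the shifted Yangian $Y_\mu$ is the unital associative $\mathbb C$-algebra with generators $E_i^{(q)},F_i^{(q)},H_i^{(p)}$ ($i\in I$, $q\in\mathbb Z_{>0}$, $p\in\mathbb Z$) and relations \begin{align*} &[H_i^{(p)},H_j^{(q)}]=0,\qquad [E_i^{(p)},F_j^{(q)}]=\delta_{ij}H_i^{(p+q-1)},\\ &[H_i^{(p+1)},E_j^{(q)}]-[H_i^{(p)},E_j^{(q+1)}]=\tfrac{\alpha_i\cdot\alpha_j}{2}\bigl(H_i^{(p)}E_j^{(q)}+E_j^{(q)}H_i^{(p)}\bigr),\\ &[H_i^{(p+1)},F_j^{(q)}]-[H_i^{(p)},F_j^{(q+1)}]=-\tfrac{\alpha_i\cdot\alpha_j}{2}\bigl(H_i^{(p)}F_j^{(q)}+F_j^{(q)}H_i^{(p)}\bigr),\\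 &[E_i^{(p+1)},E_j^{(q)}]-[E_i^{(p)},E_j^{(q+1)}]=\tfrac{\alpha_i\cdot\alpha_j}{2}\bigl(E_i^{(p)}E_j^{(q)}+E_j^{(q)}E_i^{(p)}\bigr),\\ &[F_i^{(p+1)},F_j^{(q)}]-[F_i^{(p)},F_j^{(q+1)}]=-\tfrac{\alpha_i\cdot\alpha_j}{2}\bigl(F_i^{(p)}F_j^{(q)}+F_j^{(q)}F_i^{(p)}\bigr),\\ &\operatorname{sym}[E_i^{(p_1)},[E_i^{(p_2)},\cdots[E_i^{(p_N)},E_j^{(q)}]\cdots]]=0,\quad \operatorname{sym}[F_i^{(p_1)},[F_i^{(p_2)},\cdots[F_i^{(p_N)},F_j^{(q)}]\cdots]]=0\quad(i\ne j,\ N=1-\alpha_i\cdot\alpha_j),\\ &H_i^{(p)}=0\ \ (p<-\langle\mu,\alpha_i\rangle),\qquad H_i^{(-\langle\mu,\alpha_i\rangle)}=1, \end{align*} where $\operatorname{sym}$ is the sum over all permutations of $p_1,\dots,p_N$. Put $S_i^{(-\langle\mu,\alpha_i\rangle+1)}=H_i^{(-\langle\mu,\alpha_i\rangle+1)}$ and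 $S_i^{(-\langle\mu,\alpha_i\rangle+2)}=H_i^{(-\langle\mu,\alpha_i\rangle+2)}-\frac12\bigl(H_i^{(-\langle\mu,\alpha_i\rangle+1)}\bigr)^2$. Fix Chevalley generators $e_i\in\mathfrak g_{\alpha_i}$, $f_i\in\mathfrak g_{-\alpha_i}$ with $[e_i,f_i]=\alpha_i^\vee$. For every positive root $\gamma$ fix root vectors $e_\gamma=[e_{i_1},[e_{i_2},\cdots e_{i_\ell}]\cdots]\in\mathfrak g_\gamma$ and $f_\gamma=c_\gamma[f_{j_1},[f_{j_2},\cdots f_{j_\ell}]\cdots]\in\mathfrak g_{-\gamma}$, $c_\gamma\in\mathbb C$, with $[e_\gamma,f_\gamma]=\gamma^\vee$ (that is, dual to each other under the invariant form with $(e_i,f_i)=1$). In every $Y_\mu$ put $E_\gamma^{(1)}=[E_{i_1}^{(1)},[E_{i_2}^{(1)},\cdots E_{i_\ell}^{(1)}]\cdots]$ and $F_\gamma^{(1)}=c_\gamma[F_{j_1}^{(1)},[F_{j_2}^{(1)},\cdots F_{j_\ell}^{(1)}]\cdots]$. Theorem. Let $\mu=\mu_1+\mu_2$ with $\mu_1,\mu_2$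 (hence $\mu$) antidominant. For any choice as above there is a unique homomorphism of unital $\mathbb C$-algebras $\Delta\colon Y_\mu\to Y_{\mu_1}\otimes_{\mathbb C}Y_{\mu_2}$ such that for all $i\in I$ \begin{align*} \Delta(E_i^{(r)})&=E_i^{(r)}\otimes1,\quad 1\le r\le-\langle\mu_1,\alpha_i\rangle;\\ \Delta(E_i^{(-\langle\mu_1,\alpha_i\rangle+1)})&=E_i^{(-\langle\mu_1,\alpha_i\rangle+1)}\otimes1+1\otimes E_i^{(1)};\\ \Delta(E_i^{(-\langle\mu_1,\alpha_i\rangle+2)})&=E_i^{(-\langle\mu_1,\alpha_i\rangle+2)}\otimes1+1\otimes E_i^{(2)}+S_i^{(-\langle\mu_1,\alpha_i\rangle+1)}\otimes E_i^{(1)}-\sum_{\gamma>0}F_\gamma^{(1)}\otimes[E_i^{(1)},E_\gamma^{(1)}];\\ \Delta(F_i^{(r)})&=1\otimes F_i^{(r)},\quad 1\le r\le-\langle\mu_2,\alpha_i\rangle;\\ \Delta(F_i^{(-\langle\mu_2,\alpha_i\rangle+1)})&=1\otimes F_i^{(-\langle\mu_2,\alpha_i\rangle+1)}+F_i^{(1)}\otimes1;\\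 \Delta(F_i^{(-\langle\mu_2,\alpha_i\rangle+2)})&=1\otimes F_i^{(-\langle\mu_2,\alpha_i\rangle+2)}+F_i^{(2)}\otimes1+F_i^{(1)}\otimes S_i^{(-\langle\mu_2,\alpha_i\rangle+1)}+\sum_{\gamma>0}[F_i^{(1)},F_\gamma^{(1)}]\otimes E_\gamma^{(1)};\\ \Delta(S_i^{(-\langle\mu,\alpha_i\rangle+1)})&=S_i^{(-\langle\mu_1,\alpha_i\rangle+1)}\otimes1+1\otimes S_i^{(-\langle\mu_2,\alpha_i\rangle+1)};\\ \Delta(S_i^{(-\langle\mu,\alpha_i\rangle+2)})&=S_i^{(-\langle\mu_1,\alpha_i\rangle+2)}\otimes1+1\otimes S_i^{(-\langle\mu_2,\alpha_i\rangle+2)}-\sum_{\gamma>0}\langle\alpha_i,\gamma\rangle F_\gamma^{(1)}\otimes E_\gamma^{(1)}. \end{align*} -/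

import Mathlib

open scoped TensorProduct

noncomputable section

/-! ### Iterated commutators -/

/-- The right-nested iterated bracket `[x i₁, [x i₂, … [x i_{ℓ-1}, x i_ℓ] … ]]` attached to a
word `i₁ i₂ … i_ℓ` (the empty word gives `0`).  It is used both in a Lie algebra and in an
associative algebra with its commutator bracket. -/
def iterBracket {I L : Type*} [Zero L] [Bracket L L] (x : I → L) : List I → L
  | [] => 0
  | [i] => x i
  | i :: j :: w => ⁅x i, iterBracket x (j :: w)⁆

/-! ### The Cartan doubled Yangian and the shifted Yangians

In this section `A i j` stands for the inner product `α_i · α_j` of simple roots. -/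

/-- The generators `E_i^{(q)}`, `F_i^{(q)}` (`q > 0`) and `H_i^{(p)}` (`p ∈ ℤ`). -/
inductive YangianGen (I : Type*)
  | E (i : I) (q : ℕ+)
  | F (i : I) (q : ℕ+)
  | H (i : I) (p : ℤ)

namespace CartanDoubledYangian

variable {I : Type*}

/-- The generator `E_i^{(q)}` in the free algebra. -/
abbrev fE (i : I) (q : ℕ+) : FreeAlgebra ℂ (YangianGen I) := FreeAlgebra.ι ℂ (.E i q)

/-- The generator `F_i^{(q)}` in the free algebra. -/
abbrev fF (i : I) (q : ℕ+) : FreeAlgebra ℂ (YangianGen I) := FreeAlgebra.ι ℂ (.F i q)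

/-- The generator `H_i^{(p)}` in the free algebra. -/
abbrev fH (i : I) (p : ℤ) : FreeAlgebra ℂ (YangianGen I) := FreeAlgebra.ι ℂ (.H i p)

/-- `sym [x^{(p₁)}, [x^{(p₂)}, … [x^{(p_N)}, y] … ]]`, the sum over all permutations of the
upper indices `p₁, …, p_N`. -/
def symBracket {R : Type*} [Ring R] {N : ℕ} (x : ℕ+ → R) (p : Fin N → ℕ+) (y : R) : R :=
  ∑ σ : Equiv.Perm (Fin N), (List.ofFn fun k => x (p (σ k))).foldr (fun a z => ⁅a, z⁆) y

/-- The defining relations of the Cartan doubled Yangian `Y_∞`. -/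
inductive Rel (A : Matrix I I ℤ) :
    FreeAlgebra ℂ (YangianGen I) → FreeAlgebra ℂ (YangianGen I) → Prop
  | HH (i j : I) (p q : ℤ) : Rel A ⁅fH i p, fH j q⁆ 0
  | EF_same (i : I) (p q : ℕ+) : Rel A ⁅fE i p, fF i q⁆ (fH i ((p : ℤ) + (q : ℤ) - 1))
  | EF_ne (i j : I) (hij : i ≠ j) (p q : ℕ+) : Rel A ⁅fE i p, fF j q⁆ 0
  | HE (i j : I) (p : ℤ) (q : ℕ+) :
      Rel A (⁅fH i (p + 1), fE j q⁆ - ⁅fH i p, fE j (q + 1)⁆)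
        (((A i j : ℂ) / 2) • (fH i p * fE j q + fE j q * fH i p))
  | HF (i j : I) (p : ℤ) (q : ℕ+) :
      Rel A (⁅fH i (p + 1), fF j q⁆ - ⁅fH i p, fF j (q + 1)⁆)
        (-((A i j : ℂ) / 2) • (fH i p * fF j q + fF j q * fH i p))
  | EE (i j : I) (p q : ℕ+) :
      Rel A (⁅fE i (p + 1), fE j q⁆ - ⁅fE i p, fE j (q + 1)⁆)
        (((A i j : ℂ) / 2) • (fE i p * fE j q + fE j q * fE i p))
  | FF (i j : I) (p q : ℕ+) :
      Rel A (⁅fF i (p + 1), fF j q⁆ - ⁅fF i p, fF j (q + 1)⁆)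
        (-((A i j : ℂ) / 2) • (fF i p * fF j q + fF j q * fF i p))
  | serreE (i j : I) (hij : i ≠ j) (N : ℕ) (hN : (N : ℤ) = 1 - A i j)
      (p : Fin N → ℕ+) (q : ℕ+) : Rel A (symBracket (fE i) p (fE j q)) 0
  | serreF (i j : I) (hij : i ≠ j) (N : ℕ) (hN : (N : ℤ) = 1 - A i j)
      (p : Fin N → ℕ+) (q : ℕ+) : Rel A (symBracket (fF i) p (fF j q)) 0

end CartanDoubledYangian

/-- The Cartan doubled Yangian `Y_∞`: the unital associative `ℂ`-algebra with generators
`E_i^{(q)}`, `F_i^{(q)}`, `H_i^{(p)}` and the relations `CartanDoubledYangian.Rel`. -/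
def CartanDoubledYangian {I : Type*} (A : Matrix I I ℤ) : Type _ :=
  RingQuot (CartanDoubledYangian.Rel A)

instance {I : Type*} (A : Matrix I I ℤ) : Ring (CartanDoubledYangian A) :=
  inferInstanceAs (Ring (RingQuot (CartanDoubledYangian.Rel A)))

instance {I : Type*} (A : Matrix I I ℤ) : Algebra ℂ (CartanDoubledYangian A) :=
  inferInstanceAs (Algebra ℂ (RingQuot (CartanDoubledYangian.Rel A)))

/-- The projection of the free algebra onto `Y_∞`. -/
def CartanDoubledYangian.proj {I : Type*} (A : Matrix I I ℤ) :
    FreeAlgebra ℂ (YangianGen I) →ₐ[ℂ] CartanDoubledYangian A :=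
  RingQuot.mkAlgHom ℂ (CartanDoubledYangian.Rel A)

/-- The generator `H_i^{(p)}` of `Y_∞`. -/
def CartanDoubledYangian.H {I : Type*} (A : Matrix I I ℤ) (i : I) (p : ℤ) :
    CartanDoubledYangian A :=
  CartanDoubledYangian.proj A (CartanDoubledYangian.fH i p)

/-- The relations imposed on `Y_∞` to obtain `Y_μ`, where `m i = ⟨μ, α_i⟩`. -/
inductive ShiftedYangian.Rel {I : Type*} (A : Matrix I I ℤ) (m : I → ℤ) :
    CartanDoubledYangian A → CartanDoubledYangian A → Prop
  | H_zero (i : I) (p : ℤ) (hp : p < -m i) : Rel A m (CartanDoubledYangian.H A i p) 0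
  | H_one (i : I) : Rel A m (CartanDoubledYangian.H A i (-m i)) 1

/-- The shifted Yangian `Y_μ`, where `m i = ⟨μ, α_i⟩`: the quotient of `Y_∞` by the relations
`H_i^{(p)} = 0` for `p < -⟨μ, α_i⟩` and `H_i^{(-⟨μ, α_i⟩)} = 1`. -/
def ShiftedYangian {I : Type*} (A : Matrix I I ℤ) (m : I → ℤ) : Type _ :=
  RingQuot (ShiftedYangian.Rel A m)

instance {I : Type*} (A : Matrix I I ℤ) (m : I → ℤ) : Ring (ShiftedYangian A m) :=
  inferInstanceAs (Ring (RingQuot (ShiftedYangian.Rel A m)))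

instance {I : Type*} (A : Matrix I I ℤ) (m : I → ℤ) : Algebra ℂ (ShiftedYangian A m) :=
  inferInstanceAs (Algebra ℂ (RingQuot (ShiftedYangian.Rel A m)))

namespace ShiftedYangian

variable {I : Type*} (A : Matrix I I ℤ) (m : I → ℤ)

/-- The projection of the free algebra onto `Y_μ`. -/
def proj : FreeAlgebra ℂ (YangianGen I) →ₐ[ℂ] ShiftedYangian A m :=
  AlgHom.comp (B := CartanDoubledYangian A) (RingQuot.mkAlgHom ℂ (ShiftedYangian.Rel A m))
    (CartanDoubledYangian.proj A)

/-- `E_i^{(q)} ∈ Y_μ`. -/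
def E (i : I) (q : ℕ+) : ShiftedYangian A m := proj A m (CartanDoubledYangian.fE i q)

/-- `F_i^{(q)} ∈ Y_μ`. -/
def F (i : I) (q : ℕ+) : ShiftedYangian A m := proj A m (CartanDoubledYangian.fF i q)

/-- `H_i^{(p)} ∈ Y_μ`. -/
def H (i : I) (p : ℤ) : ShiftedYangian A m := proj A m (CartanDoubledYangian.fH i p)

/-- `S_i^{(-⟨μ, α_i⟩ + 1)} = H_i^{(-⟨μ, α_i⟩ + 1)}`. -/
def S₁ (i : I) : ShiftedYangian A m := H A m i (-m i + 1)

/-- `S_i^{(-⟨μ, α_i⟩ + 2)} = H_i^{(-⟨μ, α_i⟩ + 2)} - ½ (H_i^{(-⟨μ, α_i⟩ + 1)})²`. -/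
def S₂ (i : I) : ShiftedYangian A m :=
  H A m i (-m i + 2) - (1 / 2 : ℂ) • (H A m i (-m i + 1)) ^ 2

end ShiftedYangian

/-! ### Coweights -/

section Coweight

variable {ι R M N : Type*} [CommRing R] [AddCommGroup M] [Module R M] [AddCommGroup N] [Module R N]

/-- The coweight lattice: the `ℤ`-dual of the root lattice. -/
abbrev Coweight (P : RootPairing ι R M N) : Type _ :=
  Module.Dual ℤ (Submodule.span ℤ (Set.range P.root))

/-- The integer `⟨μ, α⟩`, for a coweight `μ` and a root `α`. -/
def Coweight.pair {P : RootPairing ι R M N} (μ : Coweight P) (α : ι) : ℤ :=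
  μ ⟨P.root α, Submodule.subset_span (Set.mem_range_self α)⟩

/-- `μ` is antidominant: `⟨μ, α_i⟩ ≤ 0` for every simple root `α_i`. -/
def Coweight.IsAntidominant {P : RootPairing ι R M N} (b : P.Base) (μ : Coweight P) : Prop :=
  ∀ i ∈ b.support, μ.pair i ≤ 0

end Coweight

/-! ### Root vectors -/

open LieAlgebra LieAlgebra.IsKilling

section RootVectors

variable {g : Type*} [LieRing g] [LieAlgebra ℂ g] [FiniteDimensional ℂ g]
  [LieAlgebra.IsSemisimple ℂ g] {h : LieSubalgebra ℂ g} [h.IsCartanSubalgebra]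

/-- The positive roots of `g` with respect to the base `b`. -/
abbrev PosRoot (b : (rootSystem h).Base) : Type _ := {γ : h.root // b.IsPos γ}

instance (b : (rootSystem h).Base) : Fintype (PosRoot b) := Fintype.ofFinite _

/-- The shifted Yangian `Y_μ(g)` of a simply-laced semisimple Lie algebra `g`.  As `g` is
simply-laced, the inner products `α_i · α_j` (with `α_i · α_i = 2`) are the entries of its Cartan
matrix. -/
abbrev Yangian (b : (rootSystem h).Base) (μ : Coweight (rootSystem h)) : Type _ :=
  ShiftedYangian b.cartanMatrix fun i => μ.pair (i : h.root)

/-- A choice of Chevalley generators `e_i`, `f_i` of `g` and, for every positive root `γ`, of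
root vectors `e_γ ∈ g_γ` and `f_γ ∈ g_{-γ}` with `[e_γ, f_γ] = γ^∨`, where
* `e_γ` is an iterated bracket of the `e_i`;
* `f_γ` is a scalar multiple of an iterated bracket of the `f_i`.

As `g` is simply-laced, `[e_γ, f_γ] = γ^∨` says that `e_γ` and `f_γ` are dual to each other under
the invariant form on `g` normalized by `(e_i, f_i) = 1`. -/
structure RootVectors (b : (rootSystem h).Base) where
  /-- The Chevalley generator `e_i`. -/
  e : b.support → g
  /-- The Chevalley generator `f_i`. -/
  f : b.support → g
  e_mem (i : b.support) : e i ∈ rootSpace h (i : h.root).1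
  f_mem (i : b.support) : f i ∈ rootSpace h (-(i : h.root).1)
  lie_e_f (i : b.support) : ⁅e i, f i⁆ = (coroot (i : h.root).1 : g)
  /-- The word `i₁ … i_ℓ` with `e_γ = [e_{i₁}, [e_{i₂}, … e_{i_ℓ}] … ]`. -/
  wordE : PosRoot b → List b.support
  /-- The word `j₁ … j_ℓ` with `f_γ = c_γ [f_{j₁}, [f_{j₂}, … f_{j_ℓ}] … ]`. -/
  wordF : PosRoot b → List b.support
  /-- The scalar `c_γ`. -/
  coefF : PosRoot b → ℂ
  eRoot_mem (γ : PosRoot b) : iterBracket e (wordE γ) ∈ rootSpace h γ.1.1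
  fRoot_mem (γ : PosRoot b) : coefF γ • iterBracket f (wordF γ) ∈ rootSpace h (-γ.1.1)
  lie_eRoot_fRoot (γ : PosRoot b) :
    ⁅iterBracket e (wordE γ), coefF γ • iterBracket f (wordF γ)⁆ = (coroot γ.1.1 : g)

namespace RootVectors

variable {b : (rootSystem h).Base} (v : RootVectors b) (μ : Coweight (rootSystem h))

/-- `E_γ^{(1)} = [E_{i₁}^{(1)}, [E_{i₂}^{(1)}, … E_{i_ℓ}^{(1)}] … ] ∈ Y_μ`. -/
def E (γ : PosRoot b) : Yangian b μ :=
  iterBracket (fun i => ShiftedYangian.E b.cartanMatrix _ i 1) (v.wordE γ)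

/-- `F_γ^{(1)} = c_γ [F_{j₁}^{(1)}, [F_{j₂}^{(1)}, … F_{j_ℓ}^{(1)}] … ] ∈ Y_μ`. -/
def F (γ : PosRoot b) : Yangian b μ :=
  v.coefF γ • iterBracket (fun i => ShiftedYangian.F b.cartanMatrix _ i 1) (v.wordF γ)

end RootVectors

namespace Yangian

variable (b : (rootSystem h).Base) (μ : Coweight (rootSystem h))

/-- `E_i^{(r)} ∈ Y_μ(g)`. -/
abbrev E (i : b.support) (r : ℕ+) : Yangian b μ := ShiftedYangian.E b.cartanMatrix _ i r

/-- `F_i^{(r)} ∈ Y_μ(g)`. -/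
abbrev F (i : b.support) (r : ℕ+) : Yangian b μ := ShiftedYangian.F b.cartanMatrix _ i r

/-- `S_i^{(-⟨μ, α_i⟩ + 1)} ∈ Y_μ(g)`. -/
abbrev S₁ (i : b.support) : Yangian b μ := ShiftedYangian.S₁ b.cartanMatrix _ i

/-- `S_i^{(-⟨μ, α_i⟩ + 2)} ∈ Y_μ(g)`. -/
abbrev S₂ (i : b.support) : Yangian b μ := ShiftedYangian.S₂ b.cartanMatrix _ i

end Yangian

end RootVectors

end

/-! Write `e i n`, `f i n` for E_i^{(n+1)}, F_i^{(n+1)} and H_k for the Cartan modes of one node.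
Existence is the difficulty: Δ is prescribed on finitely many generators, while Y_μ has infinitely
many generators and relations.

The first half is a Levendorskii-type presentation. Since [S₂_i, e_{j,n}] = a_ij e_{j,n+1}, and
similarly for f, the higher modes come from the lowest ones by bracketing with S₂. `LowRelations`
keeps this recursion together with relations in low degree, and these imply all the others
(`ShiftedYangian.exists_algHom`). Bracketing with S₂ acts on a relation by shifts of its modes. For
i ≠ j two such operators are independent because a 2×2 Cartan minor is nonzero. For i = j they give
only the sum of the shifts, and the third coefficient of log H supplies the sum of their squares.
There remains the claim that [e_p, f_q] depends only on p + q. The first failure is a multiple of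
[S₂, H_K]. By `lie_lie_eq_smul` the bracket of H_K with H_{N+2} = S₂ + ½S₁² is a positive multiple
of this failure, whereas directly it equals −[S₂, H_K]; so the failure vanishes. The very first
degree is settled by comparing two neighbouring nodes, or by an explicit hypothesis at an isolated
node.

The second half constructs elements of the tensor product satisfying `LowRelations`. Put a = −⟨μ₁,
α_i⟩ and b = −⟨μ₂, α_i⟩. The elements E^{(a+1)}, F^{(1)} of the first factor and E^{(1)}, F^{(b+1)}
of the second satisfy the Chevalley–Serre relations of g, so the F_γ and E_γ inherit the structure
constants of g (`exists_lieHom`, `exists_realization`). The half Casimir Ω = Σ F_γ ⊗ E_γ satisfies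
[E^{(a+1)} ⊗ 1 + 1 ⊗ E^{(1)}, Ω] = S₁ ⊗ E^{(1)} and its analogue for F. The image of S₂ is S₂ ⊗ 1 +
1 ⊗ S₂ − [1 ⊗ S₁, Ω]; bracketing with it produces all prescribed formulas, and the quadratic
relations reduce to the Jacobi identity (`HalfCoproduct`).

The deep relation is that the images of the S₂_i commute (`lie_s₂_s₂`). It follows from an identity
inside each factor, `lie_s_e_sub`, proved with the analogues `modeJ`, `modeX` of Drinfeld's J(h_i),
J(e_k). At isolated nodes the extra hypothesis is the rank one computation `lie_tmul_third_mode`.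

Uniqueness holds because E_i^{(1)}, F_i^{(1)} and S₂_i generate Y_μ for antidominant μ
(`algHom_ext`). -/

section CommutatorLie
attribute [local instance 100] LieRing.ofAssociativeRing LieAlgebra.ofAssociativeAlgebra

/-! ### Commutator calculus in associative rings. -/

namespace RingLie

variable {A : Type*} [Ring A]

theorem leibniz (a b c : A) : ⁅a, ⁅b, c⁆⁆ = ⁅⁅a, b⁆, c⁆ + ⁅b, ⁅a, c⁆⁆ := leibniz_lie a b c

theorem lie_mul (a b c : A) : ⁅a, b * c⁆ = ⁅a, b⁆ * c + b * ⁅a, c⁆ := by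
  simp only [Ring.lie_def]; noncomm_ring

theorem mul_lie (a b c : A) : ⁅a * b, c⁆ = a * ⁅b, c⁆ + ⁅a, c⁆ * b := by
  simp only [Ring.lie_def]; noncomm_ring

theorem add (a b c : A) : ⁅a, b + c⁆ = ⁅a, b⁆ + ⁅a, c⁆ := lie_add a b c
theorem add_left (a b c : A) : ⁅a + b, c⁆ = ⁅a, c⁆ + ⁅b, c⁆ := add_lie a b c
theorem sub (a b c : A) : ⁅a, b - c⁆ = ⁅a, b⁆ - ⁅a, c⁆ := lie_sub a b c
theorem sub_left (a b c : A) : ⁅a - b, c⁆ = ⁅a, c⁆ - ⁅b, c⁆ := sub_lie a b c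
theorem neg (a b : A) : ⁅a, -b⁆ = -⁅a, b⁆ := lie_neg a b
theorem neg_left (a b : A) : ⁅-a, b⁆ = -⁅a, b⁆ := neg_lie a b
theorem skew (a b : A) : ⁅a, b⁆ = -⁅b, a⁆ := (lie_skew a b).symm
theorem self (a : A) : ⁅a, a⁆ = 0 := lie_self a
theorem zero (a : A) : ⁅a, (0 : A)⁆ = 0 := lie_zero a
theorem zero_left (a : A) : ⁅(0 : A), a⁆ = 0 := zero_lie a
theorem one (a : A) : ⁅a, (1 : A)⁆ = 0 := by simp [Ring.lie_def]
theorem one_left (a : A) : ⁅(1 : A), a⁆ = 0 := by simp [Ring.lie_def]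

theorem sum {ι : Type*} (s : Finset ι) (a : A) (x : ι → A) :
    ⁅a, ∑ i ∈ s, x i⁆ = ∑ i ∈ s, ⁅a, x i⁆ := by
  simp [Ring.lie_def, Finset.mul_sum, Finset.sum_mul]

theorem sum_left {ι : Type*} (s : Finset ι) (a : A) (x : ι → A) :
    ⁅∑ i ∈ s, x i, a⁆ = ∑ i ∈ s, ⁅x i, a⁆ := by
  simp [Ring.lie_def, Finset.mul_sum, Finset.sum_mul]

variable {S : Type*} [CommRing S] [Algebra S A]

theorem smul (c : S) (a b : A) : ⁅a, c • b⁆ = c • ⁅a, b⁆ := by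
  simp [Ring.lie_def, smul_sub]

theorem smul_left (c : S) (a b : A) : ⁅c • a, b⁆ = c • ⁅a, b⁆ := by
  simp [Ring.lie_def, smul_sub]

end RingLie
end CommutatorLie

/-! ### Brackets of Cartan modes with [e_p, f_q] through generating series. -/

namespace Levendorskii

section PowerSeriesIdentity

variable {S B : Type*} [CommRing S] [Ring B] [Algebra S B]

/-- The generating-series form of the commutator of a Cartan current with `[e, f]`, up to a
multiple of `y`. -/
theorem exists_lie_lie_eq (x κ y : S) {H e f E E' F F' R R' : B}
    (hE : E = e + x • (E' + κ • E)) (hF : F = f + x • (F' - κ • F))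
    (h₁ : ⁅H, e⁆ = (2 * κ * x) • (E * H) + y • R)
    (h₂ : ⁅H, f⁆ = -(2 * κ * x) • (F * H) + y • R') :
    ∃ R'' : B, ⁅H, ⁅e, f⁆⁆ = (2 * κ * x ^ 2) • ((⁅E', F⁆ - ⁅E, F'⁆) * H) + y • R'' := by
  have he : e = E - x • (E' + κ • E) := eq_sub_of_add_eq hE.symm
  have hf : f = F - x • (F' - κ • F) := eq_sub_of_add_eq hF.symm
  have k₁ : H * e = e * H + (2 * κ * x) • (E * H) + y • R := by
    rw [add_assoc, ← h₁, Ring.lie_def]; abel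
  have k₂ : H * f = f * H + -(2 * κ * x) • (F * H) + y • R' := by
    rw [add_assoc, ← h₂, Ring.lie_def]; abel
  refine ⟨⁅R, f⁆ + ⁅e, R'⁆ + (2 * κ * x) • (E * R' + F * R), ?_⟩
  have : ⁅H, ⁅e, f⁆⁆ = (2 * κ * x) • ((E * f - f * E - e * F + F * e
      - (2 * κ * x) • (E * F - F * E)) * H)
      + y • (⁅R, f⁆ + ⁅e, R'⁆ + (2 * κ * x) • (E * R' + F * R)) := by
    have : ⁅H, ⁅e, f⁆⁆ = ⁅H, e⁆ * f - f * ⁅H, e⁆ + e * ⁅H, f⁆ - ⁅H, f⁆ * e := by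
      simp only [Ring.lie_def]; noncomm_ring
    rw [this, h₁, h₂]
    have e1 : E * H * f = E * (f * H + -(2 * κ * x) • (F * H) + y • R') := by
      rw [mul_assoc, k₂]
    have e2 : F * H * e = F * (e * H + (2 * κ * x) • (E * H) + y • R) := by
      rw [mul_assoc, k₁]
    simp only [add_mul, smul_mul_assoc, e1, e2, Ring.lie_def]
    simp only [mul_add, add_mul, sub_mul, mul_smul_comm, smul_mul_assoc, mul_assoc]
    module
  rw [this]
  -- After substituting for e and f, [E, f] − [e, F] becomes x([E', F] − [E, F']) + 2κx[E, F]. The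
  -- last term cancels against the one created by moving H to the right.
  congr 1
  rw [he, hf]
  simp only [mul_add, add_mul, mul_sub, sub_mul, mul_smul_comm, smul_mul_assoc, mul_assoc,
    Ring.lie_def]
  module

end PowerSeriesIdentity

section Twist

open Finset.HasAntidiagonal (antidiagonal)

variable {A : Type*} [Ring A] [Algebra ℂ A]

/-- The coefficients `(τ + κ) ^ m x_p`, where `τ` is the shift `x_p ↦ x_{p+1}`. -/
def twist (κ : ℂ) (x : ℕ → A) : ℕ → ℕ → A
  | 0, p => x p
  | m + 1, p => twist κ x m (p + 1) + κ • twist κ x m p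

/-- Solving the recursion in n with every H moved to the right replaces the shift τ by τ + κ at each
step. The recursion is assumed only in the range used, because the later inductions know it only up
to a bounded degree. -/
theorem lie_eq_sum_twist (κ : ℂ) (H x : ℕ → A) (h0 : ∀ p, ⁅H 0, x p⁆ = 0) (n p : ℕ)
    (hx : ∀ k r, k ≤ n → k + r ≤ n + p →
      ⁅H (k + 1), x r⁆ = ⁅H k, x (r + 1)⁆ + κ • (H k * x r + x r * H k)) :
    ⁅H (n + 1), x p⁆ =
      (2 * κ) • ∑ mr ∈ antidiagonal n, twist κ x mr.1 p * H mr.2 := by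
  induction n generalizing p with
  | zero =>
    have h0' := h0 p
    rw [Ring.lie_def, sub_eq_zero] at h0'
    rw [hx 0 p le_rfl (by simp), h0]
    simp only [Finset.Nat.antidiagonal_zero, Finset.sum_singleton, twist, h0']
    module
  | succ n ih =>
    have h1 := ih (p + 1) fun k r hk hr => hx k r (by omega) (by omega)
    have h2 := ih p fun k r hk hr => hx k r (by omega) (by omega)
    have h3 : H (n + 1) * x p = x p * H (n + 1) +
        (2 * κ) • ∑ mr ∈ antidiagonal n, twist κ x mr.1 p * H mr.2 := by
      rw [← h2, Ring.lie_def]; abel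
    rw [hx (n + 1) p le_rfl le_rfl, h1, h3, Finset.Nat.antidiagonal_succ]
    simp only [Finset.sum_cons, Finset.sum_map, Function.Embedding.prodMap,
      Function.Embedding.coeFn_mk, Function.Embedding.refl_apply, Nat.succ_eq_add_one,
      Prod.map, twist, add_mul, Finset.sum_add_distrib, smul_mul_assoc, ← Finset.smul_sum]
    module

/-- The commutator of `H_{n+2}` with `[e_p, f_q]`. -/
theorem lie_lie_eq_sum (κ : ℂ) (H e f : ℕ → A) (he0 : ∀ p, ⁅H 0, e p⁆ = 0)
    (hf0 : ∀ p, ⁅H 0, f p⁆ = 0) (n p q : ℕ)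
    (he : ∀ k r, k ≤ n + 1 → k + r ≤ n + 1 + p →
      ⁅H (k + 1), e r⁆ = ⁅H k, e (r + 1)⁆ + κ • (H k * e r + e r * H k))
    (hf : ∀ k r, k ≤ n + 1 → k + r ≤ n + 1 + q →
      ⁅H (k + 1), f r⁆ = ⁅H k, f (r + 1)⁆ - κ • (H k * f r + f r * H k)) :
    ⁅H (n + 2), ⁅e p, f q⁆⁆ = (2 * κ) • ∑ mr ∈ antidiagonal n,
      (∑ ab ∈ antidiagonal mr.1,
        (⁅twist κ e ab.1 (p + 1), twist (-κ) f ab.2 q⁆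
          - ⁅twist κ e ab.1 p, twist (-κ) f ab.2 (q + 1)⁆)) * H mr.2 := by
  have ke : ∀ k, k ≤ n + 1 → ⁅H (k + 1), e p⁆ =
      (2 * κ) • ∑ mr ∈ antidiagonal k, twist κ e mr.1 p * H mr.2 := fun k hk =>
    lie_eq_sum_twist κ H e he0 k p fun k' r h1 h2 => he k' r (by omega) (by omega)
  have kf : ∀ k, k ≤ n + 1 → ⁅H (k + 1), f q⁆ =
      (2 * -κ) • ∑ mr ∈ antidiagonal k, twist (-κ) f mr.1 q * H mr.2 := fun k hk =>
    lie_eq_sum_twist (-κ) H f hf0 k q fun k' r h1 h2 => by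
      rw [hf k' r (by omega) (by omega), neg_smul, sub_eq_add_neg]
  -- The computation takes place in the power series ring over its centre, so that X and κ are
  -- scalars. The factor y = X^(n+3) absorbs the degrees about which the hypotheses say nothing.
  let Z := Subring.center (PowerSeries A)
  let x : Z := ⟨PowerSeries.X, Subring.mem_center_iff.2 fun g => (PowerSeries.commute_X g).eq⟩
  let y : Z := x ^ (n + 3)
  let κ' : Z := ⟨PowerSeries.C (algebraMap ℂ A κ), Subring.mem_center_iff.2 fun g => by
    ext m
    simp [Algebra.commutes]⟩
  let _ : Algebra Z (PowerSeries A) :=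
    Z.subtype.toAlgebra' fun c g => (Subring.mem_center_iff.1 c.2 g).symm
  have hx : ∀ g : PowerSeries A, x • g = PowerSeries.X * g := fun g => rfl
  have hy : ∀ g : PowerSeries A, y • g = PowerSeries.X ^ (n + 3) * g := fun g => rfl
  have hκ : ∀ g : PowerSeries A, κ' • g = PowerSeries.C (algebraMap ℂ A κ) * g := fun g => rfl
  have hκx : ∀ (k : ℕ) (g : PowerSeries A), (2 * κ' * x ^ k) • g =
      PowerSeries.X ^ k * (PowerSeries.C (algebraMap ℂ A (2 * κ)) * g) := fun k g => by
    have h2 : ∀ g' : PowerSeries A, (2 : Z) • g' = PowerSeries.C (algebraMap ℂ A 2) * g' :=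
      fun g' => by rw [ofNat_smul_eq_nsmul, map_ofNat, map_ofNat, nsmul_eq_mul]; rfl
    have h3 : ∀ g' : PowerSeries A, x ^ k • g' = PowerSeries.X ^ k * g' := fun g' => rfl
    rw [mul_comm, mul_smul, mul_smul, hκ, map_mul, map_mul, mul_assoc, h2, h3]
  -- The twisted series is the geometric series of X(τ + κ) applied to e_p; this is its functional
  -- equation.
  have hE : ∀ p, PowerSeries.mk (fun m => twist κ e m p) = PowerSeries.C (e p) +
      x • (PowerSeries.mk (fun m => twist κ e m (p + 1)) +
        κ' • PowerSeries.mk (fun m => twist κ e m p)) := fun p => by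
    ext m
    cases m with
    | zero => simp [hx, twist]
    | succ m => simp [hx, hκ, twist, PowerSeries.coeff_succ_X_mul, Algebra.smul_def]
  have hF : ∀ q, PowerSeries.mk (fun m => twist (-κ) f m q) = PowerSeries.C (f q) +
      x • (PowerSeries.mk (fun m => twist (-κ) f m (q + 1)) -
        κ' • PowerSeries.mk (fun m => twist (-κ) f m q)) := fun p => by
    ext m
    cases m with
    | zero => simp [hx, twist]
    | succ m => simp [hx, hκ, twist, PowerSeries.coeff_succ_X_mul,
        Algebra.smul_def, sub_eq_add_neg]
  have key : ∀ φ : PowerSeries A, (∀ m < n + 3, PowerSeries.coeff m φ = 0) → ∃ R, φ = y • R :=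
    fun φ h => PowerSeries.X_pow_dvd_iff.2 h
  obtain ⟨R, hR⟩ := key (⁅PowerSeries.mk H, PowerSeries.C (e p)⁆ -
      (2 * κ' * x) • (PowerSeries.mk (fun m => twist κ e m p) * PowerSeries.mk H)) (by
    intro m hm
    have := hκx 1
    simp only [pow_one] at this
    rw [this, map_sub, Ring.lie_def, map_sub, PowerSeries.coeff_mul_C, PowerSeries.coeff_C_mul]
    cases m with
    | zero => simpa [Ring.lie_def, PowerSeries.coeff_zero_X_mul] using he0 p
    | succ m =>
      rw [PowerSeries.coeff_succ_X_mul, PowerSeries.coeff_C_mul, PowerSeries.coeff_mul]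
      simp only [PowerSeries.coeff_mk]
      rw [← Ring.lie_def, ke m (by omega), Algebra.smul_def, sub_self])
  obtain ⟨R', hR'⟩ := key (⁅PowerSeries.mk H, PowerSeries.C (f q)⁆ +
      (2 * κ' * x) • (PowerSeries.mk (fun m => twist (-κ) f m q) * PowerSeries.mk H)) (by
    intro m hm
    have := hκx 1
    simp only [pow_one] at this
    rw [this, map_add, Ring.lie_def, map_sub, PowerSeries.coeff_mul_C, PowerSeries.coeff_C_mul]
    cases m with
    | zero => simpa [Ring.lie_def, PowerSeries.coeff_zero_X_mul] using hf0 q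
    | succ m =>
      rw [PowerSeries.coeff_succ_X_mul, PowerSeries.coeff_C_mul, PowerSeries.coeff_mul]
      simp only [PowerSeries.coeff_mk]
      rw [← Ring.lie_def, kf m (by omega), ← Algebra.smul_def, ← add_smul]
      simp)
  obtain ⟨R'', h⟩ := exists_lie_lie_eq x κ' y (hE p) (hF q)
    (by rw [← hR]; abel) (by rw [← hR']; module)
  -- Degree n + 2 is the last one not hidden by y.
  have h' := congrArg (PowerSeries.coeff (n + 2)) h
  rw [hκx, hy, map_add, PowerSeries.coeff_X_pow_mul' _ (n + 3), if_neg (by omega), add_zero,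
    PowerSeries.coeff_X_pow_mul, PowerSeries.coeff_C_mul, PowerSeries.coeff_mul,
    ← Algebra.smul_def] at h'
  have hC : ⁅PowerSeries.C (e p), PowerSeries.C (f q)⁆ = PowerSeries.C ⁅e p, f q⁆ := by
    simp [Ring.lie_def]
  rw [hC, Ring.lie_def, map_sub, PowerSeries.coeff_mul_C, PowerSeries.coeff_C_mul,
    PowerSeries.coeff_mk, ← Ring.lie_def] at h'
  rw [h']
  congr 1
  refine Finset.sum_congr rfl fun mr _ => ?_
  have hs : ∀ (u v : ℕ → A) (N : ℕ), (∑ ab ∈ antidiagonal N, v ab.1 * u ab.2) =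
      ∑ ab ∈ antidiagonal N, v ab.2 * u ab.1 := fun u v N =>
    Finset.Nat.sum_antidiagonal_swap (f := fun ab => v ab.2 * u ab.1)
  rw [PowerSeries.coeff_mk]
  congr 1
  simp only [Ring.lie_def, map_sub, PowerSeries.coeff_mul, PowerSeries.coeff_mk,
    Finset.sum_sub_distrib]
  exact congrArg₂ _ (congrArg₂ _ rfl (hs (fun m => twist κ e m (p + 1))
    (fun m => twist (-κ) f m q) _)) (congrArg₂ _ rfl (hs (fun m => twist κ e m p)
    (fun m => twist (-κ) f m (q + 1)) _))

end Twist
end Levendorskii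

/-! ### Propagation of vanishing under shifts, and the effect of a failure of [e_p, f_q] to depend
on p + q. -/

namespace Levendorskii

section Vanishing

variable {A : Type*} [AddCommGroup A] [Module ℂ A]

theorem eq_zero_of_det_ne_zero {α β γ δ : ℂ} (h : α * δ - β * γ ≠ 0) {x y : A}
    (h₁ : α • x + β • y = 0) (h₂ : γ • x + δ • y = 0) : x = 0 ∧ y = 0 := by
  constructor
  · refine (smul_eq_zero.1 (?_ : (α * δ - β * γ) • x = 0)).resolve_left h
    linear_combination (norm := module) δ • h₁ - β • h₂
  · refine (smul_eq_zero.1 (?_ : (α * δ - β * γ) • y = 0)).resolve_left h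
    linear_combination (norm := module) α • h₂ - γ • h₁

/-- `G p q` stands for a relation between modes p and q. Two operators acting by independent
combinations of the two shifts allow each shift to be used separately. -/
theorem forall_eq_zero_of_det_ne_zero {α β γ δ : ℂ} (h : α * δ - β * γ ≠ 0) (G : ℕ → ℕ → A)
    (h₀ : G 0 0 = 0) (h₁ : ∀ p q, G p q = 0 → α • G (p + 1) q + β • G p (q + 1) = 0)
    (h₂ : ∀ p q, G p q = 0 → γ • G (p + 1) q + δ • G p (q + 1) = 0) (p q : ℕ) : G p q = 0 := by
  induction p with
  | zero =>
    induction q with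
    | zero => exact h₀
    | succ q ih => exact (eq_zero_of_det_ne_zero h (h₁ 0 q ih) (h₂ 0 q ih)).2
  | succ p ih => exact (eq_zero_of_det_ne_zero h (h₁ p q ih) (h₂ p q ih)).1

/-- A symmetric double sequence is zero if its vanishing is preserved by the first two power sums
of the two shifts. -/
theorem forall_eq_zero_of_symmetric (G : ℕ → ℕ → A) (hs : ∀ p q, G p q = G q p) (h₀ : G 0 0 = 0)
    (h₁ : ∀ p q, G p q = 0 → G (p + 1) q + G p (q + 1) = 0)
    (h₂ : ∀ p q, G p q = 0 → G (p + 2) q + G p (q + 2) = 0) (p q : ℕ) : G p q = 0 := by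
  have key : ∀ n, ∀ p q, p + q = n → G p q = 0 := by
    intro n
    induction n using Nat.strong_induction_on with
    | _ n ih =>
      have two : ∀ x : A, x + x = 0 → x = 0 := fun x hx => by
        have : (2 : ℂ) • x = 0 := by rw [two_smul, hx]
        simpa using this
      have base : G 0 n = 0 := by
        rcases n with - | - | n
        · exact h₀
        · have := h₁ 0 0 h₀
          rw [hs (0 + 1)] at this
          exact two _ this
        -- The sums G(2,n) + G(0,n+2), G(1,n+1) + G(0,n+2) and G(2,n) + G(1,n+1) vanish; the first
        -- plus the second minus the third is 2G(0,n+2).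
        · have e1 := h₂ 0 n (ih n (by omega) 0 n (by omega))
          have e2 := h₁ 0 (n + 1) (ih (n + 1) (by omega) 0 (n + 1) (by omega))
          have e3 := h₁ 1 n (ih (n + 1) (by omega) 1 n (by omega))
          simp only [Nat.zero_add, Nat.reduceAdd, Nat.add_assoc] at e1 e2 e3
          apply two
          linear_combination (norm := module) e1 + e2 - e3
      intro p
      induction p with
      | zero => intro q hq; rw [← hq, Nat.zero_add] at base; exact base
      | succ p ihp =>
        intro q hq
        have e := h₁ p q (ih (p + q) (by omega) p q rfl)
        rwa [ihp (q + 1) (by omega), add_zero] at e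
  exact key _ p q rfl

end Vanishing

section Twist

open Finset.HasAntidiagonal (antidiagonal)

variable {A : Type*} [Ring A] [Algebra ℂ A]

/-- A twist adds to a shift only multiples of terms of lower degree, where the difference is zero;
so only the purely shifted term in top degree M can contribute. -/
theorem lie_twist_sub (κ : ℂ) (e f : ℕ → A) (M : ℕ) (X : A)
    (h : ∀ p q, p + q ≤ M → ⁅e (p + 1), f q⁆ - ⁅e p, f (q + 1)⁆ = if p + q = M then X else 0)
    (a b p q : ℕ) (hM : a + b + p + q ≤ M) :
    ⁅twist κ e a (p + 1), twist (-κ) f b q⁆ - ⁅twist κ e a p, twist (-κ) f b (q + 1)⁆ =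
      if a + b + p + q = M then X else 0 := by
  induction a generalizing p with
  | zero =>
    induction b generalizing q with
    | zero => simpa [twist] using h p q (by omega)
    | succ b ih =>
      have e1 := ih (q + 1) (by omega)
      have e2 := ih q (by omega)
      rw [if_neg (by omega)] at e2
      rw [show 0 + (b + 1) + p + q = 0 + b + p + (q + 1) by omega, ← e1]
      simp only [twist, RingLie.add, RingLie.smul] at e2 ⊢
      linear_combination (norm := module) (-κ) • e2
  | succ a ih =>
    have e1 := ih (p + 1) (by omega)
    have e2 := ih p (by omega)
    rw [if_neg (by omega)] at e2
    rw [show a + 1 + b + p + q = a + b + (p + 1) + q by omega, ← e1]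
    simp only [twist, RingLie.add_left, RingLie.smul_left]
    linear_combination (norm := module) κ • e2

/-- X is the first failure of [e_p, f_q] to depend on p + q alone. Because H_r vanishes for r < N
and X lives in a single degree, only r = N survives in `lie_lie_eq_sum`, and each of the m + 1 pairs
on the antidiagonal contributes X. When κ ≠ 0 the factor is nonzero, so a second evaluation of the
same bracket can force X = 0. -/
theorem lie_lie_eq_smul (κ : ℂ) (H e f : ℕ → A) (N m p q : ℕ) (X : A)
    (hH : ∀ r < N, H r = 0) (hN : H N = 1)
    (h : ∀ p' q', p' + q' ≤ m + p + q → ⁅e (p' + 1), f q'⁆ - ⁅e p', f (q' + 1)⁆ =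
      if p' + q' = m + p + q then X else 0)
    (he : ∀ k r, k ≤ N + m + 1 → k + r ≤ N + m + 1 + p →
      ⁅H (k + 1), e r⁆ = ⁅H k, e (r + 1)⁆ + κ • (H k * e r + e r * H k))
    (hf : ∀ k r, k ≤ N + m + 1 → k + r ≤ N + m + 1 + q →
      ⁅H (k + 1), f r⁆ = ⁅H k, f (r + 1)⁆ - κ • (H k * f r + f r * H k)) :
    ⁅H (N + m + 2), ⁅e p, f q⁆⁆ = (2 * κ * (m + 1)) • X := by
  have h0 : ∀ x : A, ⁅H 0, x⁆ = 0 := fun x => by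
    rcases Nat.eq_zero_or_pos N with h | h
    · rw [← h, hN, RingLie.one_left]
    · rw [hH 0 h, RingLie.zero_left]
  rw [lie_lie_eq_sum κ H e f (fun _ => h0 _) (fun _ => h0 _) (N + m) p q he hf,
    mul_smul (2 * κ) ((m : ℂ) + 1) X]
  congr 1
  have hW : ∀ m' ≤ m, (∑ ab ∈ antidiagonal m', (⁅twist κ e ab.1 (p + 1), twist (-κ) f ab.2 q⁆
      - ⁅twist κ e ab.1 p, twist (-κ) f ab.2 (q + 1)⁆)) = if m' = m then ((m : ℂ) + 1) • X else 0 := by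
    intro m' hm'
    rw [Finset.sum_congr rfl fun ab hab => ?_, Finset.sum_const, Finset.Nat.card_antidiagonal]
    rotate_left
    · exact if m' = m then X else 0
    · rw [Finset.HasAntidiagonal.mem_antidiagonal] at hab
      rw [lie_twist_sub κ e f (m + p + q) X h _ _ _ _ (by omega)]
      split_ifs <;> first | rfl | omega
    · split_ifs with h
      · rw [h, ← Nat.cast_smul_eq_nsmul ℂ]; push_cast; rfl
      · simp
  rw [Finset.sum_eq_single (m, N)]
  · rw [hW m le_rfl, if_pos rfl, hN, mul_one]
  · rintro ⟨m', r⟩ hmr hne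
    rw [Finset.HasAntidiagonal.mem_antidiagonal] at hmr
    simp only at hmr ⊢
    rcases Nat.lt_or_ge r N with hr | hr
    · rw [hH r hr, mul_zero]
    · rw [hW m' (by omega), if_neg, zero_mul]
      rintro rfl
      exact hne (Prod.ext rfl (by simp; omega))
  · intro h
    exact absurd (Finset.HasAntidiagonal.mem_antidiagonal.2 (by simp; omega)) h

/-- Without any failure all differences in `lie_lie_eq_sum` are zero. This is the source of
commutativity of the Cartan modes. -/
theorem lie_lie_eq_zero (κ : ℂ) (H e f : ℕ → A) (n p q : ℕ)
    (h0 : ∀ x : A, ⁅H 0, x⁆ = 0)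
    (h : ∀ p' q', ⁅e (p' + 1), f q'⁆ = ⁅e p', f (q' + 1)⁆)
    (he : ∀ k r, ⁅H (k + 1), e r⁆ = ⁅H k, e (r + 1)⁆ + κ • (H k * e r + e r * H k))
    (hf : ∀ k r, ⁅H (k + 1), f r⁆ = ⁅H k, f (r + 1)⁆ - κ • (H k * f r + f r * H k)) :
    ⁅H (n + 2), ⁅e p, f q⁆⁆ = 0 := by
  rw [lie_lie_eq_sum κ H e f (fun _ => h0 _) (fun _ => h0 _) n p q
    (fun _ _ _ _ => he _ _) (fun _ _ _ _ => hf _ _)]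
  rw [Finset.sum_eq_zero, smul_zero]
  intro mr _
  rw [Finset.sum_eq_zero, zero_mul]
  intro ab _
  rw [lie_twist_sub κ e f (ab.1 + ab.2 + p + q) 0 (by simp [h]) _ _ _ _ le_rfl]
  simp

/-- The third logarithmic Cartan mode acts by the square of the shift, up to a multiple of the
identity. -/
theorem lie_log_three (κ : ℂ) (h₁ h₂ h₃ x x' x'' : A) (h12 : ⁅h₁, h₂⁆ = 0)
    (a1 : ⁅h₁, x⁆ = (2 * κ) • x) (a1' : ⁅h₁, x'⁆ = (2 * κ) • x')
    (a1'' : ⁅h₁, x''⁆ = (2 * κ) • x'')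
    (a2 : ⁅h₂, x⁆ = ⁅h₁, x'⁆ + κ • (h₁ * x + x * h₁))
    (a2' : ⁅h₂, x'⁆ = ⁅h₁, x''⁆ + κ • (h₁ * x' + x' * h₁))
    (a3 : ⁅h₃, x⁆ = ⁅h₂, x'⁆ + κ • (h₂ * x + x * h₂)) :
    ⁅h₃ - h₂ * h₁ + (1 / 3 : ℂ) • (h₁ * h₁ * h₁), x⁆ =
      (2 * κ) • x'' + (2 / 3 * κ ^ 3) • x := by
  have e1 : h₁ * x = x * h₁ + (2 * κ) • x := by rw [← a1, Ring.lie_def]; abel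
  have e1' : h₁ * x' = x' * h₁ + (2 * κ) • x' := by rw [← a1', Ring.lie_def]; abel
  have b2 : ⁅h₂, x⁆ = (2 * κ) • x' + (2 * κ) • (x * h₁) + (2 * κ ^ 2) • x := by
    rw [a2, a1', e1]; module
  have b2' : ⁅h₂, x'⁆ = (2 * κ) • x'' + (2 * κ) • (x' * h₁) + (2 * κ ^ 2) • x' := by
    rw [a2', a1'', e1']; module
  have e2 : h₂ * x = x * h₂ + (2 * κ) • x' + (2 * κ) • (x * h₁) + (2 * κ ^ 2) • x := by
    rw [add_assoc, add_assoc, ← add_assoc ((2 * κ) • x'), ← b2, Ring.lie_def]; abel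
  have c : h₂ * h₁ = h₁ * h₂ := by rw [Ring.lie_def, sub_eq_zero] at h12; exact h12.symm
  have p1 : ⁅h₂ * h₁, x⁆ = h₂ * ⁅h₁, x⁆ + ⁅h₂, x⁆ * h₁ := RingLie.mul_lie _ _ _
  have p2 : ⁅h₁ * h₁ * h₁, x⁆ = h₁ * (h₁ * ⁅h₁, x⁆) + h₁ * (⁅h₁, x⁆ * h₁) + ⁅h₁, x⁆ * h₁ * h₁ := by
    simp only [Ring.lie_def]; noncomm_ring
  rw [RingLie.add_left, RingLie.sub_left, RingLie.smul_left, a3, b2', p1, p2, a1, b2]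
  simp only [mul_smul_comm, smul_mul_assoc, mul_add, add_mul, e1, e2, smul_add]
  simp only [← mul_assoc, e1, add_mul, smul_mul_assoc, smul_add]
  module

/-- The obstruction to the relation between `h` and `e` is antisymmetric. -/
theorem antisymm_of_lie_eq (κ : ℂ) (e₀ e₁ x₀ x₁ f : A)
    (h : ⁅e₁, x₀⁆ - ⁅e₀, x₁⁆ = κ • (e₀ * x₀ + x₀ * e₀)) :
    ⁅⁅e₁, f⁆, x₀⁆ - ⁅⁅e₀, f⁆, x₁⁆ - κ • (⁅e₀, f⁆ * x₀ + x₀ * ⁅e₀, f⁆) =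
      -(⁅⁅x₁, f⁆, e₀⁆ - ⁅⁅x₀, f⁆, e₁⁆ - κ • (⁅x₀, f⁆ * e₀ + e₀ * ⁅x₀, f⁆)) := by
  -- By the Leibniz rule, the bracket of the quadratic relation with f is the sum of the two
  -- obstructions.
  have h' := congrArg (fun z => ⁅z, f⁆) h
  simp only [Ring.lie_def, mul_add, add_mul, mul_sub, sub_mul, smul_mul_assoc, mul_smul_comm,
    mul_assoc] at h' ⊢
  linear_combination (norm := module) h'

end Twist
end Levendorskii

/-! ### The low-degree relations, and how derivations act on quadratic and Serre relations. -/

namespace Levendorskii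

/-- The value of the Cartan mode of degree `k ≤ N + 2`. -/
noncomputable def lowCartan {A : Type*} [Ring A] [Algebra ℂ A] (N : ℕ) (s₁ s₂ : A) (k : ℕ) : A :=
  if k < N then 0 else if k = N then 1 else if k = N + 1 then s₁ else s₂ + (1 / 2 : ℂ) • (s₁ * s₁)

/-- Elements of an algebra satisfying the finite set of relations of the Levendorskii-type
presentation of a shifted Yangian. Here `e i n` and `f i n` stand for `E_i^{(n+1)}` and
`F_i^{(n+1)}`, and `N i = -⟨μ, α_i⟩`. -/
structure LowRelations {I : Type*} (a : I → I → ℤ) (N : I → ℕ) {A : Type*} [Ring A]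
    [Algebra ℂ A] (s₁ s₂ : I → A) (e f : I → ℕ → A) : Prop where
  symm : ∀ i j, a i j = a j i
  diag : ∀ i, a i i = 2
  off : ∀ i j, i ≠ j → a i j = 0 ∨ a i j = -1
  s₂_s₂ : ∀ i j, ⁅s₂ i, s₂ j⁆ = 0
  s₂_s₁ : ∀ i j, ⁅s₂ i, s₁ j⁆ = 0
  s₁_e : ∀ i j, ⁅s₁ i, e j 0⁆ = (a i j : ℂ) • e j 0
  s₁_f : ∀ i j, ⁅s₁ i, f j 0⁆ = -(a i j : ℂ) • f j 0
  s₂_e : ∀ i j n, ⁅s₂ i, e j n⁆ = (a i j : ℂ) • e j (n + 1)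
  s₂_f : ∀ i j n, ⁅s₂ i, f j n⁆ = -(a i j : ℂ) • f j (n + 1)
  ee : ∀ i j, ⁅e i 1, e j 0⁆ - ⁅e i 0, e j 1⁆ =
    ((a i j : ℂ) / 2) • (e i 0 * e j 0 + e j 0 * e i 0)
  ff : ∀ i j, ⁅f i 1, f j 0⁆ - ⁅f i 0, f j 1⁆ =
    (-((a i j : ℂ) / 2)) • (f i 0 * f j 0 + f j 0 * f i 0)
  serre_e : ∀ i j, a i j = -1 → ⁅e i 0, ⁅e i 0, e j 0⁆⁆ = 0
  serre_f : ∀ i j, a i j = -1 → ⁅f i 0, ⁅f i 0, f j 0⁆⁆ = 0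
  comm_e : ∀ i j, a i j = 0 → ⁅e i 0, e j 0⁆ = 0
  comm_f : ∀ i j, a i j = 0 → ⁅f i 0, f j 0⁆ = 0
  ef_ne : ∀ i j, i ≠ j → ⁅e i 0, f j 0⁆ = 0
  ef_low : ∀ i k, 1 ≤ k → k ≤ N i + 2 → ∃ p q, p + q + 1 = k ∧
    ⁅e i p, f i q⁆ = lowCartan (N i) (s₁ i) (s₂ i) k
  ef_top : ∀ i, (∃ j, a i j = -1) ∨ ∃ p q, p + q + 1 = N i + 3 ∧ ⁅s₂ i, ⁅e i p, f i q⁆⁆ = 0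

/-- The Cartan modes determined by `e` and `f`. -/
def cartanMode {I : Type*} (N : I → ℕ) {A : Type*} [Ring A] (e f : I → ℕ → A) (i : I) : ℕ → A
  | 0 => if N i = 0 then 1 else 0
  | k + 1 => ⁅e i k, f i 0⁆

section Family

/-! Statements for one family of generators: `x = e` with `κ = a / 2`, or `x = f` with
`κ = -a / 2`. -/

variable {I A : Type*} [Ring A] [Algebra ℂ A]

/-- The quadratic relation between two families of generators. -/
def quadRel (c : ℂ) (x x' y y' : A) : A := ⁅x', y⁆ - ⁅x, y'⁆ - c • (x * y + y * x)

theorem lie_quadRel (c : ℂ) (z x x' y y' : A) : ⁅z, quadRel c x x' y y'⁆ =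
    quadRel c ⁅z, x⁆ ⁅z, x'⁆ y y' + quadRel c x x' ⁅z, y⁆ ⁅z, y'⁆ := by
  simp only [quadRel, RingLie.sub, RingLie.smul, RingLie.add]
  rw [RingLie.leibniz z, RingLie.leibniz z, RingLie.lie_mul, RingLie.lie_mul]
  module

theorem quadRel_smul_left (c d : ℂ) (x x' y y' : A) :
    quadRel c (d • x) (d • x') y y' = d • quadRel c x x' y y' := by
  simp only [quadRel, RingLie.smul_left, smul_mul_assoc, mul_smul_comm]; module

theorem quadRel_smul_right (c d : ℂ) (x x' y y' : A) :
    quadRel c x x' (d • y) (d • y') = d • quadRel c x x' y y' := by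
  simp only [quadRel, RingLie.smul, smul_mul_assoc, mul_smul_comm]; module

theorem quadRel_add_left (c : ℂ) (w w' x x' y y' : A) :
    quadRel c (w + x) (w' + x') y y' = quadRel c w w' y y' + quadRel c x x' y y' := by
  simp only [quadRel, RingLie.add_left, add_mul, mul_add]; module

theorem quadRel_add_right (c : ℂ) (x x' w w' y y' : A) :
    quadRel c x x' (w + y) (w' + y') = quadRel c x x' w w' + quadRel c x x' y y' := by
  simp only [quadRel, RingLie.add, add_mul, mul_add]; module

/-- Brackets with `s i` and `s j` act on the relation by combinations of the two shifts whose
determinant is, up to a factor 4, the minor in `hκ`; hence the lowest relation implies all. -/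
theorem quadratic_of_ne {i j : I} {κ : I → I → ℂ} {s : I → A} {x : I → ℕ → A}
    (hs : ∀ i j n, ⁅s i, x j n⁆ = (2 * κ i j) • x j (n + 1))
    (hκ : κ i i * κ j j - κ i j * κ j i ≠ 0)
    (h0 : ⁅x i 1, x j 0⁆ - ⁅x i 0, x j 1⁆ = κ i j • (x i 0 * x j 0 + x j 0 * x i 0)) (p q : ℕ) :
    ⁅x i (p + 1), x j q⁆ - ⁅x i p, x j (q + 1)⁆ = κ i j • (x i p * x j q + x j q * x i p) := by
  have key : ∀ k p q, quadRel (κ i j) (x i p) (x i (p + 1)) (x j q) (x j (q + 1)) = 0 →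
      (2 * κ k i) • quadRel (κ i j) (x i (p + 1)) (x i (p + 1 + 1)) (x j q) (x j (q + 1)) +
      (2 * κ k j) • quadRel (κ i j) (x i p) (x i (p + 1)) (x j (q + 1)) (x j (q + 1 + 1)) = 0 := by
    intro k p q h
    rw [← RingLie.zero (s k), ← h, lie_quadRel, hs, hs, hs, hs, quadRel_smul_left,
      quadRel_smul_right]
  refine sub_eq_zero.1 (forall_eq_zero_of_det_ne_zero (α := 2 * κ i i) (β := 2 * κ i j)
    (γ := 2 * κ j i) (δ := 2 * κ j j) ?_
    (fun p q => quadRel (κ i j) (x i p) (x i (p + 1)) (x j q) (x j (q + 1)))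
    (sub_eq_zero.2 h0) (key i) (key j) p q)
  intro h; exact hκ (by linear_combination h / 4)

/-- With equal indices, s gives only the sum of the two shifts. The relation is symmetric in p and
q, so the sum of their squares suffices in addition; t provides it up to multiples of the relation
itself. -/
theorem quadratic_of_eq {κ c d : ℂ} {s t : A} {x : ℕ → A} (hκ : κ ≠ 0)
    (hs : ∀ n, ⁅s, x n⁆ = (2 * κ) • x (n + 1))
    (ht : ∀ n, ⁅t, x n⁆ = (2 * κ) • x (n + 2) + d • x n)
    (h0 : ⁅x 1, x 0⁆ - ⁅x 0, x 1⁆ = c • (x 0 * x 0 + x 0 * x 0)) (p q : ℕ) :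
    ⁅x (p + 1), x q⁆ - ⁅x p, x (q + 1)⁆ = c • (x p * x q + x q * x p) := by
  have h2κ : 2 * κ ≠ 0 := mul_ne_zero two_ne_zero hκ
  refine sub_eq_zero.1 (forall_eq_zero_of_symmetric
    (fun p q => quadRel c (x p) (x (p + 1)) (x q) (x (q + 1))) ?_ (sub_eq_zero.2 h0) ?_ ?_ p q)
  · intro p q
    simp only [quadRel]
    rw [RingLie.skew (x (p + 1)), RingLie.skew (x p)]
    module
  · intro p q h
    have h' := congrArg (fun z => ⁅s, z⁆) h
    simp only [lie_quadRel, hs, quadRel_smul_left, quadRel_smul_right, RingLie.zero,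
      ← smul_add] at h'
    exact (smul_eq_zero.1 h').resolve_left h2κ
  · intro p q h
    have h' := congrArg (fun z => ⁅t, z⁆) h
    simp only [lie_quadRel, ht, quadRel_smul_left, quadRel_smul_right, RingLie.zero,
      quadRel_add_left, quadRel_add_right] at h'
    simp only [h, smul_zero, add_zero, ← smul_add] at h'
    have := (smul_eq_zero.1 h').resolve_left h2κ
    simpa only [Nat.add_right_comm _ 2 1] using this

/-- The symmetrized Serre relation. -/
def serreRel (x x' y : A) : A := ⁅x, ⁅x', y⁆⁆ + ⁅x', ⁅x, y⁆⁆

theorem lie_serreRel (z x x' y : A) : ⁅z, serreRel x x' y⁆ =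
    serreRel ⁅z, x⁆ x' y + serreRel x ⁅z, x'⁆ y + serreRel x x' ⁅z, y⁆ := by
  simp only [serreRel, RingLie.add]
  rw [RingLie.leibniz z x ⁅x', y⁆, RingLie.leibniz z x' ⁅x, y⁆, RingLie.leibniz z x y,
    RingLie.leibniz z x' y]
  simp only [RingLie.add]
  abel

theorem serreRel_comm (x x' y : A) : serreRel x x' y = serreRel x' x y := add_comm _ _

theorem serreRel_comb₁ (α β : ℂ) (x w x' y : A) : serreRel (α • x + β • w) x' y =
    α • serreRel x x' y + β • serreRel w x' y := by
  simp only [serreRel, RingLie.add, RingLie.add_left, RingLie.smul, RingLie.smul_left]; module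

theorem serreRel_comb₂ (α β : ℂ) (x x' w y : A) : serreRel x (α • x' + β • w) y =
    α • serreRel x x' y + β • serreRel x w y := by
  rw [serreRel_comm, serreRel_comb₁, serreRel_comm x', serreRel_comm w]

theorem serreRel_comb₃ (α β : ℂ) (x x' y w : A) : serreRel x x' (α • y + β • w) =
    α • serreRel x x' y + β • serreRel x x' w := by
  simp only [serreRel, RingLie.add, RingLie.smul]; module

/-- Brackets with s and s' separate the shift of y from the sum of the shifts of the two x's, and t
supplies the sum of their squares. Symmetry in p and p' then reduces everything to the lowest
relation. -/
theorem serreRel_eq_zero {κ₀ κ₁ d₀ d₁ : ℂ} {s s' t : A} {x y : ℕ → A}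
    (hκ : κ₀ ^ 2 - κ₁ ^ 2 ≠ 0) (hκ₀ : κ₀ ≠ 0)
    (hsx : ∀ n, ⁅s, x n⁆ = (2 * κ₀) • x (n + 1)) (hsy : ∀ n, ⁅s, y n⁆ = (2 * κ₁) • y (n + 1))
    (hsx' : ∀ n, ⁅s', x n⁆ = (2 * κ₁) • x (n + 1))
    (hsy' : ∀ n, ⁅s', y n⁆ = (2 * κ₀) • y (n + 1))
    (htx : ∀ n, ⁅t, x n⁆ = (2 * κ₀) • x (n + 2) + d₀ • x n)
    (hty : ∀ n, ⁅t, y n⁆ = (2 * κ₁) • y (n + 2) + d₁ • y n)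
    (h0 : ⁅x 0, ⁅x 0, y 0⁆⁆ = 0) (p p' q : ℕ) :
    serreRel (x p) (x p') (y q) = 0 := by
  have step : ∀ p p' q, serreRel (x p) (x p') (y q) = 0 →
      serreRel (x (p + 1)) (x p') (y q) + serreRel (x p) (x (p' + 1)) (y q) = 0 ∧
      serreRel (x p) (x p') (y (q + 1)) = 0 := by
    intro p p' q h
    have e1 := congrArg (fun z => ⁅s, z⁆) h
    have e2 := congrArg (fun z => ⁅s', z⁆) h
    simp only [lie_serreRel, RingLie.zero, hsx, hsy, hsx', hsy'] at e1 e2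
    have c1 := fun (α : ℂ) (x x' y : A) => serreRel_comb₁ α 0 x 0 x' y
    have c2 := fun (α : ℂ) (x x' y : A) => serreRel_comb₂ α 0 x x' 0 y
    have c3 := fun (α : ℂ) (x x' y : A) => serreRel_comb₃ α 0 x x' y 0
    simp only [zero_smul, add_zero] at c1 c2 c3
    simp only [c1, c2, c3, ← smul_add] at e1 e2
    exact eq_zero_of_det_ne_zero (by intro h; apply hκ; linear_combination h / 4) e1 e2
  -- All q are treated at once as a single relation with values in sequences, so that the terms of t
  -- shifting y vanish by hypothesis.
  refine congrFun (forall_eq_zero_of_symmetric (A := ℕ → A)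
    (fun p p' q => serreRel (x p) (x p') (y q)) (fun p p' => funext fun q => serreRel_comm _ _ _)
    (funext fun q => ?_) (fun p p' h => funext fun q => (step p p' q (congrFun h q)).1)
    (fun p p' h => funext fun q => ?_) p p') q
  · induction q with
    | zero => simp [serreRel, h0]
    | succ q ih => exact (step 0 0 q ih).2
  · have h' := congrFun h
    simp only [Pi.zero_apply] at h'
    have e := congrArg (fun z => ⁅t, z⁆) (h' q)
    simp only [lie_serreRel, RingLie.zero, htx, hty, serreRel_comb₁, serreRel_comb₂,
      serreRel_comb₃] at e
    simp only [h', smul_zero, add_zero, ← smul_add] at e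
    exact (smul_eq_zero.1 e).resolve_left (mul_ne_zero two_ne_zero hκ₀)

end Family

end Levendorskii

/-! ### Relations between different nodes, and Cartan modes of degree at most N + 2. -/

namespace Levendorskii.LowRelations

variable {I : Type*} {a : I → I → ℤ} {N : I → ℕ} {A : Type*} [Ring A] [Algebra ℂ A]
  {s₁ s₂ : I → A} {e f : I → ℕ → A}

/-- s₂ creates e_{n+1} from e_n and commutes with s₁. -/
theorem s₁_e_all (D : LowRelations a N s₁ s₂ e f) (i j : I) (n : ℕ) :
    ⁅s₁ i, e j n⁆ = (a i j : ℂ) • e j n := by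
  induction n with
  | zero => exact D.s₁_e i j
  | succ n ih =>
    have h : e j (n + 1) = (1 / 2 : ℂ) • ⁅s₂ j, e j n⁆ := by
      rw [D.s₂_e, D.diag, smul_smul]; norm_num
    rw [h, RingLie.smul, RingLie.leibniz, RingLie.skew (s₁ i), D.s₂_s₁, neg_zero,
      RingLie.zero_left, zero_add, ih, RingLie.smul, smul_comm]

theorem s₁_f_all (D : LowRelations a N s₁ s₂ e f) (i j : I) (n : ℕ) :
    ⁅s₁ i, f j n⁆ = -(a i j : ℂ) • f j n := by
  induction n with
  | zero => exact D.s₁_f i j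
  | succ n ih =>
    have h : f j (n + 1) = (-1 / 2 : ℂ) • ⁅s₂ j, f j n⁆ := by
      rw [D.s₂_f, D.diag, smul_smul]; norm_num
    rw [h, RingLie.smul, RingLie.leibniz, RingLie.skew (s₁ i), D.s₂_s₁, neg_zero,
      RingLie.zero_left, zero_add, ih, RingLie.smul, smul_comm]

theorem s₁_ef (D : LowRelations a N s₁ s₂ e f) (i j : I) (p q : ℕ) :
    ⁅s₁ i, ⁅e j p, f j q⁆⁆ = 0 := by
  rw [RingLie.leibniz, D.s₁_e_all, D.s₁_f_all, RingLie.smul, RingLie.smul_left]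
  module

theorem s₂_ef (D : LowRelations a N s₁ s₂ e f) (i j k : I) (p q : ℕ) :
    ⁅s₂ k, ⁅e i p, f j q⁆⁆ =
      (a k i : ℂ) • ⁅e i (p + 1), f j q⁆ + (-(a k j : ℂ)) • ⁅e i p, f j (q + 1)⁆ := by
  rw [RingLie.leibniz, D.s₂_e, D.s₂_f, RingLie.smul, RingLie.smul_left]

theorem ef_ne_all (D : LowRelations a N s₁ s₂ e f) {i j : I} (hij : i ≠ j) (p q : ℕ) :
    ⁅e i p, f j q⁆ = 0 := by
  refine forall_eq_zero_of_det_ne_zero (α := a i i) (β := -a i j) (γ := a j i) (δ := -a j j) ?_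
    (fun p q => ⁅e i p, f j q⁆) (D.ef_ne i j hij) ?_ ?_ p q
  · rw [D.symm j i, D.diag, D.diag]
    rcases D.off i j hij with h | h <;> rw [h] <;> norm_num
  · intro p q h; rw [← D.s₂_ef, h, RingLie.zero]
  · intro p q h; rw [← D.s₂_ef, h, RingLie.zero]

theorem ee_ne_all (D : LowRelations a N s₁ s₂ e f) {i j : I} (hij : i ≠ j) (p q : ℕ) :
    ⁅e i (p + 1), e j q⁆ - ⁅e i p, e j (q + 1)⁆ =
      ((a i j : ℂ) / 2) • (e i p * e j q + e j q * e i p) := by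
  refine quadratic_of_ne (κ := fun i j => (a i j : ℂ) / 2) (s := s₂) (x := e)
    (fun i j n => ?_) ?_ (D.ee i j) p q
  · rw [D.s₂_e]; congr 1; ring
  · simp only [D.symm j i, D.diag]
    rcases D.off i j hij with h | h <;> rw [h] <;> norm_num

theorem ff_ne_all (D : LowRelations a N s₁ s₂ e f) {i j : I} (hij : i ≠ j) (p q : ℕ) :
    ⁅f i (p + 1), f j q⁆ - ⁅f i p, f j (q + 1)⁆ =
      (-((a i j : ℂ) / 2)) • (f i p * f j q + f j q * f i p) := by
  refine quadratic_of_ne (κ := fun i j => -((a i j : ℂ) / 2)) (s := s₂) (x := f)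
    (fun i j n => ?_) ?_ (D.ff i j) p q
  · rw [D.s₂_f]; congr 1; ring
  · simp only [D.symm j i, D.diag]
    rcases D.off i j hij with h | h <;> rw [h] <;> norm_num

/-! ### Cartan modes of low degree -/

/-- `[e_p, f_q]` depends only on `p + q` up to total degree `K`. -/
def WellDefined (N : I → ℕ) (e f : I → ℕ → A) (i : I) (K : ℕ) : Prop :=
  ∀ p q, p + q + 1 ≤ K → ⁅e i p, f i q⁆ = cartanMode N e f i (p + q + 1)

theorem wellDefined_one : WellDefined N e f i 1 := by
  intro p q h
  obtain rfl : p = 0 := by omega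
  obtain rfl : q = 0 := by omega
  rfl

/-- [s₂, [e_p, f_q]] is twice [e_{p+1}, f_q] − [e_p, f_{q+1}]. So if s₂ commutes with the mode of
degree K, the index can be moved along the whole next antidiagonal. -/
theorem WellDefined.succ (D : LowRelations a N s₁ s₂ e f) {i : I} {K : ℕ}
    (h : WellDefined N e f i K) (hK : ⁅s₂ i, cartanMode N e f i K⁆ = 0) :
    WellDefined N e f i (K + 1) := by
  rcases Nat.eq_zero_or_pos K with rfl | hpos
  · exact wellDefined_one
  intro p q hpq
  rcases Nat.lt_or_ge (p + q) K with hlt | hge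
  · exact h p q hlt
  obtain rfl : p + q = K := by omega
  clear hpq hge
  induction q generalizing p with
  | zero => rfl
  | succ q ih =>
    have := ih (p + 1) (by rwa [Nat.add_right_comm]) (by rwa [Nat.add_right_comm]) (by omega)
    rw [← Nat.add_assoc, ← h p q (by omega), D.s₂_ef, D.diag, neg_smul, ← sub_eq_add_neg,
      ← smul_sub, smul_eq_zero, sub_eq_zero] at hK
    rw [← hK.resolve_left (by norm_num), this]
    congr 1; omega

theorem s₂_low (D : LowRelations a N s₁ s₂ e f) (i j : I) (k : ℕ) :
    ⁅s₂ j, lowCartan (N i) (s₁ i) (s₂ i) k⁆ = 0 := by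
  unfold lowCartan
  split_ifs
  · exact RingLie.zero _
  · exact RingLie.one _
  · exact D.s₂_s₁ _ _
  · rw [RingLie.add, RingLie.smul, RingLie.lie_mul, D.s₂_s₁, D.s₂_s₂]; simp

/-- One prescribed bracket in each degree suffices: its value is a polynomial in s₁ and s₂, hence
commutes with s₂, and this makes the next degree well defined. The process stops one degree above
the prescribed values. -/
theorem low_aux (D : LowRelations a N s₁ s₂ e f) (i : I) (k : ℕ) (hk : k ≤ N i + 2) :
    WellDefined N e f i (k + 1) ∧
      ∀ k' ≤ k, cartanMode N e f i k' = lowCartan (N i) (s₁ i) (s₂ i) k' := by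
  induction k with
  | zero =>
    refine ⟨wellDefined_one, fun k' hk' => ?_⟩
    obtain rfl : k' = 0 := by omega
    unfold cartanMode lowCartan
    rcases Nat.eq_zero_or_pos (N i) with h | h
    · simp [h]
    · rw [if_neg h.ne', if_pos h]
  | succ k ih =>
    obtain ⟨hW, hL⟩ := ih (by omega)
    obtain ⟨p, q, hpq, hv⟩ := D.ef_low i (k + 1) (by omega) hk
    have hk1 : cartanMode N e f i (k + 1) = lowCartan (N i) (s₁ i) (s₂ i) (k + 1) := by
      rw [← hv, hW p q (by omega), hpq]
    refine ⟨hW.succ D (by rw [hk1, D.s₂_low]), fun k' hk' => ?_⟩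
    rcases Nat.lt_or_ge k' (k + 1) with h | h
    · exact hL k' (by omega)
    · obtain rfl : k' = k + 1 := by omega
      exact hk1

theorem cartanMode_eq_low (D : LowRelations a N s₁ s₂ e f) (i : I) {k : ℕ} (hk : k ≤ N i + 2) :
    cartanMode N e f i k = lowCartan (N i) (s₁ i) (s₂ i) k :=
  (D.low_aux i k hk).2 k le_rfl

theorem cartanMode_of_lt (D : LowRelations a N s₁ s₂ e f) (i : I) {k : ℕ} (hk : k < N i) :
    cartanMode N e f i k = 0 := by
  rw [D.cartanMode_eq_low i (by omega), lowCartan, if_pos hk]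

theorem cartanMode_self (D : LowRelations a N s₁ s₂ e f) (i : I) :
    cartanMode N e f i (N i) = 1 := by
  rw [D.cartanMode_eq_low i (by omega), lowCartan, if_neg (by omega), if_pos rfl]

theorem cartanMode_add_one (D : LowRelations a N s₁ s₂ e f) (i : I) :
    cartanMode N e f i (N i + 1) = s₁ i := by
  rw [D.cartanMode_eq_low i (by omega), lowCartan, if_neg (by omega), if_neg (by omega),
    if_pos rfl]

theorem cartanMode_add_two (D : LowRelations a N s₁ s₂ e f) (i : I) :
    cartanMode N e f i (N i + 2) = s₂ i + (1 / 2 : ℂ) • (s₁ i * s₁ i) := by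
  rw [D.cartanMode_eq_low i (by omega), lowCartan, if_neg (by omega), if_neg (by omega),
    if_neg (by omega)]

theorem wellDefined_add_three (D : LowRelations a N s₁ s₂ e f) (i : I) :
    WellDefined N e f i (N i + 3) :=
  (D.low_aux i (N i + 2) le_rfl).1

theorem cartanMode_zero_lie (D : LowRelations a N s₁ s₂ e f) (i : I) (x : A) :
    ⁅cartanMode N e f i 0, x⁆ = 0 := by
  unfold cartanMode
  split_ifs
  · exact RingLie.one_left _
  · exact RingLie.zero_left _

/-- The relations between the low Cartan modes and a family `x` of generators. -/
theorem low_rel {i : I} {κ : ℂ} {x : ℕ → A} (D : LowRelations a N s₁ s₂ e f)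
    (h1 : ∀ n, ⁅s₁ i, x n⁆ = (2 * κ) • x n) (h2 : ∀ n, ⁅s₂ i, x n⁆ = (2 * κ) • x (n + 1))
    {k : ℕ} (hk : k ≤ N i + 1) (r : ℕ) :
    ⁅cartanMode N e f i (k + 1), x r⁆ = ⁅cartanMode N e f i k, x (r + 1)⁆ +
      κ • (cartanMode N e f i k * x r + x r * cartanMode N e f i k) := by
  rcases Nat.lt_trichotomy (k + 1) (N i) with h | h | h
  · rw [D.cartanMode_of_lt i h, D.cartanMode_of_lt i (by omega)]
    simp [RingLie.zero_left]
  · rw [h, D.cartanMode_self i, D.cartanMode_of_lt i (by omega)]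
    simp [RingLie.zero_left, RingLie.one_left]
  · rcases Nat.lt_or_ge (N i) k with h' | h'
    · obtain rfl : k = N i + 1 := by omega
      rw [D.cartanMode_add_one, D.cartanMode_add_two, RingLie.add_left, RingLie.smul_left,
        RingLie.mul_lie, h1, h1, h2]
      simp only [mul_smul_comm, smul_mul_assoc]
      module
    · obtain rfl : k = N i := by omega
      rw [D.cartanMode_add_one, D.cartanMode_self, h1, RingLie.one_left]
      simp only [one_mul, mul_one]
      module

theorem low_rel_e (D : LowRelations a N s₁ s₂ e f) (i j : I) {k : ℕ} (hk : k ≤ N i + 1) (r : ℕ) :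
    ⁅cartanMode N e f i (k + 1), e j r⁆ = ⁅cartanMode N e f i k, e j (r + 1)⁆ +
      ((a i j : ℂ) / 2) • (cartanMode N e f i k * e j r + e j r * cartanMode N e f i k) :=
  D.low_rel (κ := (a i j : ℂ) / 2) (fun n => by rw [D.s₁_e_all]; congr 1; ring)
    (fun n => by rw [D.s₂_e]; congr 1; ring) hk r

theorem low_rel_f (D : LowRelations a N s₁ s₂ e f) (i j : I) {k : ℕ} (hk : k ≤ N i + 1) (r : ℕ) :
    ⁅cartanMode N e f i (k + 1), f j r⁆ = ⁅cartanMode N e f i k, f j (r + 1)⁆ -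
      ((a i j : ℂ) / 2) • (cartanMode N e f i k * f j r + f j r * cartanMode N e f i k) := by
  rw [sub_eq_add_neg, ← neg_smul]
  exact D.low_rel (κ := -((a i j : ℂ) / 2)) (fun n => by rw [D.s₁_f_all]; congr 1; ring)
    (fun n => by rw [D.s₂_f]; congr 1; ring) hk r

/-- The relation between e_i and e_j is bracketed with f_{i,0}, which commutes with every mode of
e_j. As `cartanMode` is defined with f_{i,0}, well-definedness plays no role. -/
theorem rel_e_ne (D : LowRelations a N s₁ s₂ e f) {i j : I} (hij : i ≠ j) (k r : ℕ) :
    ⁅cartanMode N e f i (k + 1), e j r⁆ = ⁅cartanMode N e f i k, e j (r + 1)⁆ +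
      ((a i j : ℂ) / 2) • (cartanMode N e f i k * e j r + e j r * cartanMode N e f i k) := by
  cases k with
  | zero => exact D.low_rel_e i j (by omega) r
  | succ k =>
    simp only [cartanMode]
    have h1 := D.ee_ne_all hij k r
    have h2 := D.ef_ne_all hij.symm r 0
    have h3 := D.ef_ne_all hij.symm (r + 1) 0
    have h1' := congrArg (fun z => ⁅z, f i 0⁆) h1
    simp only [Ring.lie_def, sub_eq_zero] at h1' h2 h3 ⊢
    simp only [mul_add, add_mul, mul_sub, sub_mul, smul_mul_assoc, mul_smul_comm,
      mul_assoc, h2, h3] at h1' ⊢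
    simp only [← mul_assoc, ← h2, ← h3] at h1' ⊢
    linear_combination (norm := module) h1'

/-- The mirror argument with e_{i,0} produces [e_{i,0}, f_{i,k}], which is known to be a Cartan mode
only when well-definedness has been reached in that degree. -/
theorem rel_f_ne (D : LowRelations a N s₁ s₂ e f) {i j : I} (hij : i ≠ j) {k : ℕ}
    (hk : WellDefined N e f i (k + 1)) (r : ℕ) :
    ⁅cartanMode N e f i (k + 1), f j r⁆ = ⁅cartanMode N e f i k, f j (r + 1)⁆ -
      ((a i j : ℂ) / 2) • (cartanMode N e f i k * f j r + f j r * cartanMode N e f i k) := by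
  cases k with
  | zero => exact D.low_rel_f i j (by omega) r
  | succ k =>
    have hk1 := hk 0 (k + 1) (by omega)
    have hk2 := hk 0 k (by omega)
    rw [Nat.zero_add] at hk1 hk2
    rw [← hk1, ← hk2]
    have h1 := D.ff_ne_all hij k r
    have h2 := D.ef_ne_all hij 0 r
    have h3 := D.ef_ne_all hij 0 (r + 1)
    have h1' := congrArg (fun z => ⁅e i 0, z⁆) h1
    simp only [Ring.lie_def, sub_eq_zero] at h1' h2 h3 ⊢
    simp only [mul_add, add_mul, mul_sub, sub_mul, smul_mul_assoc, mul_smul_comm,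
      mul_assoc, h2, h3] at h1' ⊢
    simp only [← mul_assoc, h2, h3] at h1' ⊢
    linear_combination (norm := module) h1'

end Levendorskii.LowRelations

/-! ### Well-definedness in degree N + 4 and the third logarithmic Cartan mode. -/

namespace Levendorskii.LowRelations

variable {I : Type*} {a : I → I → ℤ} {N : I → ℕ} {A : Type*} [Ring A] [Algebra ℂ A]
  {s₁ s₂ : I → A} {e f : I → ℕ → A}

/-! ### The first obstruction -/

theorem s₂_cartanMode (D : LowRelations a N s₁ s₂ e f) {i : I} {K : ℕ}
    (h : WellDefined N e f i K) {p q : ℕ} (hpq : p + q + 1 ≤ K) (j : I) :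
    ⁅s₂ j, cartanMode N e f i (p + q + 1)⁆ =
      (a j i : ℂ) • (⁅e i (p + 1), f i q⁆ - ⁅e i p, f i (q + 1)⁆) := by
  rw [← h p q hpq, D.s₂_ef]; module

/-- The first failure sits in a single degree and is half of [s₂, H_{K+1}]. It therefore has the
form required by `lie_lie_eq_smul`, and it vanishes once s₂ commutes with H_{K+1}. -/
theorem ef_sub (D : LowRelations a N s₁ s₂ e f) {i : I} {K : ℕ}
    (h : WellDefined N e f i (K + 1)) (p q : ℕ) (hpq : p + q ≤ K) :
    ⁅e i (p + 1), f i q⁆ - ⁅e i p, f i (q + 1)⁆ =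
      if p + q = K then (1 / 2 : ℂ) • ⁅s₂ i, cartanMode N e f i (K + 1)⁆ else 0 := by
  split_ifs with hK
  · subst hK
    rw [D.s₂_cartanMode h le_rfl, D.diag, smul_smul]; norm_num
  · rw [h _ _ (by omega), h _ _ (by omega), Nat.add_right_comm p 1 q, Nat.add_assoc p q 1, sub_self]

theorem s₂_cartanMode_ne (D : LowRelations a N s₁ s₂ e f) {i : I} {K : ℕ}
    (h : WellDefined N e f i (K + 1)) (j : I) :
    ⁅s₂ j, cartanMode N e f i (K + 1)⁆ =
      ((a j i : ℂ) / 2) • ⁅s₂ i, cartanMode N e f i (K + 1)⁆ := by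
  have h1 := D.s₂_cartanMode h (p := K) (q := 0) le_rfl j
  rw [D.ef_sub h K 0 le_rfl, if_pos (Nat.add_zero K), smul_smul, Nat.add_zero] at h1
  rw [h1]; congr 1; ring

theorem s₁_cartanMode (D : LowRelations a N s₁ s₂ e f) (i j : I) (k : ℕ) :
    ⁅s₁ i, cartanMode N e f j k⁆ = 0 := by
  cases k with
  | zero => rw [RingLie.skew, D.cartanMode_zero_lie, neg_zero]
  | succ k => exact D.s₁_ef i j k 0

/-- H_{N+2} = s₂ + ½s₁² and s₁ commutes with all modes, so H_{N+2} brackets with them as s₂ does. -/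
theorem lie_cartanMode_add_two (D : LowRelations a N s₁ s₂ e f) {i j : I} (k : ℕ) :
    ⁅cartanMode N e f i k, cartanMode N e f j (N j + 2)⁆ = -⁅s₂ j, cartanMode N e f i k⁆ := by
  rw [D.cartanMode_add_two, RingLie.add, RingLie.smul, RingLie.lie_mul,
    RingLie.skew _ (s₁ j), D.s₁_cartanMode, neg_zero, zero_mul, mul_zero, add_zero, smul_zero,
    add_zero, ← RingLie.skew]

/-- The bracket of H_{i,N_i+3} with H_{j,N_j+2} is evaluated twice: by `lie_lie_eq_smul` with m = 1
it is a multiple of the failure at j, and as a bracket with s₂ j it is a multiple of the failure at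
i. -/
theorem s₂_cartanMode_neighbour (D : LowRelations a N s₁ s₂ e f) {i j : I} (hij : a i j = -1) :
    ⁅s₂ i, cartanMode N e f i (N i + 3)⁆ =
      (-2 : ℂ) • ⁅s₂ j, cartanMode N e f j (N j + 3)⁆ := by
  have hne : i ≠ j := by rintro rfl; rw [D.diag] at hij; omega
  have h := lie_lie_eq_smul ((a i j : ℂ) / 2) (cartanMode N e f i) (e j) (f j) (N i) 1 (N j + 1) 0
    ((1 / 2 : ℂ) • ⁅s₂ j, cartanMode N e f j (N j + 3)⁆)
    (fun r hr => D.cartanMode_of_lt i hr) (D.cartanMode_self i)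
    (fun p q hpq => by
      rw [D.ef_sub (K := N j + 2) (D.wellDefined_add_three j) p q (by omega)]
      congr 1
      simp only [eq_iff_iff]; omega)
    (fun k r _ _ => D.rel_e_ne hne k r)
    (fun k r hk _ => D.rel_f_ne hne (fun p q hpq => D.wellDefined_add_three i p q (by omega)) r)
  have h' : ⁅e j (N j + 1), f j 0⁆ = cartanMode N e f j (N j + 2) := rfl
  rw [h', D.lie_cartanMode_add_two, D.s₂_cartanMode_ne (K := N i + 2) (D.wellDefined_add_three i),
    D.symm j i, hij] at h
  push_cast at h
  linear_combination (norm := module) (2 : ℂ) • h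

/-- For neighbours, X_i = −2X_j and X_j = −2X_i give 3X_i = 0. An isolated node admits no such
comparison, which is why `ef_top` contains an extra relation. -/
theorem s₂_cartanMode_add_three (D : LowRelations a N s₁ s₂ e f) (i : I) :
    ⁅s₂ i, cartanMode N e f i (N i + 3)⁆ = 0 := by
  rcases D.ef_top i with ⟨j, hij⟩ | ⟨p, q, hpq, h⟩
  · have h1 := D.s₂_cartanMode_neighbour hij
    have h2 := D.s₂_cartanMode_neighbour (i := j) (j := i) (by rw [D.symm, hij])
    rw [h2, smul_smul] at h1
    refine (smul_eq_zero.1 (?_ : (3 : ℂ) • ⁅s₂ i, cartanMode N e f i (N i + 3)⁆ = 0)).resolve_left (by norm_num)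
    linear_combination (norm := module) (-1 : ℂ) • h1
  · rwa [D.wellDefined_add_three i p q (by omega), hpq] at h

theorem wellDefined_add_four (D : LowRelations a N s₁ s₂ e f) (i : I) :
    WellDefined N e f i (N i + 4) :=
  (D.wellDefined_add_three i).succ D (D.s₂_cartanMode_add_three i)

/-! ### The action of the third logarithmic Cartan mode -/

/-- For one node s₂ alone yields only this further instance of the quadratic relation, and it is all
that the third logarithmic mode needs. -/
theorem ee_one_zero (D : LowRelations a N s₁ s₂ e f) (i : I) :
    ⁅e i 2, e i 0⁆ - ⁅e i 1, e i 1⁆ = (1 : ℂ) • (e i 1 * e i 0 + e i 0 * e i 1) := by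
  have h := congrArg (fun z => ⁅s₂ i, z⁆) (D.ee i i)
  simp only [RingLie.sub, RingLie.smul, RingLie.add, RingLie.lie_mul] at h
  rw [RingLie.leibniz (s₂ i) (e i 1), RingLie.leibniz (s₂ i) (e i 0)] at h
  simp only [D.s₂_e, D.diag, RingLie.smul, RingLie.smul_left, mul_smul_comm, smul_mul_assoc,
    Nat.reduceAdd] at h
  rw [RingLie.skew (e i 0) (e i 2)] at h
  rw [RingLie.self] at h ⊢
  push_cast at h
  linear_combination (norm := module) (1 / 4 : ℂ) • h

theorem ff_one_zero (D : LowRelations a N s₁ s₂ e f) (i : I) :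
    ⁅f i 2, f i 0⁆ - ⁅f i 1, f i 1⁆ = (-1 : ℂ) • (f i 1 * f i 0 + f i 0 * f i 1) := by
  have h := congrArg (fun z => ⁅s₂ i, z⁆) (D.ff i i)
  simp only [RingLie.sub, RingLie.smul, RingLie.add, RingLie.lie_mul] at h
  rw [RingLie.leibniz (s₂ i) (f i 1), RingLie.leibniz (s₂ i) (f i 0)] at h
  simp only [D.s₂_f, D.diag, RingLie.smul, RingLie.smul_left, mul_smul_comm, smul_mul_assoc,
    Nat.reduceAdd] at h
  rw [RingLie.skew (f i 0) (f i 2)] at h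
  rw [RingLie.self] at h ⊢
  push_cast at h
  linear_combination (norm := module) (-1 / 4 : ℂ) • h

/-- Bracketing with s annihilates H and H' and shifts x by one. -/
theorem rel_of_zero {κ c : ℂ} {s H H' : A} {x : ℕ → A} (hc : c ≠ 0)
    (hs : ∀ n, ⁅s, x n⁆ = c • x (n + 1)) (hH : ⁅s, H⁆ = 0) (hH' : ⁅s, H'⁆ = 0)
    (h : ⁅H', x 0⁆ - ⁅H, x 1⁆ = κ • (H * x 0 + x 0 * H)) (r : ℕ) :
    ⁅H', x r⁆ - ⁅H, x (r + 1)⁆ = κ • (H * x r + x r * H) := by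
  induction r with
  | zero => exact h
  | succ r ih =>
    have h' := congrArg (fun z => ⁅s, z⁆) ih
    simp only [RingLie.sub, RingLie.smul, RingLie.add, RingLie.lie_mul] at h'
    rw [RingLie.leibniz s H', RingLie.leibniz s H] at h'
    simp only [hH, hH', hs, RingLie.zero_left, RingLie.smul, mul_smul_comm, smul_mul_assoc,
      zero_mul, mul_zero, zero_add, add_zero] at h'
    refine smul_right_injective A hc ?_
    linear_combination (norm := module) h'

theorem rel_e_two (D : LowRelations a N s₁ s₂ e f) (i : I) (r : ℕ) :
    ⁅cartanMode N e f i (N i + 3), e i r⁆ - ⁅cartanMode N e f i (N i + 2), e i (r + 1)⁆ =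
      (1 : ℂ) • (cartanMode N e f i (N i + 2) * e i r + e i r * cartanMode N e f i (N i + 2)) := by
  refine rel_of_zero (c := 2) two_ne_zero (fun n => by rw [D.s₂_e, D.diag]; norm_num) ?_
    (D.s₂_cartanMode_add_three i) ?_ r
  · rw [D.cartanMode_eq_low i le_rfl, D.s₂_low]
  -- The brackets of e_0, e_1, e_2 with f_N are H_{N+1}, H_{N+2}, H_{N+3}. Antisymmetry exchanges
  -- the unknown relation for H_{N+3}, e_0 with the known one for H_{N+2}, e_1.
  have h := antisymm_of_lie_eq 1 (e i 1) (e i 2) (e i 0) (e i 1) (f i (N i)) (D.ee_one_zero i)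
  have hW := D.wellDefined_add_three i
  rw [hW 2 (N i) (by omega), hW 1 (N i) (by omega), hW 0 (N i) (by omega),
    show 2 + N i + 1 = N i + 3 by omega, show 1 + N i + 1 = N i + 2 by omega,
    show 0 + N i + 1 = N i + 1 by omega] at h
  have h2 := D.low_rel_e i i (k := N i + 1) le_rfl 1
  rw [D.diag] at h2
  norm_num at h2
  rw [one_smul] at h ⊢
  rw [← sub_eq_zero, h, neg_eq_zero, h2, one_smul]
  abel

theorem rel_f_two (D : LowRelations a N s₁ s₂ e f) (i : I) (r : ℕ) :
    ⁅cartanMode N e f i (N i + 3), f i r⁆ - ⁅cartanMode N e f i (N i + 2), f i (r + 1)⁆ =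
      (-1 : ℂ) • (cartanMode N e f i (N i + 2) * f i r + f i r * cartanMode N e f i (N i + 2)) := by
  refine rel_of_zero (c := -2) (by norm_num) (fun n => by rw [D.s₂_f, D.diag]; norm_num) ?_
    (D.s₂_cartanMode_add_three i) ?_ r
  · rw [D.cartanMode_eq_low i le_rfl, D.s₂_low]
  have h := antisymm_of_lie_eq (-1) (f i 1) (f i 2) (f i 0) (f i 1) (e i (N i)) (D.ff_one_zero i)
  have hW := D.wellDefined_add_three i
  simp only [RingLie.skew (f i _) (e i _)] at h
  rw [hW (N i) 2 (by omega), hW (N i) 1 (by omega), hW (N i) 0 (by omega)] at h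
  have h2 := D.low_rel_f i i (k := N i + 1) le_rfl 1
  rw [D.diag] at h2
  norm_num at h2
  simp only [RingLie.neg_left, neg_mul, mul_neg] at h
  rw [show N i + 2 + 1 = N i + 3 by omega, show N i + 1 + 1 = N i + 2 by omega,
    show N i + 0 + 1 = N i + 1 by omega] at h
  linear_combination (norm := module) (-1 : ℂ) • h - h2

/-- The third logarithmic Cartan mode. -/
noncomputable def logCartan (N : I → ℕ) (s₁ : I → A) (e f : I → ℕ → A) (i : I) : A :=
  cartanMode N e f i (N i + 3) - cartanMode N e f i (N i + 2) * s₁ i +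
    (1 / 3 : ℂ) • (s₁ i * s₁ i * s₁ i)

end Levendorskii.LowRelations

/-! ### From low degrees to all relations. -/

namespace Levendorskii.LowRelations

variable {I : Type*} {a : I → I → ℤ} {N : I → ℕ} {A : Type*} [Ring A] [Algebra ℂ A]
  {s₁ s₂ : I → A} {e f : I → ℕ → A}

/-- This is the operator t required by `quadratic_of_eq` and `serreRel_eq_zero`. The relation
involving H_{N+3} comes from `rel_e_ne` between different nodes and from antisymmetry within one
node. -/
theorem logCartan_e (D : LowRelations a N s₁ s₂ e f) (i j : I) (n : ℕ) :
    ⁅logCartan N s₁ e f i, e j n⁆ =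
      (2 * ((a i j : ℂ) / 2)) • e j (n + 2) + (2 / 3 * ((a i j : ℂ) / 2) ^ 3) • e j n := by
  have h1 : ∀ n, ⁅s₁ i, e j n⁆ = (2 * ((a i j : ℂ) / 2)) • e j n := fun n => by
    rw [D.s₁_e_all]; congr 1; ring
  have h2 : ∀ n, _ := fun n => D.low_rel_e i j (k := N i + 1) le_rfl n
  rw [D.cartanMode_add_one] at h2
  refine lie_log_three ((a i j : ℂ) / 2) (s₁ i) (cartanMode N e f i (N i + 2))
    (cartanMode N e f i (N i + 3)) (e j n) (e j (n + 1)) (e j (n + 2)) (D.s₁_cartanMode _ _ _)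
    (h1 _) (h1 _) (h1 _) (h2 _) (h2 _) ?_
  by_cases hij : i = j
  · subst hij
    have := D.rel_e_two i n
    rw [sub_eq_iff_eq_add'] at this
    rw [this, D.diag]; norm_num
  · exact D.rel_e_ne hij _ _

theorem logCartan_f (D : LowRelations a N s₁ s₂ e f) (i j : I) (n : ℕ) :
    ⁅logCartan N s₁ e f i, f j n⁆ =
      (2 * -((a i j : ℂ) / 2)) • f j (n + 2) + (2 / 3 * (-((a i j : ℂ) / 2)) ^ 3) • f j n := by
  have h1 : ∀ n, ⁅s₁ i, f j n⁆ = (2 * -((a i j : ℂ) / 2)) • f j n := fun n => by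
    rw [D.s₁_f_all]; congr 1; ring
  have h2 : ∀ n, _ := fun n => D.low_rel_f i j (k := N i + 1) le_rfl n
  rw [D.cartanMode_add_one] at h2
  refine lie_log_three (-((a i j : ℂ) / 2)) (s₁ i) (cartanMode N e f i (N i + 2))
    (cartanMode N e f i (N i + 3)) (f j n) (f j (n + 1)) (f j (n + 2)) (D.s₁_cartanMode _ _ _)
    (h1 _) (h1 _) (h1 _) ((h2 _).trans (by module)) ((h2 _).trans (by module)) ?_
  by_cases hij : i = j
  · subst hij
    have := D.rel_f_two i n
    rw [sub_eq_iff_eq_add'] at this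
    rw [this, D.diag]; norm_num
  · have hW := D.wellDefined_add_three i
    refine (D.rel_f_ne hij (k := N i + 2) (fun p q hpq => hW p q (by omega)) n).trans ?_
    module

theorem ee_all (D : LowRelations a N s₁ s₂ e f) (i j : I) (p q : ℕ) :
    ⁅e i (p + 1), e j q⁆ - ⁅e i p, e j (q + 1)⁆ =
      ((a i j : ℂ) / 2) • (e i p * e j q + e j q * e i p) := by
  by_cases hij : i = j
  · subst hij
    refine quadratic_of_eq (κ := (a i i : ℂ) / 2) (by rw [D.diag]; norm_num)
      (fun n => ?_) (D.logCartan_e i i) (D.ee i i) p q (s := s₂ i)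
    rw [D.s₂_e]; congr 1; ring
  · exact D.ee_ne_all hij p q

theorem ff_all (D : LowRelations a N s₁ s₂ e f) (i j : I) (p q : ℕ) :
    ⁅f i (p + 1), f j q⁆ - ⁅f i p, f j (q + 1)⁆ =
      (-((a i j : ℂ) / 2)) • (f i p * f j q + f j q * f i p) := by
  by_cases hij : i = j
  · subst hij
    refine quadratic_of_eq (κ := -((a i i : ℂ) / 2)) (by rw [D.diag]; norm_num)
      (fun n => ?_) (D.logCartan_f i i) (D.ff i i) p q (s := s₂ i)
    rw [D.s₂_f]; congr 1; ring
  · exact D.ff_ne_all hij p q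

theorem serre_e_all (D : LowRelations a N s₁ s₂ e f) {i j : I} (hij : a i j = -1) (p p' q : ℕ) :
    serreRel (e i p) (e i p') (e j q) = 0 := by
  refine serreRel_eq_zero (κ₀ := (a i i : ℂ) / 2) (κ₁ := (a i j : ℂ) / 2) (s := s₂ i) (s' := s₂ j)
    (by rw [hij, D.diag]; norm_num) (by rw [D.diag]; norm_num) (fun n => ?_) (fun n => ?_)
    (fun n => ?_) (fun n => ?_) (D.logCartan_e i i) (D.logCartan_e i j) (D.serre_e i j hij) p p' q
  all_goals rw [D.s₂_e]
  · congr 1; ring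
  · congr 1; ring
  · rw [D.symm j i]; congr 1; ring
  · rw [D.diag, D.diag]; congr 1; norm_num

theorem serre_f_all (D : LowRelations a N s₁ s₂ e f) {i j : I} (hij : a i j = -1) (p p' q : ℕ) :
    serreRel (f i p) (f i p') (f j q) = 0 := by
  refine serreRel_eq_zero (κ₀ := -((a i i : ℂ) / 2)) (κ₁ := -((a i j : ℂ) / 2)) (s := s₂ i)
    (s' := s₂ j) (by rw [hij, D.diag]; norm_num) (by rw [D.diag]; norm_num) (fun n => ?_)
    (fun n => ?_) (fun n => ?_) (fun n => ?_) (D.logCartan_f i i) (D.logCartan_f i j)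
    (D.serre_f i j hij) p p' q
  all_goals rw [D.s₂_f]
  · congr 1; ring
  · congr 1; ring
  · rw [D.symm j i]; congr 1; ring
  · rw [D.diag, D.diag]; congr 1; norm_num

theorem comm_e_all (D : LowRelations a N s₁ s₂ e f) {i j : I} (hij : a i j = 0) (p q : ℕ) :
    ⁅e i p, e j q⁆ = 0 := by
  refine forall_eq_zero_of_det_ne_zero (α := a i i) (β := a i j) (γ := a j i) (δ := a j j) ?_
    (fun p q => ⁅e i p, e j q⁆) (D.comm_e i j hij) ?_ ?_ p q
  · rw [D.symm j i, D.diag, D.diag, hij]; norm_num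
  · intro p q h
    have h' := congrArg (fun z => ⁅s₂ i, z⁆) h
    simpa only [RingLie.leibniz (s₂ i), D.s₂_e, RingLie.smul, RingLie.smul_left, RingLie.zero] using h'
  · intro p q h
    have h' := congrArg (fun z => ⁅s₂ j, z⁆) h
    simpa only [RingLie.leibniz (s₂ j), D.s₂_e, RingLie.smul, RingLie.smul_left, RingLie.zero] using h'

theorem comm_f_all (D : LowRelations a N s₁ s₂ e f) {i j : I} (hij : a i j = 0) (p q : ℕ) :
    ⁅f i p, f j q⁆ = 0 := by
  refine forall_eq_zero_of_det_ne_zero (α := -a i i) (β := -a i j) (γ := -a j i) (δ := -a j j) ?_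
    (fun p q => ⁅f i p, f j q⁆) (D.comm_f i j hij) ?_ ?_ p q
  · rw [D.symm j i, D.diag, D.diag, hij]; norm_num
  · intro p q h
    have h' := congrArg (fun z => ⁅s₂ i, z⁆) h
    simpa only [RingLie.leibniz (s₂ i), D.s₂_f, RingLie.smul, RingLie.smul_left, RingLie.zero] using h'
  · intro p q h
    have h' := congrArg (fun z => ⁅s₂ j, z⁆) h
    simpa only [RingLie.leibniz (s₂ j), D.s₂_f, RingLie.smul, RingLie.smul_left, RingLie.zero] using h'

/-! ### All Cartan modes -/

/-- The obstruction to the relation between the `k`-th Cartan mode and `x r`. -/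
def obstruction (H : ℕ → A) (κ : ℂ) (x : ℕ → A) (k r : ℕ) : A :=
  ⁅H (k + 1), x r⁆ - ⁅H k, x (r + 1)⁆ - κ • (H k * x r + x r * H k)

theorem obstruction_e_swap (D : LowRelations a N s₁ s₂ e f) (i : I) (p r : ℕ) :
    obstruction (cartanMode N e f i) 1 (e i) (p + 1) r =
      -obstruction (cartanMode N e f i) 1 (e i) (r + 1) p := by
  have h := D.ee_all i i p r
  rw [D.diag] at h
  exact antisymm_of_lie_eq 1 (e i p) (e i (p + 1)) (e i r) (e i (r + 1)) (f i 0)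
    (h.trans (by norm_num))

theorem obstruction_f_swap (D : LowRelations a N s₁ s₂ e f) (i : I) {p r K : ℕ}
    (hW : WellDefined N e f i K) (hp : p + 2 ≤ K) (hr : r + 2 ≤ K) :
    obstruction (cartanMode N e f i) (-1) (f i) (p + 1) r =
      -obstruction (cartanMode N e f i) (-1) (f i) (r + 1) p := by
  have h := D.ff_all i i p r
  rw [D.diag] at h
  have h' := antisymm_of_lie_eq (-1) (f i p) (f i (p + 1)) (f i r) (f i (r + 1)) (e i 0)
    (h.trans (by norm_num))
  simp only [RingLie.skew (f i _) (e i _)] at h'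
  rw [hW 0 _ (by omega), hW 0 _ (by omega), hW 0 _ (by omega), hW 0 _ (by omega)] at h'
  simp only [RingLie.neg_left, neg_mul, mul_neg, Nat.zero_add] at h'
  simp only [obstruction]
  linear_combination (norm := module) (-1 : ℂ) • h'

theorem obstruction_e_low (D : LowRelations a N s₁ s₂ e f) (i : I) {k : ℕ} (hk : k ≤ N i + 1)
    (r : ℕ) : obstruction (cartanMode N e f i) 1 (e i) k r = 0 := by
  have h := D.low_rel_e i i hk r
  rw [D.diag] at h
  rw [obstruction, h]
  push_cast; module

theorem obstruction_f_low (D : LowRelations a N s₁ s₂ e f) (i : I) {k : ℕ} (hk : k ≤ N i + 1)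
    (r : ℕ) : obstruction (cartanMode N e f i) (-1) (f i) k r = 0 := by
  have h := D.low_rel_f i i hk r
  rw [D.diag] at h
  rw [obstruction, h]
  push_cast; module

theorem s₂_cartanMode_eq_zero (D : LowRelations a N s₁ s₂ e f) {i : I} {K : ℕ}
    (h : WellDefined N e f i (K + 1)) (j : I) : ⁅s₂ j, cartanMode N e f i K⁆ = 0 := by
  cases K with
  | zero => rw [RingLie.skew, D.cartanMode_zero_lie, neg_zero]
  | succ K =>
    have := D.s₂_cartanMode (p := K) (q := 0) h (by omega) j
    rw [Nat.add_zero] at this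
    rw [this, D.ef_sub h K 0 (by omega), if_neg (by omega), smul_zero]

/-- Brackets with s₂ reduce to r = 0; the swap then makes the degree of the Cartan mode equal to
one, where the relation is known. -/
theorem obstruction_e (D : LowRelations a N s₁ s₂ e f) {i : I} {k : ℕ}
    (h : WellDefined N e f i (k + 2)) (r : ℕ) :
    obstruction (cartanMode N e f i) 1 (e i) k r = 0 := by
  refine sub_eq_zero.2 (rel_of_zero (c := 2) two_ne_zero (s := s₂ i)
    (fun n => by rw [D.s₂_e, D.diag]; norm_num)
    (D.s₂_cartanMode_eq_zero (fun p q hpq => h p q (by omega)) i)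
    (D.s₂_cartanMode_eq_zero h i) (sub_eq_zero.1 ?_) r)
  cases k with
  | zero => exact D.obstruction_e_low i (by omega) 0
  | succ k =>
    refine (D.obstruction_e_swap i k 0).trans ?_
    rw [D.obstruction_e_low i (by omega), neg_zero]

/-- The case r = 0 costs one degree of well-definedness less than the general case; at the top
degree of `wellDefined_step` nothing more is available. -/
theorem obstruction_f_zero (D : LowRelations a N s₁ s₂ e f) {i : I} {k : ℕ}
    (h : WellDefined N e f i (k + 1)) :
    obstruction (cartanMode N e f i) (-1) (f i) k 0 = 0 := by
  cases k with
  | zero => exact D.obstruction_f_low i (by omega) 0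
  | succ k =>
    refine (D.obstruction_f_swap i h (by omega) (by omega)).trans ?_
    rw [D.obstruction_f_low i (by omega), neg_zero]

theorem obstruction_f (D : LowRelations a N s₁ s₂ e f) {i : I} {k : ℕ}
    (h : WellDefined N e f i (k + 2)) (r : ℕ) :
    obstruction (cartanMode N e f i) (-1) (f i) k r = 0 := by
  have h' : WellDefined N e f i (k + 1) := fun p q hpq => h p q (by omega)
  exact sub_eq_zero.2 (rel_of_zero (c := -2) (by norm_num) (s := s₂ i)
    (fun n => by rw [D.s₂_f, D.diag]; norm_num) (D.s₂_cartanMode_eq_zero h' i)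
    (D.s₂_cartanMode_eq_zero h i) (sub_eq_zero.1 (D.obstruction_f_zero h')) r)

/-- With K = N + k + 4, the bracket [H_K, H_{N+2}] is −[s₂, H_K] directly, and (k + 3)[s₂, H_K] by
`lie_lie_eq_smul` with m = k + 2. Hence (k + 4)[s₂, H_K] = 0. -/
theorem wellDefined_step (D : LowRelations a N s₁ s₂ e f) {i : I} {k : ℕ}
    (h : WellDefined N e f i (N i + k + 4)) : WellDefined N e f i (N i + k + 5) := by
  refine h.succ D ?_
  have key := lie_lie_eq_smul 1 (cartanMode N e f i) (e i) (f i) (N i) (k + 2) (N i + 1) 0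
    ((1 / 2 : ℂ) • ⁅s₂ i, cartanMode N e f i (N i + k + 4)⁆)
    (fun r hr => D.cartanMode_of_lt i hr) (D.cartanMode_self i)
    (fun p q hpq => by
      rw [D.ef_sub (K := N i + k + 3) h p q (by omega)]
      congr 1
      simp only [eq_iff_iff]; omega)
    (fun k' r hk' hr => ?_) (fun k' r hk' hr => ?_)
  · have h' : ⁅e i (N i + 1), f i 0⁆ = cartanMode N e f i (N i + 2) := rfl
    rw [h', D.lie_cartanMode_add_two, show N i + (k + 2) + 2 = N i + k + 4 by omega] at key
    refine (smul_eq_zero.1 (?_ : ((k : ℂ) + 4) • ⁅s₂ i, cartanMode N e f i (N i + k + 4)⁆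
      = 0)).resolve_left (by norm_cast)
    push_cast at key
    linear_combination (norm := module) (-1 : ℂ) • key
  · have : obstruction (cartanMode N e f i) 1 (e i) k' r = 0 := by
      rcases Nat.lt_or_ge k' (N i + k + 3) with hlt | hge
      · exact D.obstruction_e (fun p q hpq => h p q (by omega)) r
      -- At the top degree the bound on k' + r leaves r ≤ N + 1, so after the swap the Cartan degree
      -- r + 1 lies in the known range.
      · obtain rfl : k' = N i + k + 2 + 1 := by omega
        rw [D.obstruction_e_swap, D.obstruction_e (fun p q hpq => h p q (by omega)), neg_zero]
    rw [obstruction, sub_sub, sub_eq_zero] at this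
    exact this
  · have : obstruction (cartanMode N e f i) (-1) (f i) k' r = 0 := by
      rcases Nat.lt_or_ge k' (N i + k + 3) with hlt | hge
      · exact D.obstruction_f (fun p q hpq => h p q (by omega)) r
      · obtain rfl : k' = N i + k + 3 := by omega
        obtain rfl : r = 0 := by omega
        exact D.obstruction_f_zero (fun p q hpq => h p q (by omega))
    rw [obstruction, sub_sub, sub_eq_zero] at this
    rw [this]; module

theorem ef_eq_cartanMode (D : LowRelations a N s₁ s₂ e f) (i : I) (p q : ℕ) :
    ⁅e i p, f i q⁆ = cartanMode N e f i (p + q + 1) := by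
  have key : ∀ k, WellDefined N e f i (N i + k + 4) := by
    intro k
    induction k with
    | zero => exact D.wellDefined_add_four i
    | succ k ih => exact D.wellDefined_step ih
  exact key (p + q) p q (by omega)

theorem cartanMode_e (D : LowRelations a N s₁ s₂ e f) (i j : I) (k r : ℕ) :
    ⁅cartanMode N e f i (k + 1), e j r⁆ = ⁅cartanMode N e f i k, e j (r + 1)⁆ +
      ((a i j : ℂ) / 2) • (cartanMode N e f i k * e j r + e j r * cartanMode N e f i k) := by
  by_cases hij : i = j
  · subst hij
    have h := D.obstruction_e (i := i) (k := k) (fun p q _ => D.ef_eq_cartanMode i p q) r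
    rw [obstruction, sub_sub, sub_eq_zero] at h
    rw [h, D.diag]; norm_num
  · exact D.rel_e_ne hij k r

theorem cartanMode_f (D : LowRelations a N s₁ s₂ e f) (i j : I) (k r : ℕ) :
    ⁅cartanMode N e f i (k + 1), f j r⁆ = ⁅cartanMode N e f i k, f j (r + 1)⁆ -
      ((a i j : ℂ) / 2) • (cartanMode N e f i k * f j r + f j r * cartanMode N e f i k) := by
  by_cases hij : i = j
  · subst hij
    have h := D.obstruction_f (i := i) (k := k) (fun p q _ => D.ef_eq_cartanMode i p q) r
    rw [obstruction, sub_sub, sub_eq_zero] at h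
    rw [h, D.diag]; push_cast; module
  · exact D.rel_f_ne hij (fun p q _ => D.ef_eq_cartanMode i p q) r

theorem cartanMode_cartanMode (D : LowRelations a N s₁ s₂ e f) (i j : I) (k l : ℕ) :
    ⁅cartanMode N e f i k, cartanMode N e f j l⁆ = 0 := by
  rcases l with - | l
  · rw [RingLie.skew, D.cartanMode_zero_lie, neg_zero]
  rcases k with - | - | k
  · rw [D.cartanMode_zero_lie]
  -- The general formula starts in degree two; the mode of degree one is 0, 1 or s₁.
  · rw [D.cartanMode_eq_low i (by omega), lowCartan]
    split_ifs
    · exact RingLie.zero_left _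
    · exact RingLie.one_left _
    · exact D.s₁_cartanMode _ _ _
    · omega
  · exact lie_lie_eq_zero ((a i j : ℂ) / 2) _ (e j) (f j) k l 0 (D.cartanMode_zero_lie i)
      (fun p q => by rw [D.ef_eq_cartanMode, D.ef_eq_cartanMode]; congr 1; omega)
      (D.cartanMode_e i j) (D.cartanMode_f i j)

end Levendorskii.LowRelations

/-! ### Homomorphisms out of a shifted Yangian. -/

namespace ShiftedYangian

variable {I : Type*} (A : Matrix I I ℤ) (m : I → ℤ)

theorem symBracket_one {R : Type*} [Ring R] (x : ℕ+ → R) (p : Fin 1 → ℕ+) (y : R) :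
    CartanDoubledYangian.symBracket x p y = ⁅x (p 0), y⁆ := by
  simp [CartanDoubledYangian.symBracket]

theorem symBracket_two {R : Type*} [Ring R] (x : ℕ+ → R) (p : Fin 2 → ℕ+) (y : R) :
    CartanDoubledYangian.symBracket x p y =
      ⁅x (p 0), ⁅x (p 1), y⁆⁆ + ⁅x (p 1), ⁅x (p 0), y⁆⁆ := by
  have : (Finset.univ : Finset (Equiv.Perm (Fin 2))) = {1, Equiv.swap 0 1} := by decide
  rw [CartanDoubledYangian.symBracket, this, Finset.sum_pair (by decide)]
  simp

theorem map_lie {R S : Type*} [Ring R] [Algebra ℂ R] [Ring S] [Algebra ℂ S] (φ : R →ₐ[ℂ] S)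
    (x y : R) : φ ⁅x, y⁆ = ⁅φ x, φ y⁆ := by
  simp [Ring.lie_def]

theorem map_symBracket {R S : Type*} [Ring R] [Algebra ℂ R] [Ring S] [Algebra ℂ S]
    (φ : R →ₐ[ℂ] S) {N : ℕ} (x : ℕ+ → R) (p : Fin N → ℕ+) (y : R) :
    φ (CartanDoubledYangian.symBracket x p y) =
      CartanDoubledYangian.symBracket (fun q => φ (x q)) p (φ y) := by
  have key : ∀ l : List R, φ (l.foldr (fun a z => ⁅a, z⁆) y) =
      (l.map φ).foldr (fun a z => ⁅a, z⁆) (φ y) := by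
    intro l
    induction l with
    | nil => rfl
    | cons a l ih => simp only [List.foldr_cons, List.map_cons, map_lie, ih]
  simp only [CartanDoubledYangian.symBracket, map_sum, key, List.map_ofFn]
  rfl

/-- The images of the Cartan generators, indexed by the integers. -/
def cartanInt {R : Type*} [Ring R] (h : ℕ → R) : ℤ → R
  | Int.ofNat n => h n
  | Int.negSucc _ => 0

/-- The images of the generators of a shifted Yangian. -/
def genMap {R : Type*} [Ring R] (e f h : I → ℕ → R) : YangianGen I → R
  | .E i q => e i q.natPred
  | .F i q => f i q.natPred
  | .H i p => cartanInt (h i) p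

variable {A}

theorem exists_algHom_cartanDoubled {N : I → ℕ} {R : Type*} [Ring R] [Algebra ℂ R]
    {s₁ s₂ : I → R} {e f : I → ℕ → R} (D : Levendorskii.LowRelations A N s₁ s₂ e f) :
    ∃ φ : CartanDoubledYangian A →ₐ[ℂ] R, ∀ g,
      φ (CartanDoubledYangian.proj A (FreeAlgebra.ι ℂ g)) =
        genMap e f (fun i => Levendorskii.cartanMode N e f i) g := by
  let h := fun i => Levendorskii.cartanMode N e f i
  let ψ : FreeAlgebra ℂ (YangianGen I) →ₐ[ℂ] R := FreeAlgebra.lift ℂ (genMap e f h)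
  have hE : ∀ i q, ψ (CartanDoubledYangian.fE i q) = e i q.natPred := fun i q =>
    FreeAlgebra.lift_ι_apply _ _
  have hF : ∀ i q, ψ (CartanDoubledYangian.fF i q) = f i q.natPred := fun i q =>
    FreeAlgebra.lift_ι_apply _ _
  have hH : ∀ i q, ψ (CartanDoubledYangian.fH i q) = cartanInt (h i) q := fun i q =>
    FreeAlgebra.lift_ι_apply _ _
  have hs : ∀ q : ℕ+, (q + 1).natPred = q.natPred + 1 := fun q => by
    rw [PNat.natPred_add_one]; rfl
  have hψ : ∀ ⦃x y⦄, CartanDoubledYangian.Rel A x y → ψ x = ψ y := by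
    intro x y hxy
    induction hxy with
    | HH i j p q =>
      rw [map_lie, hH, hH, map_zero]
      rcases p with p | p <;> rcases q with q | q
      · exact D.cartanMode_cartanMode i j p q
      all_goals simp only [cartanInt, RingLie.zero, RingLie.zero_left]
    | EF_same i p q =>
      rw [map_lie, hE, hF, hH, D.ef_eq_cartanMode]
      have : (p : ℤ) + q - 1 = Int.ofNat (p.natPred + q.natPred + 1) := by
        have h1 := PNat.natPred_add_one p
        have h2 := PNat.natPred_add_one q
        simp only [Int.ofNat_eq_natCast]
        omega
      rw [this]; rfl
    | EF_ne i j hij p q => rw [map_lie, hE, hF, map_zero, D.ef_ne_all hij]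
    | HE i j p q =>
      rw [map_sub, map_lie, map_lie, map_smul, map_add, map_mul, map_mul, hH, hH, hE, hE, hs]
      rcases p with p | _ | p
      · have := D.cartanMode_e i j p q.natPred
        exact sub_eq_iff_eq_add'.2 this
      -- The boundary case p = −1: negative modes go to 0, and the mode of degree 0 is 0 or 1, hence
      -- central.
      · simpa [cartanInt, RingLie.zero_left] using D.cartanMode_zero_lie i _
      · have : Int.negSucc (p + 1) + 1 = Int.negSucc p := by omega
        simp [cartanInt, RingLie.zero_left, this]
    | HF i j p q =>
      rw [map_sub, map_lie, map_lie, map_smul, map_add, map_mul, map_mul, hH, hH, hF, hF, hs]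
      rcases p with p | _ | p
      · have := D.cartanMode_f i j p q.natPred
        rw [neg_smul]
        exact sub_eq_iff_eq_add'.2 (this.trans (sub_eq_add_neg _ _))
      · simpa [cartanInt, RingLie.zero_left] using D.cartanMode_zero_lie i _
      · have : Int.negSucc (p + 1) + 1 = Int.negSucc p := by omega
        simp [cartanInt, RingLie.zero_left, this]
    | EE i j p q =>
      rw [map_sub, map_lie, map_lie, map_smul, map_add, map_mul, map_mul]
      simp only [hE, hs]
      exact D.ee_all i j _ _
    | FF i j p q =>
      rw [map_sub, map_lie, map_lie, map_smul, map_add, map_mul, map_mul]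
      simp only [hF, hs]
      exact D.ff_all i j _ _
    | serreE i j hij N hN p q =>
      rw [map_symBracket, map_zero]
      simp only [hE]
      rcases D.off i j hij with h0 | h0
      · obtain rfl : N = 1 := by omega
        rw [symBracket_one, D.comm_e_all h0]
      · obtain rfl : N = 2 := by omega
        rw [symBracket_two]
        exact D.serre_e_all h0 _ _ _
    | serreF i j hij N hN p q =>
      rw [map_symBracket, map_zero]
      simp only [hF]
      rcases D.off i j hij with h0 | h0
      · obtain rfl : N = 1 := by omega
        rw [symBracket_one, D.comm_f_all h0]
      · obtain rfl : N = 2 := by omega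
        rw [symBracket_two]
        exact D.serre_f_all h0 _ _ _
  refine ⟨RingQuot.liftAlgHom ℂ ⟨ψ, hψ⟩, fun g => ?_⟩
  exact (RingQuot.liftAlgHom_mkAlgHom_apply ℂ ψ hψ (FreeAlgebra.ι ℂ g)).trans
    (FreeAlgebra.lift_ι_apply _ _)

/-- The universal property of the shifted Yangian with respect to the finite presentation. -/
theorem exists_algHom {N : I → ℕ} {R : Type*} [Ring R] [Algebra ℂ R]
    {s₁ s₂ : I → R} {e f : I → ℕ → R} (D : Levendorskii.LowRelations A N s₁ s₂ e f)
    (hm : ∀ i, (N i : ℤ) = -m i) :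
    ∃ φ : ShiftedYangian A m →ₐ[ℂ] R, (∀ i q, φ (E A m i q) = e i q.natPred) ∧
      (∀ i q, φ (F A m i q) = f i q.natPred) ∧ (∀ i, φ (S₁ A m i) = s₁ i) ∧
      (∀ i, φ (S₂ A m i) = s₂ i) := by
  obtain ⟨ψ, hψ⟩ := exists_algHom_cartanDoubled D
  have hψ' : ∀ ⦃x y⦄, Rel A m x y → ψ x = ψ y := by
    intro x y hxy
    induction hxy with
    | H_zero i p hp =>
      rw [CartanDoubledYangian.H, hψ, map_zero]
      rcases p with p | p
      · exact D.cartanMode_of_lt i (by have := hm i; simp only [Int.ofNat_eq_natCast] at hp; omega)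
      · rfl
    | H_one i =>
      rw [CartanDoubledYangian.H, hψ, map_one, ← hm]
      exact D.cartanMode_self i
  let φ : ShiftedYangian A m →ₐ[ℂ] R := RingQuot.liftAlgHom ℂ ⟨ψ, hψ'⟩
  have hφ : ∀ g, φ (proj A m (FreeAlgebra.ι ℂ g)) = _ := fun g =>
    (RingQuot.liftAlgHom_mkAlgHom_apply ℂ ψ hψ' _).trans (hψ g)
  have h1 : ∀ i, φ (H A m i (-m i + 1)) = s₁ i := fun i => by
    rw [H, hφ, ← hm]
    exact D.cartanMode_add_one i
  refine ⟨φ, fun i q => hφ _, fun i q => hφ _, h1, fun i => ?_⟩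
  have h2 : φ (H A m i (-m i + 2)) = s₂ i + (1 / 2 : ℂ) • (s₁ i * s₁ i) := by
    rw [H, hφ, ← hm]
    exact D.cartanMode_add_two i
  rw [S₂, map_sub, map_smul, map_pow, h1, h2, pow_two, add_sub_cancel_right]

end ShiftedYangian

/-- The combinatorics of the positive roots of a simply-laced root system: `c i γ` is the inner
product of the simple root `s i` with `γ`. -/
structure PosSystem (I P M : Type*) [AddCommGroup M] where
  root : P → M
  root_injective : Function.Injective root
  s : I → P
  s_injective : Function.Injective s
  c : I → P → ℤ
  ht : P → ℕ
  c_add : ∀ {β γ i}, root β = root γ + root (s i) → ∀ k, c k β = c k γ + c k (s i)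
  c_mem : ∀ {γ i}, γ ≠ s i → c i γ = -1 ∨ c i γ = 0 ∨ c i γ = 1
  c_self : ∀ i, c i (s i) = 2
  c_symm : ∀ i j, c i (s j) = c j (s i)
  c_simple : ∀ {i j}, i ≠ j → c i (s j) = 0 ∨ c i (s j) = -1
  exists_add : ∀ {γ i}, c i γ = -1 → ∃ β, root β = root γ + root (s i)
  exists_sub : ∀ {γ i}, c i γ = 1 → ∃ β, root γ = root β + root (s i)
  simple_or : ∀ γ, (∃ i, γ = s i) ∨ ∃ i, c i γ = 1
  ht_add : ∀ {β γ i}, root β = root γ + root (s i) → ht β = ht γ + 1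
  ht_pos : ∀ γ, 1 ≤ ht γ
  ht_simple : ∀ i, ht (s i) = 1

/-! ### Consequences of the Serre relations for root vectors. -/

namespace PosSystem

variable {I P M : Type*} [AddCommGroup M] (S : PosSystem I P M)

/-- Adding α_i raises the pairing by 2, and both pairings lie in {−1, 0, 1}; γ = α_i is excluded by
the pairing, β = α_i by the height. -/
theorem c_eq_neg_one {β γ : P} {i : I} (h : S.root β = S.root γ + S.root (S.s i)) :
    S.c i γ = -1 := by
  have h1 := S.c_add h i
  rw [S.c_self] at h1
  have hγ : γ ≠ S.s i := by
    rintro rfl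
    rw [S.c_self] at h1
    rcases eq_or_ne β (S.s i) with rfl | hne
    · rw [S.c_self] at h1; omega
    · have := S.c_mem hne; omega
  have hβ : β ≠ S.s i := by
    rintro rfl
    have h2 := S.ht_add h
    have := S.ht_pos γ
    rw [S.ht_simple] at h2; omega
  have := S.c_mem hγ
  have := S.c_mem hβ
  omega

theorem c_eq_one {β γ : P} {i : I} (h : S.root β = S.root γ + S.root (S.s i)) :
    S.c i β = 1 := by
  rw [S.c_add h, S.c_eq_neg_one h, S.c_self]; norm_num

theorem ne_simple_of_eq_add {β γ : P} {i : I} (h : S.root β = S.root γ + S.root (S.s i)) (j : I) :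
    β ≠ S.s j := by
  rintro rfl
  have h2 := S.ht_add h
  have := S.ht_pos γ
  rw [S.ht_simple] at h2; omega

theorem exists_pred {γ : P} (h : ∀ i, γ ≠ S.s i) :
    ∃ p : I × P, S.root γ = S.root p.2 + S.root (S.s p.1) := by
  rcases S.simple_or γ with ⟨i, hi⟩ | ⟨i, hi⟩
  · exact absurd hi (h i)
  · obtain ⟨β, hβ⟩ := S.exists_sub hi
    exact ⟨(i, β), hβ⟩

theorem induction {p : P → Prop} (γ : P) (simple : ∀ i, p (S.s i))
    (step : ∀ β γ i, S.root β = S.root γ + S.root (S.s i) → p γ → p β) : p γ := by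
  generalize hn : S.ht γ = n
  induction n using Nat.strong_induction_on generalizing γ with
  | _ n ih =>
    by_cases h : ∃ i, γ = S.s i
    · obtain ⟨i, rfl⟩ := h; exact simple i
    · obtain ⟨⟨i, β⟩, hβ⟩ := S.exists_pred (not_exists.1 h)
      have : S.ht γ = S.ht β + 1 := S.ht_add hβ
      exact step γ β i hβ (ih (S.ht β) (by omega) β rfl)

section RootVec

variable {L : Type*} [LieRing L] [LieAlgebra ℂ L]

open Classical in
/-- Root vectors built recursively from the vectors `X i` attached to the simple roots. -/
noncomputable def rootVec (X : I → L) (γ : P) : L :=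
  if h : ∃ p : I × P, S.root γ = S.root p.2 + S.root (S.s p.1) then
    ⁅X h.choose.1, rootVec X h.choose.2⁆
  else if h' : ∃ i, γ = S.s i then X h'.choose else 0
termination_by S.ht γ
decreasing_by
  rw [S.ht_add h.choose_spec]
  exact Nat.lt_succ_self _

theorem rootVec_simple (X : I → L) (i : I) : S.rootVec X (S.s i) = X i := by
  rw [rootVec]
  have h : ¬ ∃ p : I × P, S.root (S.s i) = S.root p.2 + S.root (S.s p.1) := fun ⟨p, hp⟩ =>
    S.ne_simple_of_eq_add hp i rfl
  have h' : ∃ j, S.s i = S.s j := ⟨i, rfl⟩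
  rw [dif_neg h, dif_pos h']
  exact congrArg X (S.s_injective h'.choose_spec).symm

theorem exists_rootVec_eq {γ : P} (h : ∀ i, γ ≠ S.s i) : ∃ k β,
    S.root γ = S.root β + S.root (S.s k) ∧
      ∀ X : I → L, S.rootVec X γ = ⁅X k, S.rootVec X β⁆ := by
  have h' := S.exists_pred h
  refine ⟨h'.choose.1, h'.choose.2, h'.choose_spec, fun X => ?_⟩
  rw [rootVec, dif_pos h']

/-- The Serre relations for a family of vectors attached to the simple roots. -/
structure Serre (X : I → L) : Prop where
  lie_eq_zero : ∀ i j, S.c i (S.s j) = 0 → ⁅X i, X j⁆ = 0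
  lie_lie_eq_zero : ∀ i j, S.c i (S.s j) = -1 → ⁅X i, ⁅X i, X j⁆⁆ = 0

variable {S} {X : I → L}

/-- A simultaneous induction on height, using only the Serre relations: a bracket vanishes unless
the pairing is −1, and vectors built along different decompositions of γ are proportional. This is
the upper bound in Serre's theorem, with one vector per positive root and no claim that it is
nonzero. -/
theorem Serre.main (hX : S.Serre X) (n : ℕ) : ∀ γ, S.ht γ ≤ n →
    (∀ i, S.c i γ ≠ -1 → ⁅X i, S.rootVec X γ⁆ = 0) ∧
    (∀ i k δ ε, S.root γ = S.root δ + S.root (S.s i) → S.root γ = S.root ε + S.root (S.s k) →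
      ∃ r : ℂ, ⁅X i, S.rootVec X δ⁆ = r • ⁅X k, S.rootVec X ε⁆) := by
  induction n with
  | zero => intro γ hγ; have := S.ht_pos γ; omega
  | succ n ih =>
    intro γ hγ
    have vanish : ∀ {δ} i, S.ht δ ≤ n → S.c i δ ≠ -1 → ⁅X i, S.rootVec X δ⁆ = 0 :=
      fun i hδ => (ih _ hδ).1 i
    have line : ∀ i k δ ε, S.root γ = S.root δ + S.root (S.s i) →
        S.root γ = S.root ε + S.root (S.s k) →
        ∃ r : ℂ, ⁅X i, S.rootVec X δ⁆ = r • ⁅X k, S.rootVec X ε⁆ := by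
      intro i k δ ε hδ hε
      by_cases hik : i = k
      · subst hik
        obtain rfl : δ = ε := S.root_injective (add_right_cancel (hδ.symm.trans hε))
        exact ⟨1, by rw [one_smul]⟩
      have h1 := S.c_add hδ k
      rw [S.c_eq_one hε] at h1
      -- If α_i and α_k are orthogonal, δ and ε lie above a common root ζ and X_i, X_k commute. If
      -- they are adjacent, c_k δ = 2 forces δ = α_k and ε = α_i.
      rcases S.c_simple (Ne.symm hik) with h0 | h0
      · rw [h0] at h1
        obtain ⟨ζ, hζ⟩ := S.exists_sub (γ := δ) (i := k) (by omega)
        have hζ' : S.root ε = S.root ζ + S.root (S.s i) := by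
          rw [hδ, hζ] at hε
          exact add_right_cancel (b := S.root (S.s k)) (hε.symm.trans (by abel))
        have e1 := S.ht_add hδ
        have e2 := S.ht_add hε
        have xik : ⁅X i, X k⁆ = 0 := hX.lie_eq_zero i k (by rw [S.c_symm, h0])
        obtain ⟨r, hr⟩ : ∃ r : ℂ, S.rootVec X δ = r • ⁅X k, S.rootVec X ζ⁆ := by
          obtain ⟨l, η, hη, hl⟩ := S.exists_rootVec_eq (L := L) (S.ne_simple_of_eq_add hζ)
          rw [hl]
          exact (ih δ (by omega)).2 l k η ζ hη hζ
        obtain ⟨r', hr'⟩ : ∃ r : ℂ, ⁅X i, S.rootVec X ζ⁆ = r • S.rootVec X ε := by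
          obtain ⟨l, η, hη, hl⟩ := S.exists_rootVec_eq (L := L) (S.ne_simple_of_eq_add hζ')
          rw [hl]
          exact (ih ε (by omega)).2 i l ζ η hζ' hη
        refine ⟨r * r', ?_⟩
        rw [hr, lie_smul, leibniz_lie, xik, zero_lie, zero_add, hr', lie_smul, smul_smul]
      · rw [h0] at h1
        have hδk : δ = S.s k := by
          by_contra hne
          have := S.c_mem hne; omega
        have hεi : ε = S.s i := by
          apply S.root_injective
          rw [hδ, hδk, add_comm] at hε
          exact (add_right_cancel hε).symm
        exact ⟨-1, by rw [hδk, hεi, S.rootVec_simple, S.rootVec_simple, neg_one_smul, lie_skew]⟩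
    refine ⟨fun i hi => ?_, line⟩
    by_cases hs : ∃ j, γ = S.s j
    · obtain ⟨j, rfl⟩ := hs
      rw [S.rootVec_simple]
      by_cases hij : i = j
      · rw [hij, lie_self]
      · exact hX.lie_eq_zero i j ((S.c_simple hij).resolve_right hi)
    have hns := not_exists.1 hs
    have up : ∀ {δ ε} j, S.ht ε ≤ n → S.root ε = S.root δ + S.root (S.s j) →
        (∃ r : ℂ, ⁅X j, S.rootVec X δ⁆ = r • S.rootVec X ε) ∧
        ∃ r : ℂ, S.rootVec X ε = r • ⁅X j, S.rootVec X δ⁆ := by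
      intro δ ε j hht hε
      obtain ⟨l, η, hη, hl⟩ := S.exists_rootVec_eq (L := L) (S.ne_simple_of_eq_add hε)
      rw [hl]
      exact ⟨(ih ε hht).2 j l δ η hε hη, (ih ε hht).2 l j η δ hη hε⟩
    rcases S.c_mem (hns i) with h | h | h
    · exact absurd h hi
    · obtain ⟨j, γ', hγ', hl⟩ := S.exists_rootVec_eq (L := L) hns
      have hht := S.ht_add hγ'
      have hc := S.c_add hγ' i
      have hij : i ≠ j := by
        rintro rfl
        rw [S.c_eq_one hγ'] at h; omega
      rw [hl]
      rcases S.c_simple hij with h0 | h0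
      · rw [leibniz_lie, hX.lie_eq_zero i j h0, zero_lie, zero_add,
          vanish i (by omega) (by omega), lie_zero]
      · obtain ⟨γ'', hγ''⟩ := S.exists_sub (γ := γ') (i := i) (by omega)
        have hht' := S.ht_add hγ''
        have hj := S.c_add hγ'' j
        rw [S.c_eq_neg_one hγ', S.c_symm, h0] at hj
        obtain ⟨r, hr⟩ := (up i (by omega) hγ'').2
        obtain ⟨r', hr'⟩ := (up i (by omega) hγ'').1
        have z1 : ⁅X j, S.rootVec X γ''⁆ = 0 := vanish j (by omega) (by omega)
        have z2 : ⁅X i, ⁅X i, S.rootVec X γ''⁆⁆ = 0 := by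
          rw [hr', lie_smul, vanish i (by omega) (by omega), smul_zero]
        have z3 := hX.lie_lie_eq_zero i j h0
        rw [hr, lie_smul, lie_smul]
        -- Because [X_i, [X_i, X_j]] = 0, this element equals its own negative.
        suffices ⁅X i, ⁅X j, ⁅X i, S.rootVec X γ''⁆⁆⁆ = 0 by rw [this, smul_zero]
        have e1 : ⁅X j, ⁅X i, S.rootVec X γ''⁆⁆ = ⁅⁅X j, X i⁆, S.rootVec X γ''⁆ := by
          rw [leibniz_lie (X j), z1, lie_zero, add_zero]
        have z4 : ⁅X i, ⁅X j, X i⁆⁆ = 0 := by rw [← lie_skew (X j) (X i), lie_neg, z3, neg_zero]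
        have e2 : ⁅X i, ⁅⁅X j, X i⁆, S.rootVec X γ''⁆⁆ =
            -⁅X i, ⁅X j, ⁅X i, S.rootVec X γ''⁆⁆⁆ := by
          rw [leibniz_lie (X i), z4, zero_lie, zero_add, lie_lie, z2, lie_zero, zero_sub]
        rw [e1] at e2 ⊢
        have : (2 : ℂ) • ⁅X i, ⁅⁅X j, X i⁆, S.rootVec X γ''⁆⁆ = 0 := by
          rw [two_smul]; nth_rewrite 1 [e2]; exact neg_add_cancel _
        exact (smul_eq_zero.1 this).resolve_left two_ne_zero
    · obtain ⟨γ', hγ'⟩ := S.exists_sub h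
      have hht := S.ht_add hγ'
      obtain ⟨r, hr⟩ : ∃ r : ℂ, S.rootVec X γ = r • ⁅X i, S.rootVec X γ'⁆ := by
        obtain ⟨l, η, hη, hl⟩ := S.exists_rootVec_eq (L := L) hns
        rw [hl]
        exact line l i η γ' hη hγ'
      rw [hr, lie_smul]
      -- A further simple root α_j is removed from γ'. If it is orthogonal to α_i, X_i passes
      -- through X_j; if adjacent, X_i kills the remaining vector and the Serre relation applies to
      -- X_j.
      suffices ⁅X i, ⁅X i, S.rootVec X γ'⁆⁆ = 0 by rw [this, smul_zero]
      have hc' := S.c_eq_neg_one hγ'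
      by_cases hs' : ∃ j, γ' = S.s j
      · obtain ⟨j, rfl⟩ := hs'
        rw [S.rootVec_simple]
        exact hX.lie_lie_eq_zero i j hc'
      obtain ⟨j, δ, hδ, hl⟩ := S.exists_rootVec_eq (L := L) (not_exists.1 hs')
      have hht' := S.ht_add hδ
      have hc := S.c_add hδ i
      have hij : i ≠ j := by
        rintro rfl
        rw [S.c_eq_one hδ] at hc'; omega
      rw [hl]
      rcases S.c_simple hij with h0 | h0
      · rw [leibniz_lie (X i) (X j), hX.lie_eq_zero i j h0, zero_lie, zero_add,
          leibniz_lie (X i) (X j), hX.lie_eq_zero i j h0, zero_lie, zero_add]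
        obtain ⟨ζ, hζ⟩ := S.exists_add (γ := δ) (i := i) (by omega)
        have hht'' := S.ht_add hζ
        obtain ⟨r', hr'⟩ := (up i (by omega) hζ).1
        rw [hr', lie_smul, vanish i (by omega) (by rw [S.c_eq_one hζ]; decide), smul_zero, lie_zero]
      · have z : ⁅X i, S.rootVec X δ⁆ = 0 := vanish i (by omega) (by omega)
        rw [leibniz_lie (X i) (X j), z, lie_zero, add_zero, leibniz_lie (X i) ⁅X i, X j⁆, z,
          hX.lie_lie_eq_zero i j h0, zero_lie, lie_zero, add_zero]

theorem Serre.lie_rootVec_eq_zero (hX : S.Serre X) {i : I} {γ : P} (h : S.c i γ ≠ -1) :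
    ⁅X i, S.rootVec X γ⁆ = 0 :=
  (hX.main _ γ le_rfl).1 i h

theorem Serre.exists_lie_rootVec (hX : S.Serre X) {i : I} {γ β : P}
    (h : S.root β = S.root γ + S.root (S.s i)) :
    ∃ r : ℂ, ⁅X i, S.rootVec X γ⁆ = r • S.rootVec X β := by
  obtain ⟨l, η, hη, hl⟩ := S.exists_rootVec_eq (L := L) (S.ne_simple_of_eq_add h)
  rw [hl]
  exact (hX.main _ β le_rfl).2 i l γ η h hη

theorem Serre.lie_rootVec_mem (hX : S.Serre X) (i : I) (γ : P) :
    ⁅X i, S.rootVec X γ⁆ ∈ Submodule.span ℂ (Set.range (S.rootVec X)) := by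
  by_cases h : S.c i γ = -1
  · obtain ⟨β, hβ⟩ := S.exists_add h
    obtain ⟨r, hr⟩ := hX.exists_lie_rootVec hβ
    rw [hr]
    exact Submodule.smul_mem _ _ (Submodule.subset_span ⟨β, rfl⟩)
  · rw [hX.lie_rootVec_eq_zero h]; exact Submodule.zero_mem _

end RootVec

end PosSystem

/-! ### Chevalley–Serre elements and the homomorphisms they define. -/

namespace PosSystem

variable {I P M : Type*} [AddCommGroup M] (S : PosSystem I P M)

theorem rootVec_induction {L : Type*} [LieRing L] [LieAlgebra ℂ L] {p : P → Prop} (γ : P)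
    (simple : ∀ i, p (S.s i))
    (step : ∀ β γ k, S.root β = S.root γ + S.root (S.s k) →
      (∀ X : I → L, S.rootVec X β = ⁅X k, S.rootVec X γ⁆) → p γ → p β) : p γ := by
  generalize hn : S.ht γ = n
  induction n using Nat.strong_induction_on generalizing γ with
  | _ n ih =>
    by_cases h : ∃ i, γ = S.s i
    · obtain ⟨i, rfl⟩ := h; exact simple i
    · obtain ⟨k, β, hβ, hv⟩ := S.exists_rootVec_eq (L := L) (not_exists.1 h)
      have : S.ht γ = S.ht β + 1 := S.ht_add hβ
      exact step γ β k hβ hv (ih (S.ht β) (by omega) β rfl)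

theorem map_rootVec {L L' : Type*} [LieRing L] [LieAlgebra ℂ L] [LieRing L'] [LieAlgebra ℂ L']
    (φ : L →ₗ⁅ℂ⁆ L') (X : I → L) (γ : P) :
    φ (S.rootVec X γ) = S.rootVec (fun i => φ (X i)) γ := by
  generalize hn : S.ht γ = n
  induction n using Nat.strong_induction_on generalizing γ with
  | _ n ih =>
    rw [rootVec, rootVec]
    split_ifs with h h'
    · have := S.ht_add h.choose_spec
      rw [LieHom.map_lie, ih (S.ht h.choose.2) (by omega) _ rfl]
    · rfl
    · exact φ.map_zero

theorem rootVec_mem {L : Type*} [LieRing L] [LieAlgebra ℂ L] (N : LieSubalgebra ℂ L) {X : I → L}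
    (hX : ∀ i, X i ∈ N) (γ : P) : S.rootVec X γ ∈ N := by
  induction γ using S.rootVec_induction (L := L) with
  | simple i => rw [S.rootVec_simple]; exact hX i
  | step β γ k _ hv ih => rw [hv]; exact N.lie_mem (hX k) ih

section Chevalley

variable {L : Type*} [LieRing L] [LieAlgebra ℂ L]

/-- The Chevalley–Serre relations. -/
structure ChevalleySerre (X Y H : I → L) : Prop where
  lie_H_H : ∀ i j, ⁅H i, H j⁆ = 0
  lie_H_X : ∀ i j, ⁅H i, X j⁆ = (S.c i (S.s j) : ℂ) • X j
  lie_H_Y : ∀ i j, ⁅H i, Y j⁆ = -(S.c i (S.s j) : ℂ) • Y j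
  lie_X_Y : ∀ i, ⁅X i, Y i⁆ = H i
  lie_X_Y_ne : ∀ i j, i ≠ j → ⁅X i, Y j⁆ = 0
  serre_X : S.Serre X
  serre_Y : S.Serre Y

/-- The spanning family built from Chevalley generators. -/
noncomputable def genFamily (X Y H : I → L) : (P ⊕ P) ⊕ I → L :=
  Sum.elim (Sum.elim (S.rootVec X) (S.rootVec Y)) H

/-- The span of the root vectors and the Cartan elements. -/
noncomputable def genSpan (X Y H : I → L) : Submodule ℂ L :=
  Submodule.span ℂ (Set.range (S.genFamily X Y H))

variable {S} {X Y H : I → L}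

theorem X_mem_genSpan (γ : P) : S.rootVec X γ ∈ S.genSpan X Y H :=
  Submodule.subset_span ⟨Sum.inl (Sum.inl γ), rfl⟩

theorem Y_mem_genSpan (γ : P) : S.rootVec Y γ ∈ S.genSpan X Y H :=
  Submodule.subset_span ⟨Sum.inl (Sum.inr γ), rfl⟩

theorem H_mem_genSpan (i : I) : H i ∈ S.genSpan X Y H :=
  Submodule.subset_span ⟨Sum.inr i, rfl⟩

theorem genSpan_le {N : Submodule ℂ L} (hX : ∀ γ, S.rootVec X γ ∈ N) (hY : ∀ γ, S.rootVec Y γ ∈ N)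
    (hH : ∀ i, H i ∈ N) : S.genSpan X Y H ≤ N := by
  refine Submodule.span_le.2 ?_
  rintro _ ⟨(γ | γ) | i, rfl⟩
  · exact hX γ
  · exact hY γ
  · exact hH i

namespace ChevalleySerre

theorem symm (h : S.ChevalleySerre X Y H) : S.ChevalleySerre Y X (fun i => -H i) where
  lie_H_H i j := by rw [neg_lie, lie_neg, h.lie_H_H, neg_zero, neg_zero]
  lie_H_X i j := by rw [neg_lie, h.lie_H_Y, neg_smul, neg_neg]
  lie_H_Y i j := by rw [neg_lie, h.lie_H_X, neg_smul]
  lie_X_Y i := by rw [← lie_skew, h.lie_X_Y]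
  lie_X_Y_ne i j hij := by rw [← lie_skew, h.lie_X_Y_ne j i hij.symm, neg_zero]
  serre_X := h.serre_Y
  serre_Y := h.serre_X

theorem genSpan_symm (h : S.ChevalleySerre X Y H) :
    S.genSpan Y X (fun i => -H i) = S.genSpan X Y H := by
  refine le_antisymm (genSpan_le Y_mem_genSpan X_mem_genSpan fun i => neg_mem (H_mem_genSpan i))
    (genSpan_le Y_mem_genSpan X_mem_genSpan fun i => ?_)
  rw [← neg_neg (H i)]
  exact neg_mem (H_mem_genSpan (H := fun i => -H i) i)

theorem lie_H_rootVec (h : S.ChevalleySerre X Y H) (i : I) (γ : P) :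
    ⁅H i, S.rootVec X γ⁆ = (S.c i γ : ℂ) • S.rootVec X γ := by
  induction γ using S.rootVec_induction (L := L) with
  | simple j => rw [S.rootVec_simple, h.lie_H_X]
  | step β γ j hβ hv ih =>
    rw [hv, leibniz_lie, h.lie_H_X, ih, smul_lie, lie_smul, S.c_add hβ]
    push_cast; module

/-- Mere membership is too weak for the induction on γ. One has to remember that the result is a
multiple of H_i when γ = α_i, and otherwise zero or of weight γ − α_i. -/
theorem lie_Y_rootVec_mem (h : S.ChevalleySerre X Y H) (i : I) (γ : P) :
    ⁅Y i, S.rootVec X γ⁆ ∈ S.genSpan X Y H := by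
  suffices key : (∃ r : ℂ, γ = S.s i ∧ ⁅Y i, S.rootVec X γ⁆ = r • H i) ∨
      ∃ (δ : P) (r : ℂ), (r = 0 ∨ S.root γ = S.root δ + S.root (S.s i)) ∧
        ⁅Y i, S.rootVec X γ⁆ = r • S.rootVec X δ by
    rcases key with ⟨r, -, hr⟩ | ⟨δ, r, -, hr⟩ <;> rw [hr]
    · exact Submodule.smul_mem _ _ (H_mem_genSpan i)
    · exact Submodule.smul_mem _ _ (X_mem_genSpan δ)
  induction γ using S.rootVec_induction (L := L) with
  | simple j =>
    rw [S.rootVec_simple]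
    by_cases hij : i = j
    · subst hij
      exact Or.inl ⟨-1, rfl, by rw [← lie_skew, h.lie_X_Y, neg_one_smul]⟩
    · exact Or.inr ⟨S.s j, 0, Or.inl rfl, by
        rw [← lie_skew, h.lie_X_Y_ne j i (Ne.symm hij), neg_zero, zero_smul]⟩
  | step β γ k hβ hv ih =>
    right
    rw [hv, leibniz_lie]
    have e1 : ∃ r : ℂ, (r = 0 ∨ i = k) ∧ ⁅⁅Y i, X k⁆, S.rootVec X γ⁆ = r • S.rootVec X γ := by
      by_cases hik : i = k
      · subst hik
        exact ⟨-S.c i γ, Or.inr rfl, by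
          rw [← lie_skew (Y i) (X i), neg_lie, h.lie_X_Y, h.lie_H_rootVec, neg_smul]⟩
      · exact ⟨0, Or.inl rfl, by
          rw [← lie_skew (Y i) (X k), h.lie_X_Y_ne k i (Ne.symm hik), neg_zero, zero_lie, zero_smul]⟩
    obtain ⟨r, hr, e1⟩ := e1
    rw [e1]
    rcases ih with ⟨r', rfl, hr'⟩ | ⟨δ, r', hr1, hr'⟩
    · by_cases hik : i = k
      · subst hik
        exact absurd (S.c_eq_neg_one hβ) (by rw [S.c_self]; decide)
      · refine ⟨S.s k, -r' * S.c i (S.s k), Or.inr (hβ.trans (add_comm _ _)), ?_⟩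
        rw [hr.resolve_right hik, hr', lie_smul, ← lie_skew (X k) (H i), h.lie_H_X, S.rootVec_simple X k]
        module
    · rw [hr', lie_smul]
      rcases hr1 with rfl | hδ
      · refine ⟨γ, r, hr.imp id fun hik => by subst hik; exact hβ, by rw [zero_smul, add_zero]⟩
      · by_cases hc : S.c k δ = -1
        · obtain ⟨ε, hε⟩ := S.exists_add hc
          obtain ⟨r'', hr''⟩ := h.serre_X.exists_lie_rootVec hε
          have hβ' : S.root β = S.root ε + S.root (S.s i) := by
            rw [hβ, hδ, hε]; abel
          rw [hr'']
          by_cases hik : i = k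
          · subst hik
            obtain rfl : γ = ε := S.root_injective (add_right_cancel (hβ.symm.trans hβ'))
            exact ⟨γ, r + r' * r'', Or.inr hβ, by module⟩
          · rw [hr.resolve_right hik]
            exact ⟨ε, r' * r'', Or.inr hβ', by module⟩
        · rw [h.serre_X.lie_rootVec_eq_zero hc, smul_zero, add_zero]
          exact ⟨γ, r, hr.imp id fun hik => by subst hik; exact hβ, rfl⟩

theorem lie_X_mem (h : S.ChevalleySerre X Y H) (i : I) {z : L} (hz : z ∈ S.genSpan X Y H) :
    ⁅X i, z⁆ ∈ S.genSpan X Y H := by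
  suffices S.genSpan X Y H ≤ (S.genSpan X Y H).comap (LieAlgebra.ad ℂ L (X i)) from
    this hz
  refine genSpan_le (fun γ => ?_) (fun γ => ?_) (fun j => ?_)
  · have hle : Submodule.span ℂ (Set.range (S.rootVec X)) ≤ S.genSpan X Y H :=
      Submodule.span_le.2 (by rintro _ ⟨γ, rfl⟩; exact X_mem_genSpan γ)
    exact hle (h.serre_X.lie_rootVec_mem i γ)
  · rw [← h.genSpan_symm]
    exact h.symm.lie_Y_rootVec_mem i γ
  · change ⁅X i, H j⁆ ∈ S.genSpan X Y H
    rw [← lie_skew, h.lie_H_X, ← S.rootVec_simple X i]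
    exact neg_mem (Submodule.smul_mem _ _ (X_mem_genSpan _))

theorem lie_Y_mem (h : S.ChevalleySerre X Y H) (i : I) {z : L} (hz : z ∈ S.genSpan X Y H) :
    ⁅Y i, z⁆ ∈ S.genSpan X Y H := by
  rw [← h.genSpan_symm] at hz ⊢
  exact h.symm.lie_X_mem i hz

theorem iterBracket_X_mem (h : S.ChevalleySerre X Y H) (w : List I) :
    iterBracket X w ∈ S.genSpan X Y H := by
  induction w with
  | nil => exact Submodule.zero_mem _
  | cons i w ih =>
    cases w with
    | nil => rw [iterBracket, ← S.rootVec_simple X i]; exact X_mem_genSpan _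
    | cons j w => exact h.lie_X_mem i ih

theorem iterBracket_Y_mem (h : S.ChevalleySerre X Y H) (w : List I) :
    iterBracket Y w ∈ S.genSpan X Y H := by
  rw [← h.genSpan_symm]
  exact h.symm.iterBracket_X_mem w

end ChevalleySerre

/-- Chevalley–Serre elements of any Lie algebra are the images of Chevalley generators under a
homomorphism, provided that the root vectors and Cartan elements form a basis of the source. -/
theorem ChevalleySerre.exists_lieHom {L' : Type*} [LieRing L'] [LieAlgebra ℂ L']
    {X' Y' H' : I → L'} (h : S.ChevalleySerre X Y H) (h' : S.ChevalleySerre X' Y' H')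
    (hli : LinearIndependent ℂ (S.genFamily X Y H)) (hspan : S.genSpan X Y H = ⊤) :
    ∃ ρ : L →ₗ⁅ℂ⁆ L', (∀ i, ρ (X i) = X' i) ∧ (∀ i, ρ (Y i) = Y' i) ∧ ∀ i, ρ (H i) = H' i := by
  let B := Module.Basis.mk hli hspan.ge
  let ρ : L →ₗ[ℂ] L' := B.constr ℂ (S.genFamily X' Y' H')
  have hρ : ∀ u, ρ (S.genFamily X Y H u) = S.genFamily X' Y' H' u := fun u => by
    rw [← Module.Basis.mk_apply hli hspan.ge u]; exact B.constr_basis ℂ _ u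
  -- The pairs satisfy the same relations in L × L', so the span of their root vectors is stable
  -- under brackets with the generators. That span is the graph of ρ, so ρ respects brackets with
  -- generators.
  let X₂ : I → L × L' := fun i => (X i, X' i)
  let Y₂ : I → L × L' := fun i => (Y i, Y' i)
  let H₂ : I → L × L' := fun i => (H i, H' i)
  have h₂ : S.ChevalleySerre X₂ Y₂ H₂ :=
    { lie_H_H := fun i j => Prod.ext (h.lie_H_H i j) (h'.lie_H_H i j)
      lie_H_X := fun i j => Prod.ext (h.lie_H_X i j) (h'.lie_H_X i j)
      lie_H_Y := fun i j => Prod.ext (h.lie_H_Y i j) (h'.lie_H_Y i j)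
      lie_X_Y := fun i => Prod.ext (h.lie_X_Y i) (h'.lie_X_Y i)
      lie_X_Y_ne := fun i j hij => Prod.ext (h.lie_X_Y_ne i j hij) (h'.lie_X_Y_ne i j hij)
      serre_X := ⟨fun i j hij => Prod.ext (h.serre_X.1 i j hij) (h'.serre_X.1 i j hij),
        fun i j hij => Prod.ext (h.serre_X.2 i j hij) (h'.serre_X.2 i j hij)⟩
      serre_Y := ⟨fun i j hij => Prod.ext (h.serre_Y.1 i j hij) (h'.serre_Y.1 i j hij),
        fun i j hij => Prod.ext (h.serre_Y.2 i j hij) (h'.serre_Y.2 i j hij)⟩ }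
  have hpair : ∀ u, S.genFamily X₂ Y₂ H₂ u = (S.genFamily X Y H u, S.genFamily X' Y' H' u) := by
    rintro ((γ | γ) | i)
    · exact Prod.ext (S.map_rootVec (LieHom.fst ℂ L L') X₂ γ) (S.map_rootVec (LieHom.snd ℂ L L') X₂ γ)
    · exact Prod.ext (S.map_rootVec (LieHom.fst ℂ L L') Y₂ γ) (S.map_rootVec (LieHom.snd ℂ L L') Y₂ γ)
    · rfl
  have graph : ∀ z, z ∈ S.genSpan X₂ Y₂ H₂ ↔ z.2 = ρ z.1 := by
    intro z
    constructor
    · intro hz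
      suffices S.genSpan X₂ Y₂ H₂ ≤
          LinearMap.ker (LinearMap.snd ℂ L L' - ρ ∘ₗ LinearMap.fst ℂ L L') from
        sub_eq_zero.1 (this hz)
      refine Submodule.span_le.2 ?_
      rintro _ ⟨u, rfl⟩
      rw [hpair]
      exact sub_eq_zero.2 (hρ u).symm
    · intro hz
      suffices (⊤ : Submodule ℂ L) ≤
          (S.genSpan X₂ Y₂ H₂).comap (LinearMap.prod LinearMap.id ρ) by
        have := this (Submodule.mem_top (x := z.1))
        rwa [show z = (z.1, ρ z.1) from Prod.ext rfl hz]
      rw [← hspan]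
      refine Submodule.span_le.2 ?_
      rintro _ ⟨u, rfl⟩
      change (S.genFamily X Y H u, ρ (S.genFamily X Y H u)) ∈ S.genSpan X₂ Y₂ H₂
      rw [hρ, ← hpair]
      exact Submodule.subset_span ⟨u, rfl⟩
  have hXs : ∀ i, ρ (X i) = X' i := fun i => by
    have := hρ (Sum.inl (Sum.inl (S.s i)))
    simpa only [genFamily, Sum.elim_inl, S.rootVec_simple] using this
  have hYs : ∀ i, ρ (Y i) = Y' i := fun i => by
    have := hρ (Sum.inl (Sum.inr (S.s i)))
    simpa only [genFamily, Sum.elim_inl, Sum.elim_inr, S.rootVec_simple] using this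
  -- The elements y for which ρ respects every bracket with y form a subalgebra by the Jacobi
  -- identity, and it contains the generators.
  let N : LieSubalgebra ℂ L :=
    { carrier := {y | ∀ x, ρ ⁅y, x⁆ = ⁅ρ y, ρ x⁆}
      add_mem' := fun {a b} ha hb x => by
        rw [add_lie, map_add, ha, hb, map_add, add_lie]
      zero_mem' := fun x => by rw [zero_lie, map_zero, zero_lie]
      smul_mem' := fun c a ha x => by rw [smul_lie, map_smul, ha, map_smul, smul_lie]
      lie_mem' := fun {a b} ha hb x => by
        rw [lie_lie, map_sub, ha, hb, hb, ha, ha, lie_lie] }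
  have hXN : ∀ i, X i ∈ N := fun i x => by
    rw [hXs]
    exact ((graph _).1 (h₂.lie_X_mem i ((graph (x, ρ x)).2 rfl))).symm
  have hYN : ∀ i, Y i ∈ N := fun i x => by
    rw [hYs]
    exact ((graph _).1 (h₂.lie_Y_mem i ((graph (x, ρ x)).2 rfl))).symm
  have hN : ∀ y, y ∈ N := by
    intro y
    have : S.genSpan X Y H ≤ N.toSubmodule := by
      refine genSpan_le (fun γ => ?_) (fun γ => ?_) fun i => ?_
      · exact S.rootVec_mem N hXN γ
      · exact S.rootVec_mem N hYN γ
      · rw [← h.lie_X_Y i]; exact N.lie_mem (hXN i) (hYN i)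
    exact this (hspan ▸ Submodule.mem_top)
  exact ⟨{ ρ with map_lie' := fun {x y} => hN x y }, hXs, hYs, fun i => hρ (Sum.inr i)⟩

end Chevalley

end PosSystem

/-! ### Positive roots of simply-laced root systems. -/

namespace RootPairing.Base

variable {ι R M N : Type*} [Finite ι] [Field R] [CharZero R] [AddCommGroup M] [Module R M]
  [AddCommGroup N] [Module R N] {P : RootPairing ι R M N} [P.IsRootSystem] [P.IsCrystallographic]
  [P.IsReduced] (b : P.Base)

theorem cartanMatrix_symm_of_isSimplyLaced (hb : b.cartanMatrix.IsSimplyLaced) (i j : b.support) :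
    b.cartanMatrix i j = b.cartanMatrix j i := by
  rcases eq_or_ne i j with rfl | hij
  · rfl
  have h := b.cartanMatrix_apply_eq_zero_iff_symm (i := i) (j := j)
  have h1 := hb hij
  have h2 := hb hij.symm
  omega

/-- In a simply-laced root system the coroots depend linearly on the roots. -/
theorem exists_linearMap_root_eq_coroot (hb : b.cartanMatrix.IsSimplyLaced) :
    ∃ T : M →ₗ[R] N, (∀ i, T (P.root i) = P.coroot i) ∧
      ∀ x y, P.toLinearMap x (T y) = P.toLinearMap y (T x) := by
  let T : M →ₗ[R] N := b.toWeightBasis.constr R fun i => P.coroot i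
  have hT : ∀ i ∈ b.support, T (P.root i) = P.coroot i := fun i hi => by
    have := b.toWeightBasis.constr_basis R (fun i => P.coroot i) ⟨i, hi⟩
    rwa [b.toWeightBasis_apply] at this
  have hsymm : ∀ x y, P.toLinearMap x (T y) = P.toLinearMap y (T x) := by
    suffices h : P.toLinearMap.compl₂ T = (P.toLinearMap.compl₂ T).flip from fun x y =>
      LinearMap.congr_fun (LinearMap.congr_fun h x) y
    refine b.toWeightBasis.ext fun i => b.toWeightBasis.ext fun j => ?_
    simp only [LinearMap.compl₂_apply, LinearMap.flip_apply, toWeightBasis_apply]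
    rw [hT _ i.2, hT _ j.2, root_coroot_eq_pairing, root_coroot_eq_pairing,
      ← P.algebraMap_pairingIn ℤ, ← P.algebraMap_pairingIn ℤ]
    exact congrArg _ (b.cartanMatrix_symm_of_isSimplyLaced hb i j)
  refine ⟨T, fun i => ?_, hsymm⟩
  -- By symmetry of the pairing, T intertwines the reflections of roots and coroots, so the identity
  -- spreads from the simple roots.
  induction i using b.induction_reflect with
  | h₀ i hi => rw [root_reflectionPerm, coroot_reflectionPerm]; simp [hi]
  | h₁ i hi => exact hT i hi
  | h₂ i j hi hj =>
    rw [root_reflectionPerm, coroot_reflectionPerm, reflection_apply_root, coreflection_apply_coroot,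
      map_sub, map_smul, hi, hT j hj]
    have := hsymm (P.root i) (P.root j)
    rw [hi, hT j hj, root_coroot_eq_pairing, root_coroot_eq_pairing] at this
    rw [this]

variable {b}

theorem coroot_add_of_root_add (hb : b.cartanMatrix.IsSimplyLaced) {i j k : ι}
    (h : P.root k = P.root i + P.root j) : P.coroot k = P.coroot i + P.coroot j := by
  obtain ⟨T, hT, -⟩ := b.exists_linearMap_root_eq_coroot hb
  rw [← hT, h, map_add, hT, hT]

theorem pairingIn_symm (hb : b.cartanMatrix.IsSimplyLaced) (i j : ι) :
    P.pairingIn ℤ i j = P.pairingIn ℤ j i := by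
  obtain ⟨T, hT, hs⟩ := b.exists_linearMap_root_eq_coroot hb
  apply FaithfulSMul.algebraMap_injective ℤ R
  rw [P.algebraMap_pairingIn ℤ, P.algebraMap_pairingIn ℤ, ← root_coroot_eq_pairing,
    ← root_coroot_eq_pairing, ← hT, ← hT, hs]

theorem pairingIn_mem_of_ne (hb : b.cartanMatrix.IsSimplyLaced) {i j : ι} (hij : i ≠ j)
    (hij' : P.root i ≠ -P.root j) :
    P.pairingIn ℤ i j = -1 ∨ P.pairingIn ℤ i j = 0 ∨ P.pairingIn ℤ i j = 1 := by
  have h := P.pairingIn_pairingIn_mem_set_of_isCrystal_of_isRed' i j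
    (fun h => hij (P.root.injective h)) hij'
  rw [← pairingIn_symm hb i j] at h
  simp only [Set.mem_insert_iff, Set.mem_singleton_iff, Prod.mk.injEq] at h
  omega

theorem IsPos.root_ne_neg {i j : ι} (hi : b.IsPos i) (hj : b.IsPos j) : P.root i ≠ -P.root j := by
  intro h
  let := P.indexNeg
  have : i = -j := by
    apply P.root.injective
    rw [h, indexNeg_neg, root_reflectionPerm, reflection_apply_self]
  rw [this, IsPos.neg_iff_not] at hi
  exact hi hj

/-- The positive roots of a simply-laced root system. -/
noncomputable def posSystem (hb : b.cartanMatrix.IsSimplyLaced) : PosSystem b.support {i : ι // b.IsPos i} M where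
  root γ := P.root γ.1
  root_injective γ δ h := Subtype.ext (P.root.injective h)
  s i := ⟨i.1, isPos_of_mem_support i.2⟩
  s_injective i j h := Subtype.ext (congrArg (fun γ => γ.1) h)
  c i γ := P.pairingIn ℤ i γ.1
  ht γ := (b.height γ.1).toNat
  c_add {β γ i} h k := by
    apply FaithfulSMul.algebraMap_injective ℤ R
    simp only [map_add, P.algebraMap_pairingIn ℤ, ← root_coroot_eq_pairing]
    rw [coroot_add_of_root_add hb h, map_add]
  c_mem {γ i} h := pairingIn_mem_of_ne hb (fun h' => h (Subtype.ext h'.symm))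
    ((isPos_of_mem_support i.2).root_ne_neg γ.2)
  c_self i := P.pairingIn_same ℤ i
  c_symm i j := pairingIn_symm hb _ _
  c_simple {i j} h := hb h
  exists_add {γ i} h := by
    obtain ⟨β, hβ⟩ := P.root_add_root_mem_of_pairingIn_neg (i := γ.1) (j := i)
      (by rw [pairingIn_symm hb, h]; decide) (γ.2.root_ne_neg (isPos_of_mem_support i.2))
    exact ⟨⟨β, γ.2.add (isPos_of_mem_support i.2) hβ⟩, hβ⟩
  exists_sub {γ i} h := by
    obtain ⟨β, hβ⟩ := P.root_sub_root_mem_of_pairingIn_pos (i := γ.1) (j := i)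
      (by rw [pairingIn_symm hb, h]; decide) (by
        intro h'
        rw [h', P.pairingIn_same] at h
        omega)
    exact ⟨⟨β, γ.2.sub i.2 hβ⟩, by rw [hβ, sub_add_cancel]⟩
  simple_or γ := by
    obtain ⟨j, hj, hj'⟩ := γ.2.exists_mem_support_pos_pairingIn
    by_cases h : j = γ.1
    · exact Or.inl ⟨⟨j, hj⟩, Subtype.ext h.symm⟩
    · have := pairingIn_mem_of_ne hb h ((isPos_of_mem_support hj).root_ne_neg γ.2)
      exact Or.inr ⟨⟨j, hj⟩, by change P.pairingIn ℤ j γ.1 = 1; omega⟩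
  ht_add {β γ i} h := by
    have h1 := b.height_add h
    rw [height_one_of_mem_support i.2] at h1
    have := b.isPos_iff.1 γ.2
    omega
  ht_pos γ := by have := b.isPos_iff.1 γ.2; omega
  ht_simple i := by rw [height_one_of_mem_support i.2]; rfl

end RootPairing.Base
open LieAlgebra LieAlgebra.IsKilling

/-! ### The Chevalley–Serre relations in g. -/

namespace RootVectors

variable {g : Type*} [LieRing g] [LieAlgebra ℂ g] [FiniteDimensional ℂ g]
  [LieAlgebra.IsSemisimple ℂ g] {h : LieSubalgebra ℂ g} [h.IsCartanSubalgebra]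
  {b : (rootSystem h).Base} (v : RootVectors b)

/-- The root vector `e_γ`. -/
def eRoot (γ : PosRoot b) : g := iterBracket v.e (v.wordE γ)

/-- The root vector `f_γ`. -/
def fRoot (γ : PosRoot b) : g := v.coefF γ • iterBracket v.f (v.wordF γ)

theorem eRoot_mem' (γ : PosRoot b) : v.eRoot γ ∈ rootSpace h γ.1.1 := v.eRoot_mem γ

theorem fRoot_mem' (γ : PosRoot b) : v.fRoot γ ∈ rootSpace h (-γ.1.1) := v.fRoot_mem γ

theorem lie_eRoot_fRoot' (γ : PosRoot b) : ⁅v.eRoot γ, v.fRoot γ⁆ = (coroot γ.1.1 : g) :=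
  v.lie_eRoot_fRoot γ

theorem eq_zero_of_not_root {χ : h → ℂ} (h0 : χ ≠ 0) (hχ : ∀ γ : h.root, (γ.1 : h → ℂ) ≠ χ) {x : g}
    (hx : x ∈ rootSpace h χ) : x = 0 := by
  by_contra hne
  have hbot : rootSpace h χ ≠ ⊥ := fun hb => hne (by rw [hb] at hx; simpa using hx)
  let w : LieModule.Weight ℂ h g := ⟨χ, hbot⟩
  have hw : w ∈ h.root := by
    simp only [LieSubalgebra.root, Finset.mem_filter, Finset.mem_univ, true_and]
    exact h0
  exact hχ ⟨w, hw⟩ rfl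

theorem isNonZero (γ : h.root) : γ.1.IsNonZero := by
  have := γ.2
  simpa only [LieSubalgebra.root, Finset.mem_filter, Finset.mem_univ, true_and] using this

theorem coe_add {α β γ : h.root}
    (hr : (rootSystem h).root α = (rootSystem h).root β + (rootSystem h).root γ) :
    (α.1 : h → ℂ) = β.1 + γ.1 := by
  simp only [rootSystem_root_apply] at hr
  exact congrArg DFunLike.coe hr

theorem root_eq_add {α β γ : h.root} (hr : (α.1 : h → ℂ) = β.1 + γ.1) :
    (rootSystem h).root α = (rootSystem h).root β + (rootSystem h).root γ := by
  simp only [rootSystem_root_apply]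
  exact DFunLike.coe_injective hr

theorem root_eq_neg {α β : h.root} (hr : (α.1 : h → ℂ) = -β.1) :
    (rootSystem h).root α = -(rootSystem h).root β := by
  simp only [rootSystem_root_apply]
  exact DFunLike.coe_injective hr

theorem eRoot_ne_zero (γ : PosRoot b) : v.eRoot γ ≠ 0 := by
  intro h0
  have := v.lie_eRoot_fRoot' γ
  rw [h0, zero_lie] at this
  exact isNonZero γ.1 (coroot_eq_zero_iff.1 (Subtype.ext this.symm))

theorem fRoot_ne_zero (γ : PosRoot b) : v.fRoot γ ≠ 0 := by
  intro h0
  have := v.lie_eRoot_fRoot' γ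
  rw [h0, lie_zero] at this
  exact isNonZero γ.1 (coroot_eq_zero_iff.1 (Subtype.ext this.symm))

theorem exists_smul_eRoot {γ : PosRoot b} {x : g} (hx : x ∈ rootSpace h γ.1.1) :
    ∃ r : ℂ, x = r • v.eRoot γ := by
  obtain ⟨r, hr⟩ := (finrank_eq_one_iff_of_nonzero' (⟨v.eRoot γ, v.eRoot_mem' γ⟩ : rootSpace h γ.1.1)
    (fun h0 => v.eRoot_ne_zero γ (congrArg Subtype.val h0))).1
    (finrank_rootSpace_eq_one γ.1.1 (isNonZero γ.1)) ⟨x, hx⟩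
  exact ⟨r, (congrArg Subtype.val hr).symm⟩

theorem exists_smul_fRoot {γ : PosRoot b} {x : g} (hx : x ∈ rootSpace h (-γ.1.1)) :
    ∃ r : ℂ, x = r • v.fRoot γ := by
  obtain ⟨r, hr⟩ := (finrank_eq_one_iff_of_nonzero'
    (⟨v.fRoot γ, v.fRoot_mem' γ⟩ : rootSpace h (-γ.1.1))
    (fun h0 => v.fRoot_ne_zero γ (congrArg Subtype.val h0))).1
    (finrank_rootSpace_eq_one (-γ.1.1) (isNonZero γ.1).neg) ⟨x, hx⟩
  exact ⟨r, (congrArg Subtype.val hr).symm⟩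

theorem lie_coroot_of_mem {χ : LieModule.Weight ℂ h g} {α : h.root} {x : g}
    (hx : x ∈ rootSpace h χ) : ⁅(coroot α.1 : g), x⁆ = χ (coroot α.1) • x :=
  lie_eq_smul_of_mem_rootSpace hx (coroot α.1)

theorem apply_coroot (hb : b.cartanMatrix.IsSimplyLaced) (α β : h.root) :
    α.1 (coroot β.1) = ((rootSystem h).pairingIn ℤ β α : ℂ) := by
  rw [← RootPairing.Base.pairingIn_symm hb, ← rootSystem_pairing_apply h β α,
    ← (rootSystem h).algebraMap_pairingIn ℤ]
  rfl

theorem lie_cartan (x y : h) : ⁅(x : g), (y : g)⁆ = 0 := by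
  have : ⁅x, y⁆ = 0 := trivial_lie_zero h h x y
  exact congrArg Subtype.val this

theorem neg_root (γ : h.root) : ∃ δ : h.root, (δ.1 : h → ℂ) = -γ.1 := by
  refine ⟨⟨-γ.1, ?_⟩, rfl⟩
  simp only [LieSubalgebra.root, Finset.mem_filter, Finset.mem_univ, true_and]
  exact (isNonZero γ).neg

theorem coe_add_ne_zero (γ δ : PosRoot b) : (γ.1.1 : h → ℂ) + δ.1.1 ≠ 0 := by
  intro h0
  exact γ.2.root_ne_neg δ.2 (root_eq_neg (eq_neg_of_add_eq_zero_left h0))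

theorem eq_zero_of_add {γ δ : PosRoot b}
    (hn : ∀ β : PosRoot b, (rootSystem h).root β.1 ≠ (rootSystem h).root γ.1 + (rootSystem h).root δ.1)
    {x : g} (hx : x ∈ rootSpace h ((γ.1.1 : h → ℂ) + δ.1.1)) : x = 0 := by
  refine eq_zero_of_not_root (coe_add_ne_zero γ δ) (fun α hα => ?_) hx
  have := root_eq_add hα
  exact hn ⟨α, γ.2.add δ.2 this⟩ this

theorem eq_zero_of_neg_add {γ δ : PosRoot b}
    (hn : ∀ β : PosRoot b, (rootSystem h).root β.1 ≠ (rootSystem h).root γ.1 + (rootSystem h).root δ.1)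
    {x : g} (hx : x ∈ rootSpace h (-(γ.1.1 : h → ℂ) + -δ.1.1)) : x = 0 := by
  refine eq_zero_of_not_root (fun h0 => coe_add_ne_zero γ δ ?_) (fun α hα => ?_) hx
  · rw [← neg_add, neg_eq_zero] at h0; exact h0
  obtain ⟨α', hα'⟩ := neg_root α
  have := root_eq_add (α := α') (β := γ.1) (γ := δ.1) (by rw [hα', hα]; abel)
  exact hn ⟨α', γ.2.add δ.2 this⟩ this

theorem lie_mem {χ χ' : h → ℂ} {x y : g} (hx : x ∈ rootSpace h χ) (hy : y ∈ rootSpace h χ') :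
    ⁅x, y⁆ ∈ rootSpace h (χ + χ') :=
  lie_mem_genWeightSpace_of_mem_genWeightSpace hx hy

/-- The simple root as a positive root. -/
def simple (i : b.support) : PosRoot b := ⟨i.1, RootPairing.Base.isPos_of_mem_support i.2⟩

theorem serre_aux (hb : b.cartanMatrix.IsSimplyLaced) {γ : PosRoot b} {i : b.support}
    (hc : (rootSystem h).pairingIn ℤ i γ.1 ≠ -1) (β : PosRoot b) :
    (rootSystem h).root β.1 ≠ (rootSystem h).root (simple i).1 + (rootSystem h).root γ.1 := fun hβ =>
  hc ((RootPairing.Base.posSystem hb).c_eq_neg_one (β := β) (γ := γ) (i := i)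
    (hβ.trans (add_comm _ _)))

/-- The Serre brackets have weight ±(α_i + α_j) in the orthogonal case and ±(2α_i + α_j) in the
adjacent case; these are not roots. -/
theorem chevalleySerre (hb : b.cartanMatrix.IsSimplyLaced) :
    (RootPairing.Base.posSystem hb).ChevalleySerre v.e v.f
      (fun i => (coroot (i : h.root).1 : g)) where
  lie_H_H i j := lie_cartan _ _
  lie_H_X i j := by
    rw [lie_coroot_of_mem (v.e_mem j), apply_coroot hb]; rfl
  lie_H_Y i j := by
    have := lie_coroot_of_mem (χ := -(j : h.root).1) (α := i) (v.f_mem j)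
    rw [this, LieModule.Weight.coe_neg, Pi.neg_apply, apply_coroot hb]; rfl
  lie_X_Y i := v.lie_e_f i
  lie_X_Y_ne i j hij := by
    refine eq_zero_of_not_root ?_ (fun α hα => ?_) (lie_mem (v.e_mem i) (v.f_mem j))
    · intro h0
      have : (i : h.root).1 = (j : h.root).1 := DFunLike.coe_injective (add_neg_eq_zero.1 h0)
      exact hij (Subtype.ext (Subtype.ext this))
    · refine b.sub_notMem_range_root i.2 j.2 ⟨α, ?_⟩
      have := root_eq_add (α := (i : h.root)) (β := α) (γ := (j : h.root)) (by rw [hα]; abel)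
      rw [this, add_sub_cancel_right]
  serre_X := by
    constructor
    · intro i j hc
      exact eq_zero_of_add (γ := simple i) (δ := simple j) (serre_aux hb (γ := simple j)
        (fun h' => absurd (hc.symm.trans h') (by decide))) (lie_mem (v.e_mem i) (v.e_mem j))
    · intro i j hc
      obtain ⟨β, hβ⟩ := (RootPairing.Base.posSystem hb).exists_add hc
      have h2 := coe_add hβ
      rw [add_comm] at h2
      refine eq_zero_of_add (γ := simple i) (δ := β) (serre_aux hb (γ := β) ?_) ?_
      · have := (RootPairing.Base.posSystem hb).c_eq_one hβ
        exact fun h' => absurd (this.symm.trans h') (by decide)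
      · rw [h2]
        exact lie_mem (v.e_mem i) (lie_mem (v.e_mem i) (v.e_mem j))
  serre_Y := by
    constructor
    · intro i j hc
      exact eq_zero_of_neg_add (γ := simple i) (δ := simple j) (serre_aux hb (γ := simple j)
        (fun h' => absurd (hc.symm.trans h') (by decide))) (lie_mem (v.f_mem i) (v.f_mem j))
    · intro i j hc
      obtain ⟨β, hβ⟩ := (RootPairing.Base.posSystem hb).exists_add hc
      have h2 := coe_add hβ
      rw [add_comm] at h2
      refine eq_zero_of_neg_add (γ := simple i) (δ := β) (serre_aux hb (γ := β) ?_) ?_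
      · have := (RootPairing.Base.posSystem hb).c_eq_one hβ
        exact fun h' => absurd (this.symm.trans h') (by decide)
      · rw [h2, neg_add]
        exact lie_mem (v.f_mem i) (lie_mem (v.f_mem i) (v.f_mem j))

end RootVectors
open LieAlgebra LieAlgebra.IsKilling

/-! ### A basis of g and the duality of its structure constants. -/

namespace RootVectors

variable {g : Type*} [LieRing g] [LieAlgebra ℂ g] [FiniteDimensional ℂ g]
  [LieAlgebra.IsSemisimple ℂ g] {h : LieSubalgebra ℂ g} [h.IsCartanSubalgebra]
  {b : (rootSystem h).Base} (v : RootVectors b)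

/-! ### Bases of the Lie algebra -/

/-- The family of all root vectors and simple coroots. -/
noncomputable def family : (PosRoot b ⊕ PosRoot b) ⊕ b.support → g :=
  Sum.elim (Sum.elim v.eRoot v.fRoot) fun i => (coroot (i : h.root).1 : g)

/-- Root vectors belong to distinct nonzero weights, and the independent simple coroots to weight
zero. -/
theorem linearIndependent_family : LinearIndependent ℂ v.family := by
  let χ : PosRoot b ⊕ PosRoot b → h → ℂ :=
    Sum.elim (fun γ => γ.1.1) (fun γ => -γ.1.1)
  let t : (h → ℂ) → Submodule ℂ g := fun w => (rootSpace h w).toSubmodule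
  have ht : iSupIndep t :=
    LieSubmodule.iSupIndep_toSubmodule.2 (LieModule.iSupIndep_genWeightSpace ℂ h g)
  have hχ : Function.Injective χ := by
    rintro (γ | γ) (δ | δ) hγδ
    · exact congrArg Sum.inl (Subtype.ext (Subtype.ext (DFunLike.coe_injective hγδ)))
    · exact absurd (eq_neg_iff_add_eq_zero.1 hγδ) (coe_add_ne_zero γ δ)
    · exact absurd (eq_neg_iff_add_eq_zero.1 hγδ.symm) (coe_add_ne_zero δ γ)
    · exact congrArg Sum.inr (Subtype.ext (Subtype.ext (DFunLike.coe_injective (neg_injective hγδ))))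
  have hmem : ∀ u, Sum.elim v.eRoot v.fRoot u ∈ t (χ u) := by
    rintro (γ | γ)
    · exact v.eRoot_mem' γ
    · exact v.fRoot_mem' γ
  refine LinearIndependent.sum_type ?_ ?_ ?_
  · refine iSupIndep.linearIndependent _ (ht.comp hχ) hmem ?_
    rintro (γ | γ)
    · exact v.eRoot_ne_zero γ
    · exact v.fRoot_ne_zero γ
  · have h1 : LinearIndependent ℂ fun i : b.support => (rootSystem h).coroot i := b.linearIndepOn_coroot
    exact h1.map' h.toSubmodule.subtype (Submodule.ker_subtype _)
  · refine (ht 0).symm.mono ?_ ?_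
    · refine Submodule.span_le.2 ?_
      rintro _ ⟨u, rfl⟩
      refine Submodule.mem_iSup_of_mem (χ u) (Submodule.mem_iSup_of_mem ?_ (hmem u))
      rcases u with γ | γ
      · exact isNonZero γ.1
      · exact (isNonZero γ.1).neg
    · refine Submodule.span_le.2 ?_
      rintro _ ⟨i, rfl⟩
      exact toLieSubmodule_le_rootSpace_zero ℂ g h (coroot (i : h.root).1).2

theorem span_family : Submodule.span ℂ (Set.range v.family) = ⊤ := by
  have htop := congrArg LieSubmodule.toSubmodule (LieModule.iSup_genWeightSpace_eq_top' ℂ h g)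
  rw [LieSubmodule.iSup_toSubmodule] at htop
  rw [eq_top_iff]
  refine le_of_eq_of_le htop.symm (iSup_le fun χ => ?_)
  by_cases hχ : χ.IsZero
  · have h0 : rootSpace h χ = h.toLieSubmodule := by
      rw [← rootSpace_zero_eq ℂ g h]; exact congrArg (rootSpace h) hχ
    intro x hx
    have hx' : x ∈ h := by
      have : x ∈ rootSpace h χ := hx
      rw [h0] at this; exact this
    have h1 : (⊤ : Submodule ℂ h) ≤
        (Submodule.span ℂ (Set.range v.family)).comap h.toSubmodule.subtype := by
      rw [← RootPairing.IsRootSystem.span_coroot_eq_top (P := rootSystem h),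
        show Submodule.span ℂ (Set.range (rootSystem h).coroot) = (rootSystem h).corootSpan ℂ from rfl,
        ← b.span_coroot_support, Submodule.span_le]
      rintro _ ⟨i, hi, rfl⟩
      exact Submodule.subset_span ⟨Sum.inr ⟨i, hi⟩, rfl⟩
    exact h1 (Submodule.mem_top (x := ⟨x, hx'⟩))
  · have hroot : χ ∈ h.root := by
      simpa only [LieSubalgebra.root, Finset.mem_filter, Finset.mem_univ, true_and] using hχ
    intro x hx
    rcases RootPairing.Base.IsPos.or_neg b ⟨χ, hroot⟩ with hp | hp
    · obtain ⟨r, rfl⟩ := v.exists_smul_eRoot (γ := ⟨_, hp⟩) hx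
      exact Submodule.smul_mem _ _ (Submodule.subset_span ⟨Sum.inl (Sum.inl ⟨_, hp⟩), rfl⟩)
    · obtain ⟨r, rfl⟩ := v.exists_smul_fRoot (γ := ⟨_, hp⟩) (x := x) (by
        letI := (rootSystem h).indexNeg
        have : (((-⟨χ, hroot⟩ : h.root)).1 : h → ℂ) = -χ := by
          have h1 := (rootSystem h).root_reflectionPerm ⟨χ, hroot⟩ ⟨χ, hroot⟩
          rw [RootPairing.reflection_apply_self] at h1
          exact congrArg DFunLike.coe h1
        rw [this, neg_neg]; exact hx)
      exact Submodule.smul_mem _ _ (Submodule.subset_span ⟨Sum.inl (Sum.inr ⟨_, hp⟩), rfl⟩)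

/-- The given e_γ and f_γ are, up to scalars, iterated brackets of Chevalley generators, so they
stay inside this bracket-stable span. -/
theorem genSpan_eq_top (hb : b.cartanMatrix.IsSimplyLaced) :
    (RootPairing.Base.posSystem hb).genSpan v.e v.f (fun i => (coroot (i : h.root).1 : g)) = ⊤ := by
  rw [eq_top_iff, ← v.span_family, Submodule.span_le]
  have hCS := v.chevalleySerre hb
  rintro _ ⟨(γ | γ) | i, rfl⟩
  · exact hCS.iterBracket_X_mem _
  · exact Submodule.smul_mem _ _ (hCS.iterBracket_Y_mem _)
  · exact PosSystem.H_mem_genSpan (S := RootPairing.Base.posSystem hb)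
      (H := fun i : b.support => (coroot (i : h.root).1 : g)) i

/-- A spanning family indexed by the same set as a known basis is itself a basis. -/
theorem linearIndependent_genFamily (hb : b.cartanMatrix.IsSimplyLaced) :
    LinearIndependent ℂ ((RootPairing.Base.posSystem hb).genFamily v.e v.f
      (fun i => (coroot (i : h.root).1 : g))) := by
  refine linearIndependent_of_top_le_span_of_card_eq_finrank (v.genSpan_eq_top hb).ge ?_
  exact (Module.finrank_eq_card_basis
    (Module.Basis.mk v.linearIndependent_family v.span_family.ge)).symm

/-! ### Structure constants -/

theorem lie_cast {χ χ' : h → ℂ} {x : g} (hx : x ∈ rootSpace h χ) (e : χ = χ') :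
    x ∈ rootSpace h χ' := e ▸ hx

/-- Duality of e_γ and f_γ makes the constants of the mixed brackets the same as those of the
unmixed ones. Instead of the invariant form, the proof applies the Jacobi identity to [e_β, [f_γ,
f_δ]] for β = γ + δ and compares coefficients of the coroots of γ and δ. -/
theorem exists_structureConstants (hb : b.cartanMatrix.IsSimplyLaced) :
    ∃ n m : PosRoot b → PosRoot b → PosRoot b → ℂ,
      (∀ γ δ β, n γ δ β ≠ 0 →
        (rootSystem h).root β.1 = (rootSystem h).root γ.1 + (rootSystem h).root δ.1) ∧
      (∀ γ δ β, m γ δ β ≠ 0 →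
        (rootSystem h).root β.1 = (rootSystem h).root γ.1 + (rootSystem h).root δ.1) ∧
      (∀ γ δ β, n γ δ β = -n δ γ β) ∧ (∀ γ δ β, m γ δ β = -m δ γ β) ∧
      (∀ γ δ, ⁅v.fRoot γ, v.fRoot δ⁆ = ∑ β, n γ δ β • v.fRoot β) ∧
      (∀ γ δ, ⁅v.eRoot γ, v.eRoot δ⁆ = ∑ β, m γ δ β • v.eRoot β) ∧
      (∀ γ β, γ ≠ β → ⁅v.fRoot γ, v.eRoot β⁆ =
        -∑ δ, n γ δ β • v.eRoot δ + ∑ δ, m β δ γ • v.fRoot δ) := by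
  classical
  let R := fun γ : PosRoot b => (rootSystem h).root γ.1
  have hRinj : ∀ {γ δ}, R γ = R δ → γ = δ := fun hγδ =>
    Subtype.ext ((rootSystem h).root.injective hγδ)
  have hn : ∀ γ δ β, ∃ r : ℂ, (R β = R γ + R δ → ⁅v.fRoot γ, v.fRoot δ⁆ = r • v.fRoot β) ∧
      (R β ≠ R γ + R δ → r = 0) := by
    intro γ δ β
    by_cases hβ : R β = R γ + R δ
    · obtain ⟨r, hr⟩ := v.exists_smul_fRoot (γ := β) (lie_cast
        (lie_mem (v.fRoot_mem' γ) (v.fRoot_mem' δ)) (by rw [coe_add hβ, neg_add]))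
      exact ⟨r, fun _ => hr, fun h' => absurd hβ h'⟩
    · exact ⟨0, fun h' => absurd h' hβ, fun _ => rfl⟩
  have hm : ∀ γ δ β, ∃ r : ℂ, (R β = R γ + R δ → ⁅v.eRoot γ, v.eRoot δ⁆ = r • v.eRoot β) ∧
      (R β ≠ R γ + R δ → r = 0) := by
    intro γ δ β
    by_cases hβ : R β = R γ + R δ
    · obtain ⟨r, hr⟩ := v.exists_smul_eRoot (γ := β) (lie_cast
        (lie_mem (v.eRoot_mem' γ) (v.eRoot_mem' δ)) (by rw [coe_add hβ]))
      exact ⟨r, fun _ => hr, fun h' => absurd hβ h'⟩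
    · exact ⟨0, fun h' => absurd h' hβ, fun _ => rfl⟩
  choose n hn1 hn0 using hn
  choose m hm1 hm0 using hm
  have hsum : ∀ (k : PosRoot b → ℂ) (x : PosRoot b → g) (β₀ : PosRoot b),
      (∀ β, β ≠ β₀ → k β = 0) → ∑ β, k β • x β = k β₀ • x β₀ := fun k x β₀ hk =>
    Finset.sum_eq_single β₀ (fun β _ hβ => by rw [hk β hβ, zero_smul])
      (fun hβ => absurd (Finset.mem_univ _) hβ)
  have pair2 : ∀ γ : PosRoot b, γ.1.1 (coroot γ.1.1) = 2 := fun γ =>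
    root_apply_coroot (isNonZero γ.1)
  have pairs : ∀ {β γ δ : PosRoot b}, R β = R γ + R δ →
      (coroot β.1.1 : g) = (coroot γ.1.1 : g) + (coroot δ.1.1 : g) ∧
      γ.1.1 (coroot δ.1.1) = -1 ∧ δ.1.1 (coroot γ.1.1) = -1 := by
    intro β γ δ hβ
    have h1 : coroot β.1.1 = coroot γ.1.1 + coroot δ.1.1 :=
      RootPairing.Base.coroot_add_of_root_add hb hβ
    have h2 := pair2 β
    have hs : γ.1.1 (coroot δ.1.1) = δ.1.1 (coroot γ.1.1) := by
      rw [apply_coroot hb, apply_coroot hb, RootPairing.Base.pairingIn_symm hb]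
    have h3 : ∀ x, β.1.1 x = γ.1.1 x + δ.1.1 x := fun x => congrFun (coe_add hβ) x
    have hl : ∀ (α : PosRoot b) (x y : h), α.1.1 (x + y) = α.1.1 x + α.1.1 y := fun α x y =>
      map_add (LieModule.Weight.toLinear ℂ h g α.1.1) x y
    rw [h3, h1, hl, hl, pair2, pair2, hs] at h2
    have h4 : δ.1.1 (coroot γ.1.1) = -1 := by linear_combination h2 / 2
    exact ⟨congrArg Subtype.val h1, hs.trans h4, h4⟩
  -- Evaluating γ and δ gives the matrix with 2 on the diagonal and −1 off it, of determinant 3.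
  have indep : ∀ {β γ δ : PosRoot b}, R β = R γ + R δ → ∀ p q : ℂ,
      p • (coroot γ.1.1 : g) + q • (coroot δ.1.1 : g) = 0 → p = 0 ∧ q = 0 := by
    intro β γ δ hβ p q hpq
    obtain ⟨-, e1, e2⟩ := pairs hβ
    have hpq' : p • coroot γ.1.1 + q • coroot δ.1.1 = 0 := Subtype.ext hpq
    have a1 := congrArg (LieModule.Weight.toLinear ℂ h g γ.1.1) hpq'
    have a2 := congrArg (LieModule.Weight.toLinear ℂ h g δ.1.1) hpq'
    simp only [map_add, map_smul, map_zero, LieModule.Weight.toLinear_apply, pair2, e1, e2,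
      smul_eq_mul] at a1 a2
    constructor
    · linear_combination (2 / 3 : ℂ) * a1 + (1 / 3 : ℂ) * a2
    · linear_combination (1 / 3 : ℂ) * a1 + (2 / 3 : ℂ) * a2
  have fe : ∀ γ, ⁅v.fRoot γ, v.eRoot γ⁆ = -(coroot γ.1.1 : g) := fun γ => by
    rw [← lie_skew, v.lie_eRoot_fRoot']
  have key_n : ∀ {β γ δ}, R β = R γ + R δ → ⁅v.fRoot γ, v.eRoot β⁆ = -(n γ δ β) • v.eRoot δ := by
    intro β γ δ hβ
    have hβ' : R β = R δ + R γ := hβ.trans (add_comm _ _)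
    obtain ⟨p, hp⟩ := v.exists_smul_eRoot (γ := δ) (lie_cast
      (lie_mem (v.fRoot_mem' γ) (v.eRoot_mem' β)) (by rw [coe_add hβ]; abel))
    obtain ⟨q, hq⟩ := v.exists_smul_eRoot (γ := γ) (lie_cast
      (lie_mem (v.fRoot_mem' δ) (v.eRoot_mem' β)) (by rw [coe_add hβ]; abel))
    have e1 := leibniz_lie (v.eRoot β) (v.fRoot γ) (v.fRoot δ)
    rw [hn1 _ _ _ hβ, lie_smul, v.lie_eRoot_fRoot', ← lie_skew (v.eRoot β) (v.fRoot γ), hp,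
      ← lie_skew (v.eRoot β) (v.fRoot δ), hq, neg_lie, lie_neg, smul_lie, lie_smul,
      v.lie_eRoot_fRoot', fe, (pairs hβ).1] at e1
    have e2 := (indep hβ (n γ δ β - q) (n γ δ β + p) (by
      linear_combination (norm := module) e1)).2
    rw [hp]; congr 1; linear_combination e2
  have key_m : ∀ {β γ δ}, R γ = R β + R δ → ⁅v.fRoot γ, v.eRoot β⁆ = m β δ γ • v.fRoot δ := by
    intro β γ δ hγ
    obtain ⟨p, hp⟩ := v.exists_smul_fRoot (γ := δ) (lie_cast
      (lie_mem (v.fRoot_mem' γ) (v.eRoot_mem' β)) (by rw [coe_add hγ]; abel))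
    obtain ⟨q, hq⟩ := v.exists_smul_fRoot (γ := β) (lie_cast
      (lie_mem (v.fRoot_mem' γ) (v.eRoot_mem' δ)) (by rw [coe_add hγ]; abel))
    have e1 := leibniz_lie (v.fRoot γ) (v.eRoot β) (v.eRoot δ)
    rw [hm1 _ _ _ hγ, lie_smul, fe, hp, hq, smul_lie, lie_smul, fe, v.lie_eRoot_fRoot',
      (pairs hγ).1] at e1
    have e2 := (indep hγ (m β δ γ + q) (m β δ γ - p) (by
      linear_combination (norm := module) (-1 : ℂ) • e1)).2
    rw [hp]; congr 1; linear_combination -e2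
  refine ⟨n, m, fun γ δ β hne => by_contra fun h' => hne (hn0 _ _ _ h'),
    fun γ δ β hne => by_contra fun h' => hne (hm0 _ _ _ h'), ?_, ?_, ?_, ?_, ?_⟩
  · intro γ δ β
    by_cases hβ : R β = R γ + R δ
    · have hβ' : R β = R δ + R γ := hβ.trans (add_comm _ _)
      have e1 := hn1 _ _ _ hβ
      rw [← lie_skew, hn1 _ _ _ hβ', ← neg_smul] at e1
      exact (smul_left_injective ℂ (v.fRoot_ne_zero β) e1).symm
    · rw [hn0 _ _ _ hβ, hn0 _ _ _ fun h' => hβ (h'.trans (add_comm _ _)), neg_zero]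
  · intro γ δ β
    by_cases hβ : R β = R γ + R δ
    · have hβ' : R β = R δ + R γ := hβ.trans (add_comm _ _)
      have e1 := hm1 _ _ _ hβ
      rw [← lie_skew, hm1 _ _ _ hβ', ← neg_smul] at e1
      exact (smul_left_injective ℂ (v.eRoot_ne_zero β) e1).symm
    · rw [hm0 _ _ _ hβ, hm0 _ _ _ fun h' => hβ (h'.trans (add_comm _ _)), neg_zero]
  · intro γ δ
    by_cases hβ : ∃ β, R β = R γ + R δ
    · obtain ⟨β, hβ⟩ := hβ
      rw [hsum _ _ β fun β' hβ' => hn0 _ _ _ fun h' => hβ' (hRinj (h'.trans hβ.symm)), hn1 _ _ _ hβ]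
    · rw [Finset.sum_eq_zero fun β _ => by rw [hn0 _ _ _ fun h' => hβ ⟨β, h'⟩, zero_smul]]
      exact eq_zero_of_neg_add (not_exists.1 hβ) (lie_mem (v.fRoot_mem' γ) (v.fRoot_mem' δ))
  · intro γ δ
    by_cases hβ : ∃ β, R β = R γ + R δ
    · obtain ⟨β, hβ⟩ := hβ
      rw [hsum _ _ β fun β' hβ' => hm0 _ _ _ fun h' => hβ' (hRinj (h'.trans hβ.symm)), hm1 _ _ _ hβ]
    · rw [Finset.sum_eq_zero fun β _ => by rw [hm0 _ _ _ fun h' => hβ ⟨β, h'⟩, zero_smul]]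
      exact eq_zero_of_add (not_exists.1 hβ) (lie_mem (v.eRoot_mem' γ) (v.eRoot_mem' δ))
  · intro γ β hγβ
    -- β − γ and γ − β cannot both be positive roots, so at most one of the two sums is nonzero.
    have opp : ∀ {δ ε}, R β = R γ + R δ → R γ ≠ R β + R ε := by
      intro δ ε h1 h2
      refine δ.2.root_ne_neg ε.2 (eq_neg_of_add_eq_zero_left ?_)
      change R δ + R ε = 0
      rw [h1, add_assoc] at h2
      exact left_eq_add.1 h2
    by_cases h1 : ∃ δ, R β = R γ + R δ
    · obtain ⟨δ, hδ⟩ := h1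
      rw [hsum _ v.eRoot δ fun δ' hδ' => hn0 _ _ _ fun h' =>
          hδ' (hRinj (add_left_cancel (h'.symm.trans hδ))),
        Finset.sum_eq_zero fun ε _ => by rw [hm0 _ _ _ (opp hδ), zero_smul], key_n hδ, add_zero,
        neg_smul]
    by_cases h2 : ∃ δ, R γ = R β + R δ
    · obtain ⟨δ, hδ⟩ := h2
      rw [hsum _ v.fRoot δ fun δ' hδ' => hm0 _ _ _ fun h' =>
          hδ' (hRinj (add_left_cancel (h'.symm.trans hδ))),
        Finset.sum_eq_zero fun ε _ => by rw [hn0 _ _ _ fun h' => h1 ⟨ε, h'⟩, zero_smul], key_m hδ,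
        neg_zero, zero_add]
    rw [Finset.sum_eq_zero fun ε _ => by rw [hn0 _ _ _ fun h' => h1 ⟨ε, h'⟩, zero_smul],
      Finset.sum_eq_zero fun ε _ => by rw [hm0 _ _ _ fun h' => h2 ⟨ε, h'⟩, zero_smul], neg_zero,
      add_zero]
    refine eq_zero_of_not_root (fun h0 => hγβ ?_) (fun α hα => ?_)
      (lie_mem (v.fRoot_mem' γ) (v.eRoot_mem' β))
    · exact Subtype.ext (Subtype.ext (DFunLike.coe_injective (neg_add_eq_zero.1 h0)))
    · rcases RootPairing.Base.IsPos.or_neg b α with hp | hp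
      · exact h1 ⟨⟨α, hp⟩, root_eq_add (α := β.1) (by rw [hα]; abel)⟩
      · refine h2 ⟨⟨_, hp⟩, ?_⟩
        have e1 := (rootSystem h).root_reflectionPerm α α
        rw [RootPairing.reflection_apply_self] at e1
        have e2 := root_eq_add (α := β.1) (β := γ.1) (γ := α) (by rw [hα]; abel)
        change (rootSystem h).root γ.1 = (rootSystem h).root β.1 +
          (rootSystem h).root ((rootSystem h).reflectionPerm α α)
        rw [e1, e2]; abel

end RootVectors
open LieAlgebra LieAlgebra.IsKilling

/-- Elements of an associative algebra satisfying the commutation relations of the root vectors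
of a simply-laced Lie algebra with structure constants `n` and `m`. -/
structure PosSystem.Realization {I P M : Type*} [AddCommGroup M] (S : PosSystem I P M) [Fintype P]
    (n m : P → P → P → ℂ) {A : Type*} [Ring A] [Algebra ℂ A] (e f : P → A) (h : I → A) : Prop where
  n_supp : ∀ γ δ β, n γ δ β ≠ 0 → S.root β = S.root γ + S.root δ
  m_supp : ∀ γ δ β, m γ δ β ≠ 0 → S.root β = S.root γ + S.root δ
  n_antisymm : ∀ γ δ β, n γ δ β = -n δ γ β
  m_antisymm : ∀ γ δ β, m γ δ β = -m δ γ β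
  c_of_add : ∀ γ δ β, S.root β = S.root γ + S.root δ → ∀ i, S.c i β = S.c i γ + S.c i δ
  simple_ne_add : ∀ i γ δ, S.root (S.s i) ≠ S.root γ + S.root δ
  lie_f_f : ∀ γ δ, ⁅f γ, f δ⁆ = ∑ β, n γ δ β • f β
  lie_e_e : ∀ γ δ, ⁅e γ, e δ⁆ = ∑ β, m γ δ β • e β
  lie_f_e : ∀ γ β, γ ≠ β → ⁅f γ, e β⁆ = -∑ δ, n γ δ β • e δ + ∑ δ, m β δ γ • f δ
  lie_e_f_simple : ∀ i, ⁅e (S.s i), f (S.s i)⁆ = h i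
  lie_h_e : ∀ i γ, ⁅h i, e γ⁆ = (S.c i γ : ℂ) • e γ
  lie_h_f : ∀ i γ, ⁅h i, f γ⁆ = -(S.c i γ : ℂ) • f γ
  lie_h_h : ∀ i j, ⁅h i, h j⁆ = 0
  e_step : ∀ γ, (∃ i, γ = S.s i) ∨ ∃ k β, ∃ r : ℂ,
    S.root γ = S.root β + S.root (S.s k) ∧ e γ = r • ⁅e (S.s k), e β⁆
  f_step : ∀ γ, (∃ i, γ = S.s i) ∨ ∃ k β, ∃ r : ℂ,
    S.root γ = S.root β + S.root (S.s k) ∧ f γ = r • ⁅f (S.s k), f β⁆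

theorem PosSystem.Realization.symm {I P M : Type*} [AddCommGroup M] {S : PosSystem I P M}
    [Fintype P] {n m : P → P → P → ℂ} {A : Type*} [Ring A] [Algebra ℂ A] {e f : P → A} {h : I → A}
    (R : S.Realization n m e f h) : S.Realization m n f e (fun i => -h i) where
  n_supp := R.m_supp
  m_supp := R.n_supp
  n_antisymm := R.m_antisymm
  m_antisymm := R.n_antisymm
  c_of_add := R.c_of_add
  simple_ne_add := R.simple_ne_add
  lie_f_f := R.lie_e_e
  lie_e_e := R.lie_f_f
  lie_f_e γ β hγβ := by rw [RingLie.skew, R.lie_f_e β γ hγβ.symm]; abel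
  lie_e_f_simple i := by rw [RingLie.skew, R.lie_e_f_simple]
  lie_h_e i γ := by rw [RingLie.neg_left, R.lie_h_f, neg_smul, neg_neg]
  lie_h_f i γ := by rw [RingLie.neg_left, R.lie_h_e, neg_smul]
  lie_h_h i j := by rw [RingLie.neg_left, RingLie.neg, R.lie_h_h, neg_zero, neg_zero]
  e_step := R.f_step
  f_step := R.e_step

/-- The Chevalley–Serre relations in an associative algebra. -/
structure AssocChevalleySerre {I : Type*} (a : I → I → ℤ) {A : Type*} [Ring A] [Algebra ℂ A]
    (X Y H : I → A) : Prop where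
  lie_H_H : ∀ i j, ⁅H i, H j⁆ = 0
  lie_H_X : ∀ i j, ⁅H i, X j⁆ = (a i j : ℂ) • X j
  lie_H_Y : ∀ i j, ⁅H i, Y j⁆ = -(a i j : ℂ) • Y j
  lie_X_Y : ∀ i, ⁅X i, Y i⁆ = H i
  lie_X_Y_ne : ∀ i j, i ≠ j → ⁅X i, Y j⁆ = 0
  lie_X_X : ∀ i j, a i j = 0 → ⁅X i, X j⁆ = 0
  lie_Y_Y : ∀ i j, a i j = 0 → ⁅Y i, Y j⁆ = 0
  lie_X_X_X : ∀ i j, a i j = -1 → ⁅X i, ⁅X i, X j⁆⁆ = 0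
  lie_Y_Y_Y : ∀ i j, a i j = -1 → ⁅Y i, ⁅Y i, Y j⁆⁆ = 0

/-! ### Transporting the root vectors to associative algebras. -/

namespace RootVectors

variable {g : Type*} [LieRing g] [LieAlgebra ℂ g] [FiniteDimensional ℂ g]
  [LieAlgebra.IsSemisimple ℂ g] {h : LieSubalgebra ℂ g} [h.IsCartanSubalgebra]
  {b : (rootSystem h).Base} (v : RootVectors b)

section
attribute [local instance 100] LieRing.ofAssociativeRing LieAlgebra.ofAssociativeAlgebra

theorem exists_linearMap (hb : b.cartanMatrix.IsSimplyLaced) {A : Type*} [Ring A] [Algebra ℂ A]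
    {X Y H : b.support → A} (hA : AssocChevalleySerre b.cartanMatrix X Y H) :
    ∃ ρ : g →ₗ[ℂ] A, (∀ x y, ρ ⁅x, y⁆ = ⁅ρ x, ρ y⁆) ∧ (∀ i, ρ (v.e i) = X i) ∧
      (∀ i, ρ (v.f i) = Y i) ∧ ∀ i : b.support, ρ (coroot (i : h.root).1 : g) = H i := by
  have hCS : (RootPairing.Base.posSystem hb).ChevalleySerre X Y H :=
    { lie_H_H := hA.lie_H_H
      lie_H_X := hA.lie_H_X
      lie_H_Y := hA.lie_H_Y
      lie_X_Y := hA.lie_X_Y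
      lie_X_Y_ne := hA.lie_X_Y_ne
      serre_X := ⟨hA.lie_X_X, hA.lie_X_X_X⟩
      serre_Y := ⟨hA.lie_Y_Y, hA.lie_Y_Y_Y⟩ }
  obtain ⟨ρ, h1, h2, h3⟩ := (v.chevalleySerre hb).exists_lieHom hCS
    (v.linearIndependent_genFamily hb) (v.genSpan_eq_top hb)
  exact ⟨ρ.toLinearMap, fun x y => ρ.map_lie x y, h1, h2, h3⟩

end

theorem eq_of_mem_of_mem {γ δ : PosRoot b} {x : g} (hx : x ≠ 0) (h1 : x ∈ rootSpace h γ.1.1)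
    (h2 : x ∈ rootSpace h δ.1.1) : γ = δ := by
  refine Subtype.ext (Subtype.ext (DFunLike.coe_injective (funext fun y => ?_)))
  have e1 := lie_eq_smul_of_mem_rootSpace h1 y
  rw [lie_eq_smul_of_mem_rootSpace h2 y] at e1
  exact (smul_left_injective ℂ hx e1).symm

theorem exists_posRoot_of_word (w : List b.support) (hw : iterBracket v.e w ≠ 0) :
    ∃ γ : PosRoot b, b.height γ.1 = w.length ∧ iterBracket v.e w ∈ rootSpace h γ.1.1 := by
  induction w with
  | nil => exact absurd rfl hw
  | cons i w ih =>
    cases w with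
    | nil => exact ⟨simple i, RootPairing.Base.height_one_of_mem_support i.2, v.e_mem i⟩
    | cons j w =>
      rw [iterBracket] at hw ⊢
      obtain ⟨γ, h1, h2⟩ := ih (fun h0 => hw (by rw [h0, lie_zero]))
      have hmem := lie_mem (v.e_mem i) h2
      by_contra hcon
      refine hw (eq_zero_of_add (γ := simple i) (δ := γ) (fun β hβ => hcon ⟨β, ?_, ?_⟩) hmem)
      · rw [b.height_add hβ, h1, show b.height (simple i).1 = 1 from
          RootPairing.Base.height_one_of_mem_support i.2]
        simp only [List.length_cons]; push_cast; ring
      · exact lie_cast hmem (coe_add hβ).symm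

/-- A nonzero bracket of ℓ generators has weight of height ℓ. So the word of a simple root has a
single letter, and the weight identifies it. -/
theorem eRoot_simple (i : b.support) : v.eRoot (simple i) = v.e i := by
  obtain ⟨γ, h1, h2⟩ := v.exists_posRoot_of_word (v.wordE (simple i)) (v.eRoot_ne_zero _)
  obtain rfl : γ = simple i := eq_of_mem_of_mem (v.eRoot_ne_zero _) h2 (v.eRoot_mem' _)
  have h3 : b.height (simple i).1 = 1 := RootPairing.Base.height_one_of_mem_support i.2
  obtain ⟨j, hj⟩ := List.length_eq_one_iff.1 (by exact_mod_cast h1.symm.trans h3)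
  have h4 : v.eRoot (simple i) = v.e j := by rw [eRoot, hj]; rfl
  have h5 : simple j = simple i := eq_of_mem_of_mem (v.eRoot_ne_zero _)
    (by rw [h4]; exact v.e_mem j) (v.eRoot_mem' (simple i))
  have h6 : j = i := Subtype.ext (congrArg (fun γ => γ.1) h5)
  rw [h4, h6]

/-- The root space is a line, and the normalization of the bracket with e_i fixes the scalar. -/
theorem fRoot_simple (i : b.support) : v.fRoot (simple i) = v.f i := by
  obtain ⟨r, hr⟩ := v.exists_smul_fRoot (γ := simple i) (v.f_mem i)
  have h1 := v.lie_e_f i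
  have h2 := v.lie_eRoot_fRoot' (simple i)
  rw [eRoot_simple] at h2
  have h0 : (coroot (i : h.root).1 : g) ≠ 0 := fun h0 =>
    isNonZero (i : h.root) (coroot_eq_zero_iff.1 (Subtype.ext h0))
  rw [hr, lie_smul, h2] at h1
  have : r = 1 := by
    refine smul_left_injective ℂ h0 ?_
    simpa [simple] using h1
  rw [hr, this, one_smul]

/-- The chosen words need not be compatible with one another, so induction on height cannot use
them. Root spaces being lines, e_γ is a multiple of the vector from the recursive construction,
which has the required form. -/
theorem e_step (hb : b.cartanMatrix.IsSimplyLaced) (γ : PosRoot b) :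
    (∃ i, γ = simple i) ∨ ∃ (k : b.support) (β : PosRoot b) (r : ℂ),
      (rootSystem h).root γ.1 = (rootSystem h).root β.1 + (rootSystem h).root (simple k).1 ∧
      v.eRoot γ = r • ⁅v.e k, v.eRoot β⁆ := by
  let S := RootPairing.Base.posSystem hb
  have hmem : ∀ γ : PosRoot b, S.rootVec v.e γ ∈ rootSpace h γ.1.1 := by
    intro γ
    induction γ using S.rootVec_induction (L := g) with
    | simple i => rw [S.rootVec_simple]; exact v.e_mem i
    | step β γ k hβ hv ih =>
      rw [hv]
      exact lie_cast (lie_mem (v.e_mem k) ih) (by rw [coe_add hβ, add_comm]; rfl)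
  by_cases hs : ∃ i, γ = simple i
  · exact Or.inl hs
  obtain ⟨k, β, hβ, hv⟩ := S.exists_rootVec_eq (L := g) (not_exists.1 hs)
  obtain ⟨r, hr⟩ := v.exists_smul_eRoot (hmem γ)
  obtain ⟨r', hr'⟩ := v.exists_smul_eRoot (hmem β)
  have hr0 : r ≠ 0 := by
    rintro rfl
    rw [zero_smul] at hr
    exact (v.linearIndependent_genFamily hb).ne_zero (Sum.inl (Sum.inl γ)) hr
  refine Or.inr ⟨k, β, r⁻¹ * r', hβ, ?_⟩
  rw [mul_smul, ← lie_smul, ← hr', ← hv, hr, smul_smul, inv_mul_cancel₀ hr0, one_smul]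

theorem f_step (hb : b.cartanMatrix.IsSimplyLaced) (γ : PosRoot b) :
    (∃ i, γ = simple i) ∨ ∃ (k : b.support) (β : PosRoot b) (r : ℂ),
      (rootSystem h).root γ.1 = (rootSystem h).root β.1 + (rootSystem h).root (simple k).1 ∧
      v.fRoot γ = r • ⁅v.f k, v.fRoot β⁆ := by
  let S := RootPairing.Base.posSystem hb
  have hmem : ∀ γ : PosRoot b, S.rootVec v.f γ ∈ rootSpace h (-γ.1.1) := by
    intro γ
    induction γ using S.rootVec_induction (L := g) with
    | simple i => rw [S.rootVec_simple]; exact v.f_mem i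
    | step β γ k hβ hv ih =>
      rw [hv]
      exact lie_cast (lie_mem (v.f_mem k) ih) (by rw [coe_add hβ, add_comm, neg_add]; rfl)
  by_cases hs : ∃ i, γ = simple i
  · exact Or.inl hs
  obtain ⟨k, β, hβ, hv⟩ := S.exists_rootVec_eq (L := g) (not_exists.1 hs)
  obtain ⟨r, hr⟩ := v.exists_smul_fRoot (hmem γ)
  obtain ⟨r', hr'⟩ := v.exists_smul_fRoot (hmem β)
  have hr0 : r ≠ 0 := by
    rintro rfl
    rw [zero_smul] at hr
    exact (v.linearIndependent_genFamily hb).ne_zero (Sum.inl (Sum.inr γ)) hr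
  refine Or.inr ⟨k, β, r⁻¹ * r', hβ, ?_⟩
  rw [mul_smul, ← lie_smul, ← hr', ← hv, hr, smul_smul, inv_mul_cancel₀ hr0, one_smul]

/-- The commutation relations of the root vectors in any associative algebra generated by
Chevalley–Serre elements. -/
theorem exists_realization (hb : b.cartanMatrix.IsSimplyLaced) :
    ∃ n m : PosRoot b → PosRoot b → PosRoot b → ℂ, ∀ (A : Type*) [Ring A] [Algebra ℂ A]
      (X Y H : b.support → A), AssocChevalleySerre b.cartanMatrix X Y H →
      (RootPairing.Base.posSystem hb).Realization n m (fun γ => iterBracket X (v.wordE γ))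
        (fun γ => v.coefF γ • iterBracket Y (v.wordF γ)) H ∧
      (∀ i, iterBracket X (v.wordE (simple i)) = X i) ∧
      (∀ i, v.coefF (simple i) • iterBracket Y (v.wordF (simple i)) = Y i) := by
  obtain ⟨n, m, n_supp, m_supp, n_anti, m_anti, hff, hee, hfe⟩ := v.exists_structureConstants hb
  -- The constants come from g, before A is given; both tensor factors will share them.
  refine ⟨n, m, fun A _ _ X Y H hA => ?_⟩
  obtain ⟨ρ, hρ, hX, hY, hH⟩ := v.exists_linearMap hb hA
  have hiX : ∀ w, ρ (iterBracket v.e w) = iterBracket X w := by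
    intro w
    induction w with
    | nil => exact ρ.map_zero
    | cons i w ih =>
      cases w with
      | nil => exact hX i
      | cons j w => rw [iterBracket, iterBracket, hρ, ih, hX]
  have hiY : ∀ w, ρ (iterBracket v.f w) = iterBracket Y w := by
    intro w
    induction w with
    | nil => exact ρ.map_zero
    | cons i w ih =>
      cases w with
      | nil => exact hY i
      | cons j w => rw [iterBracket, iterBracket, hρ, ih, hY]
  have he : ∀ γ, iterBracket X (v.wordE γ) = ρ (v.eRoot γ) := fun γ => (hiX _).symm
  have hf : ∀ γ, v.coefF γ • iterBracket Y (v.wordF γ) = ρ (v.fRoot γ) := fun γ => by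
    rw [fRoot, map_smul, hiY]
  have hes : ∀ i, ρ (v.eRoot ((RootPairing.Base.posSystem hb).s i)) = X i := fun i => by
    rw [← hX]; exact congrArg ρ (v.eRoot_simple i)
  have hfs : ∀ i, ρ (v.fRoot ((RootPairing.Base.posSystem hb).s i)) = Y i := fun i => by
    rw [← hY]; exact congrArg ρ (v.fRoot_simple i)
  refine ⟨?_, fun i => (he _).trans (hes i), fun i => (hf _).trans (hfs i)⟩
  simp only [he, hf]
  exact
    { n_supp := n_supp
      m_supp := m_supp
      n_antisymm := n_anti
      m_antisymm := m_anti
      c_of_add := fun γ δ β hβ i => by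
        apply FaithfulSMul.algebraMap_injective ℤ ℂ
        have h1 : ∀ γ : PosRoot b, algebraMap ℤ ℂ ((RootPairing.Base.posSystem hb).c i γ) =
            γ.1.1 (coroot (i : h.root).1) := fun γ => (apply_coroot hb γ.1 i).symm
        rw [map_add, h1, h1, h1, coe_add hβ]; rfl
      simple_ne_add := fun i γ δ hi => by
        have h1 := b.height_add (i := γ.1) (j := δ.1) (k := (simple i).1) hi
        have h2 : b.height (simple i).1 = 1 := RootPairing.Base.height_one_of_mem_support i.2
        have h3 : 0 < b.height γ.1 := γ.2
        have h4 : 0 < b.height δ.1 := δ.2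
        omega
      lie_f_f := fun γ δ => by rw [← hρ, hff, map_sum]; simp only [map_smul]
      lie_e_e := fun γ δ => by rw [← hρ, hee, map_sum]; simp only [map_smul]
      lie_f_e := fun γ β hγβ => by
        rw [← hρ, hfe γ β hγβ, map_add, map_neg, map_sum, map_sum]; simp only [map_smul]
      lie_e_f_simple := fun i => by rw [hes, hfs, hA.lie_X_Y]
      lie_h_e := fun i γ => by
        rw [← hH, ← hρ, lie_coroot_of_mem (v.eRoot_mem' γ), apply_coroot hb, map_smul]; rfl
      lie_h_f := fun i γ => by
        have := lie_coroot_of_mem (χ := -γ.1.1) (α := i) (v.fRoot_mem' γ)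
        rw [← hH, ← hρ, this, LieModule.Weight.coe_neg, Pi.neg_apply, apply_coroot hb, map_smul]; rfl
      lie_h_h := hA.lie_H_H
      e_step := fun γ => (v.e_step hb γ).imp id fun ⟨k, β, r, h1, h2⟩ =>
        ⟨k, β, r, h1, by rw [h2, map_smul, hρ, hX, hes]⟩
      f_step := fun γ => (v.f_step hb γ).imp id fun ⟨k, β, r, h1, h2⟩ =>
        ⟨k, β, r, h1, by rw [h2, map_smul, hρ, hY, hfs]⟩ }

end RootVectors

/-! ### Relations in a shifted Yangian, indexed from zero. -/

namespace ShiftedYangian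

variable {I : Type*} (A : Matrix I I ℤ) (m : I → ℤ)

theorem proj_rel {x y : FreeAlgebra ℂ (YangianGen I)} (h : CartanDoubledYangian.Rel A x y) :
    proj A m x = proj A m y :=
  congrArg (RingQuot.mkAlgHom ℂ (Rel A m)) (RingQuot.mkAlgHom_rel ℂ h)

/-- The generator `E_i^{(n+1)}`. -/
def e (i : I) (n : ℕ) : ShiftedYangian A m := E A m i n.succPNat

/-- The generator `F_i^{(n+1)}`. -/
def f (i : I) (n : ℕ) : ShiftedYangian A m := F A m i n.succPNat

theorem E_eq (i : I) (q : ℕ+) : E A m i q = e A m i q.natPred := by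
  rw [e, PNat.succPNat_natPred]

theorem F_eq (i : I) (q : ℕ+) : F A m i q = f A m i q.natPred := by
  rw [f, PNat.succPNat_natPred]

theorem succPNat_add_one (n : ℕ) : n.succPNat + 1 = (n + 1).succPNat := rfl

theorem lie_H_H (i j : I) (p q : ℤ) : ⁅H A m i p, H A m j q⁆ = 0 := by
  have h := proj_rel A m (.HH i j p q)
  rwa [map_lie, map_zero] at h

theorem lie_e_f (i : I) (p q : ℕ) : ⁅e A m i p, f A m i q⁆ = H A m i (p + q + 1) := by
  have h := proj_rel A m (.EF_same i p.succPNat q.succPNat)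
  rw [map_lie] at h
  refine h.trans (congrArg (H A m i) ?_)
  simp only [Nat.succPNat_coe]; push_cast; ring

theorem lie_e_f_ne {i j : I} (hij : i ≠ j) (p q : ℕ) : ⁅e A m i p, f A m j q⁆ = 0 := by
  have h := proj_rel A m (.EF_ne i j hij p.succPNat q.succPNat)
  rwa [map_lie, map_zero] at h

theorem H_e (i j : I) (p : ℤ) (q : ℕ) :
    ⁅H A m i (p + 1), e A m j q⁆ - ⁅H A m i p, e A m j (q + 1)⁆ =
      ((A i j : ℂ) / 2) • (H A m i p * e A m j q + e A m j q * H A m i p) := by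
  have h := proj_rel A m (.HE i j p q.succPNat)
  rwa [map_sub, map_lie, map_lie, map_smul, map_add, map_mul, map_mul, succPNat_add_one] at h

theorem H_f (i j : I) (p : ℤ) (q : ℕ) :
    ⁅H A m i (p + 1), f A m j q⁆ - ⁅H A m i p, f A m j (q + 1)⁆ =
      -((A i j : ℂ) / 2) • (H A m i p * f A m j q + f A m j q * H A m i p) := by
  have h := proj_rel A m (.HF i j p q.succPNat)
  rwa [map_sub, map_lie, map_lie, map_smul, map_add, map_mul, map_mul, succPNat_add_one] at h

theorem e_e (i j : I) (p q : ℕ) :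
    ⁅e A m i (p + 1), e A m j q⁆ - ⁅e A m i p, e A m j (q + 1)⁆ =
      ((A i j : ℂ) / 2) • (e A m i p * e A m j q + e A m j q * e A m i p) := by
  have h := proj_rel A m (.EE i j p.succPNat q.succPNat)
  rwa [map_sub, map_lie, map_lie, map_smul, map_add, map_mul, map_mul, succPNat_add_one,
    succPNat_add_one] at h

theorem f_f (i j : I) (p q : ℕ) :
    ⁅f A m i (p + 1), f A m j q⁆ - ⁅f A m i p, f A m j (q + 1)⁆ =
      -((A i j : ℂ) / 2) • (f A m i p * f A m j q + f A m j q * f A m i p) := by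
  have h := proj_rel A m (.FF i j p.succPNat q.succPNat)
  rwa [map_sub, map_lie, map_lie, map_smul, map_add, map_mul, map_mul, succPNat_add_one,
    succPNat_add_one] at h

variable {A} in
theorem ne_of_entry (hdiag : ∀ i, A i i = 2) {i j : I} (h : A i j ≠ 2) : i ≠ j := by
  rintro rfl; exact h (hdiag i)

theorem lie_e_e (hdiag : ∀ i, A i i = 2) {i j : I} (h : A i j = 0) (p q : ℕ) :
    ⁅e A m i p, e A m j q⁆ = 0 := by
  have h := proj_rel A m (.serreE i j (ne_of_entry hdiag (by rw [h]; decide)) 1 (by rw [h]; rfl)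
    (fun _ => p.succPNat) q.succPNat)
  rwa [symBracket_one, map_lie, map_zero] at h

theorem lie_f_f (hdiag : ∀ i, A i i = 2) {i j : I} (h : A i j = 0) (p q : ℕ) :
    ⁅f A m i p, f A m j q⁆ = 0 := by
  have h := proj_rel A m (.serreF i j (ne_of_entry hdiag (by rw [h]; decide)) 1 (by rw [h]; rfl)
    (fun _ => p.succPNat) q.succPNat)
  rwa [symBracket_one, map_lie, map_zero] at h

theorem lie_e_e_e (hdiag : ∀ i, A i i = 2) {i j : I} (h : A i j = -1) (p q : ℕ) :
    ⁅e A m i p, ⁅e A m i p, e A m j q⁆⁆ = 0 := by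
  have h := proj_rel A m (.serreE i j (ne_of_entry hdiag (by rw [h]; decide)) 2 (by rw [h]; rfl)
    (fun _ => p.succPNat) q.succPNat)
  rw [symBracket_two, map_add, map_lie, map_lie, map_zero, ← two_smul ℂ] at h
  exact (smul_eq_zero.1 h).resolve_left two_ne_zero

theorem lie_f_f_f (hdiag : ∀ i, A i i = 2) {i j : I} (h : A i j = -1) (p q : ℕ) :
    ⁅f A m i p, ⁅f A m i p, f A m j q⁆⁆ = 0 := by
  have h := proj_rel A m (.serreF i j (ne_of_entry hdiag (by rw [h]; decide)) 2 (by rw [h]; rfl)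
    (fun _ => p.succPNat) q.succPNat)
  rw [symBracket_two, map_add, map_lie, map_lie, map_zero, ← two_smul ℂ] at h
  exact (smul_eq_zero.1 h).resolve_left two_ne_zero

theorem H_of_lt (i : I) {p : ℤ} (hp : p < -m i) : H A m i p = 0 :=
  (RingQuot.mkAlgHom_rel ℂ (Rel.H_zero i p hp)).trans (map_zero _)

theorem H_neg (i : I) : H A m i (-m i) = 1 :=
  (RingQuot.mkAlgHom_rel ℂ (Rel.H_one i)).trans (map_one _)

theorem lie_S₁_e (i j : I) (q : ℕ) : ⁅S₁ A m i, e A m j q⁆ = (A i j : ℂ) • e A m j q := by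
  have h := H_e A m i j (-m i) q
  rw [H_neg, RingLie.one_left, sub_zero, one_mul, mul_one] at h
  rw [S₁, h]; module

theorem lie_S₁_f (i j : I) (q : ℕ) : ⁅S₁ A m i, f A m j q⁆ = -(A i j : ℂ) • f A m j q := by
  have h := H_f A m i j (-m i) q
  rw [H_neg, RingLie.one_left, sub_zero, one_mul, mul_one] at h
  rw [S₁, h]; module

theorem H_two (i : I) : H A m i (-m i + 2) = S₂ A m i + (1 / 2 : ℂ) • (S₁ A m i * S₁ A m i) := by
  rw [S₂, S₁, pow_two, sub_add_cancel]

theorem lie_S₂_e (i j : I) (q : ℕ) : ⁅S₂ A m i, e A m j q⁆ = (A i j : ℂ) • e A m j (q + 1) := by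
  have h := H_e A m i j (-m i + 1) q
  rw [show -m i + 1 + 1 = -m i + 2 by ring, H_two, RingLie.add_left, RingLie.smul_left,
    RingLie.mul_lie, ← S₁, lie_S₁_e, lie_S₁_e, mul_smul_comm, smul_mul_assoc] at h
  linear_combination (norm := module) h

theorem lie_S₂_f (i j : I) (q : ℕ) : ⁅S₂ A m i, f A m j q⁆ = -(A i j : ℂ) • f A m j (q + 1) := by
  have h := H_f A m i j (-m i + 1) q
  rw [show -m i + 1 + 1 = -m i + 2 by ring, H_two, RingLie.add_left, RingLie.smul_left,
    RingLie.mul_lie, ← S₁, lie_S₁_f, lie_S₁_f, mul_smul_comm, smul_mul_assoc] at h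
  linear_combination (norm := module) h

theorem lie_S₁_S₁ (i j : I) : ⁅S₁ A m i, S₁ A m j⁆ = 0 := lie_H_H A m i j _ _

theorem lie_S₂_H (i j : I) (p : ℤ) : ⁅S₂ A m i, H A m j p⁆ = 0 := by
  rw [S₂, RingLie.sub_left, RingLie.smul_left, pow_two, RingLie.mul_lie, lie_H_H, lie_H_H]
  simp

theorem lie_S₂_S₁ (i j : I) : ⁅S₂ A m i, S₁ A m j⁆ = 0 := lie_S₂_H A m i j _

theorem lie_S₂_S₂ (i j : I) : ⁅S₂ A m i, S₂ A m j⁆ = 0 := by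
  conv_lhs => rw [S₂.eq_1 A m j]
  rw [RingLie.sub, RingLie.smul, pow_two, RingLie.lie_mul, lie_S₂_H, lie_S₂_H]
  simp

theorem e_e_self (hdiag : ∀ i, A i i = 2) (i : I) (n : ℕ) :
    ⁅e A m i (n + 1), e A m i n⁆ = e A m i n * e A m i n := by
  have h := e_e A m i i n n
  rw [hdiag, RingLie.skew (e A m i n)] at h
  push_cast at h
  linear_combination (norm := module) (1 / 2 : ℂ) • h

theorem f_f_self (hdiag : ∀ i, A i i = 2) (i : I) (n : ℕ) :
    ⁅f A m i (n + 1), f A m i n⁆ = -(f A m i n * f A m i n) := by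
  have h := f_f A m i i n n
  rw [hdiag, RingLie.skew (f A m i n)] at h
  push_cast at h
  linear_combination (norm := module) (1 / 2 : ℂ) • h

/-- The Chevalley–Serre elements `E_i^{(p_i+1)}`, `F_i^{(q_i+1)}` with `p_i + q_i = -⟨μ, α_i⟩`. -/
theorem assocChevalleySerre (hdiag : ∀ i, A i i = 2) {p q : I → ℕ}
    (hpq : ∀ i, (p i : ℤ) + q i = -m i) : AssocChevalleySerre (fun i j => A i j)
      (fun i => e A m i (p i)) (fun i => f A m i (q i)) (fun i => S₁ A m i) where
  lie_H_H := lie_S₁_S₁ A m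
  lie_H_X i j := lie_S₁_e A m i j _
  lie_H_Y i j := lie_S₁_f A m i j _
  lie_X_Y i := by rw [lie_e_f, hpq]; rfl
  lie_X_Y_ne i j hij := lie_e_f_ne A m hij _ _
  lie_X_X i j h := lie_e_e A m hdiag h _ _
  lie_Y_Y i j h := lie_f_f A m hdiag h _ _
  lie_X_X_X i j h := lie_e_e_e A m hdiag h _ _
  lie_Y_Y_Y i j h := lie_f_f_f A m hdiag h _ _

/-- A homomorphism from a shifted Yangian with antidominant shift is determined by the values at
`E_i^{(1)}`, `F_i^{(1)}` and `S_i^{(-⟨μ, α_i⟩ + 2)}`. -/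
theorem algHom_ext (hdiag : ∀ i, A i i = 2) (hm : ∀ i, m i ≤ 0) {R : Type*} [Ring R] [Algebra ℂ R]
    {φ ψ : ShiftedYangian A m →ₐ[ℂ] R} (hE : ∀ i, φ (E A m i 1) = ψ (E A m i 1))
    (hF : ∀ i, φ (F A m i 1) = ψ (F A m i 1)) (hS : ∀ i, φ (S₂ A m i) = ψ (S₂ A m i)) :
    φ = ψ := by
  have he : ∀ i n, φ (e A m i n) = ψ (e A m i n) := by
    intro i n
    induction n with
    | zero => exact hE i
    | succ n ih =>
      have h : e A m i (n + 1) = (1 / 2 : ℂ) • ⁅S₂ A m i, e A m i n⁆ := by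
        rw [lie_S₂_e, hdiag, smul_smul]; norm_num
      rw [h, map_smul, map_smul, map_lie, map_lie, ih, hS]
  have hf : ∀ i n, φ (f A m i n) = ψ (f A m i n) := by
    intro i n
    induction n with
    | zero => exact hF i
    | succ n ih =>
      have h : f A m i (n + 1) = (-1 / 2 : ℂ) • ⁅S₂ A m i, f A m i n⁆ := by
        rw [lie_S₂_f, hdiag, smul_smul]; norm_num
      rw [h, map_smul, map_smul, map_lie, map_lie, ih, hS]
  have hH : ∀ i p, φ (H A m i p) = ψ (H A m i p) := by
    intro i p
    rcases lt_trichotomy p (-m i) with h | rfl | h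
    · rw [H_of_lt A m i h, map_zero, map_zero]
    · rw [H_neg, map_one, map_one]
    -- Antidominance gives p ≥ 1, so H_i^{(p)} is the bracket of E_i^{(p)} and F_i^{(1)}.
    · have := hm i
      obtain ⟨n, rfl⟩ : ∃ n : ℕ, p = (n : ℤ) + (0 : ℕ) + 1 := ⟨(p - 1).toNat, by simp; omega⟩
      rw [← lie_e_f, map_lie, map_lie, he, hf]
  refine RingQuot.ringQuot_ext' ℂ _ _ (RingQuot.ringQuot_ext' ℂ _ _
    (FreeAlgebra.hom_ext (funext fun x => ?_)))
  cases x with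
  | E i q =>
    have := he i q.natPred
    rwa [← E_eq] at this
  | F i q =>
    have := hf i q.natPred
    rwa [← F_eq] at this
  | H i p => exact hH i p

end ShiftedYangian

/-! ### Invariance of the half Casimir and analogues of Drinfeld's J. -/

namespace PosSystem.Realization

variable {I P M : Type*} [AddCommGroup M] {S : PosSystem I P M} [Fintype P] {n m : P → P → P → ℂ}
  {A : Type*} [Ring A] [Algebra ℂ A] {e f : P → A} {h : I → A}

open Classical in
theorem lie_X_f (R : S.Realization n m e f h) (k : I) (γ : P) :
    ⁅e (S.s k), f γ⁆ = (if γ = S.s k then h k else 0) - ∑ δ, m (S.s k) δ γ • f δ := by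
  split_ifs with hγ
  · subst hγ
    rw [R.lie_e_f_simple, Finset.sum_eq_zero, sub_zero]
    intro δ _
    rw [show m (S.s k) δ (S.s k) = 0 from by_contra fun h0 => R.simple_ne_add _ _ _ (R.m_supp _ _ _ h0),
      zero_smul]
  · rw [RingLie.skew, R.lie_f_e γ _ hγ, Finset.sum_eq_zero]
    · abel
    · intro δ _
      rw [show n γ δ (S.s k) = 0 from by_contra fun h0 => R.simple_ne_add _ _ _ (R.n_supp _ _ _ h0),
        zero_smul]

section Pairing

variable {A' : Type*} [Ring A'] [Algebra ℂ A'] {e' f' : P → A'} {h' : I → A'}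
  {W : Type*} [AddCommGroup W] [Module ℂ W]

/-- The invariance of the canonical tensor under `e_k`, weighted by the inner products with
`α_i`. -/
theorem sum_weighted (R : S.Realization n m e f h) (R' : S.Realization n m e' f' h')
    (B : A →ₗ[ℂ] A' →ₗ[ℂ] W) (i k : I) :
    ∑ γ, (S.c i γ : ℂ) • (B (f γ) ⁅e' (S.s k), e' γ⁆ + B ⁅e (S.s k), f γ⁆ (e' γ)) =
      (S.c i (S.s k) : ℂ) • ∑ γ, B ⁅e (S.s k), f γ⁆ (e' γ) := by
  classical
  have h1 : ∑ γ, (S.c i γ : ℂ) • B (f γ) ⁅e' (S.s k), e' γ⁆ =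
      ∑ γ, ∑ δ, ((S.c i γ : ℂ) * m (S.s k) γ δ) • B (f γ) (e' δ) := by
    refine Finset.sum_congr rfl fun γ _ => ?_
    rw [R'.lie_e_e, map_sum, Finset.smul_sum]
    refine Finset.sum_congr rfl fun δ _ => ?_
    rw [map_smul, smul_smul]
  have h2 : ∀ w : P → ℂ, ∑ γ, w γ • B ⁅e (S.s k), f γ⁆ (e' γ) =
      w (S.s k) • B (h k) (e' (S.s k)) -
        ∑ γ, ∑ δ, (w δ * m (S.s k) γ δ) • B (f γ) (e' δ) := by
    intro w
    rw [Finset.sum_comm, eq_sub_iff_add_eq, ← Finset.sum_add_distrib,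
      Finset.sum_eq_single (S.s k)]
    · rw [R.lie_X_f, if_pos rfl, map_sub, LinearMap.sub_apply, smul_sub, map_sum,
        LinearMap.sum_apply, Finset.smul_sum]
      simp only [map_smul, LinearMap.smul_apply, smul_smul]
      abel
    · intro γ _ hγ
      rw [R.lie_X_f, if_neg hγ, zero_sub, map_neg, LinearMap.neg_apply, smul_neg, map_sum,
        LinearMap.sum_apply, Finset.smul_sum]
      simp only [map_smul, LinearMap.smul_apply, smul_smul]
      abel
    · intro h0; exact absurd (Finset.mem_univ _) h0
  have h3 := h2 fun _ => 1
  simp only [one_smul, one_mul] at h3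
  simp only [smul_add, Finset.sum_add_distrib]
  rw [h1, h2, h3, smul_sub, Finset.smul_sum]
  simp only [Finset.smul_sum]
  have h4 : ∀ γ δ, ((S.c i γ : ℂ) * m (S.s k) γ δ) • B (f γ) (e' δ) =
      ((S.c i δ : ℂ) * m (S.s k) γ δ) • B (f γ) (e' δ) -
        (S.c i (S.s k) : ℂ) • (m (S.s k) γ δ) • B (f γ) (e' δ) := by
    intro γ δ
    by_cases h0 : m (S.s k) γ δ = 0
    · simp [h0]
    · rw [R.c_of_add _ _ _ (R.m_supp _ _ _ h0) i]
      push_cast; module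
  simp only [h4, Finset.sum_sub_distrib]
  abel

/-- Duality of the structure constants cancels everything except the Cartan term at γ = α_k. The
bilinear map B is arbitrary because the identity serves both for tensor products and for
anticommutators within one algebra. -/
theorem sum_lie_X (R : S.Realization n m e f h) (R' : S.Realization n m e' f' h')
    (B : A →ₗ[ℂ] A' →ₗ[ℂ] W) (k : I) :
    ∑ γ, (B (f γ) ⁅e' (S.s k), e' γ⁆ + B ⁅e (S.s k), f γ⁆ (e' γ)) = B (h k) (e' (S.s k)) := by
  classical
  have h1 : ∑ γ, B (f γ) ⁅e' (S.s k), e' γ⁆ = ∑ γ, ∑ δ, m (S.s k) γ δ • B (f γ) (e' δ) := by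
    simp only [R'.lie_e_e, map_sum, map_smul]
  rw [Finset.sum_add_distrib, h1, Finset.sum_comm, ← Finset.sum_add_distrib,
    Finset.sum_eq_single (S.s k)]
  · rw [R.lie_X_f, if_pos rfl, map_sub, LinearMap.sub_apply, map_sum, LinearMap.sum_apply]
    simp only [map_smul, LinearMap.smul_apply]
    abel
  · intro γ _ hγ
    rw [R.lie_X_f, if_neg hγ, zero_sub, map_neg, LinearMap.neg_apply, map_sum,
      LinearMap.sum_apply]
    simp only [map_smul, LinearMap.smul_apply]
    abel
  · intro h0; exact absurd (Finset.mem_univ _) h0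

theorem sum_lie_Y (R : S.Realization n m e f h) (R' : S.Realization n m e' f' h')
    (B : A →ₗ[ℂ] A' →ₗ[ℂ] W) (k : I) :
    ∑ γ, (B (f γ) ⁅f' (S.s k), e' γ⁆ + B ⁅f (S.s k), f γ⁆ (e' γ)) = -B (f (S.s k)) (h' k) := by
  have := R'.symm.sum_lie_X R.symm B.flip k
  simp only [LinearMap.flip_apply] at this
  rw [← map_neg, ← this]
  exact Finset.sum_congr rfl fun γ _ => add_comm _ _

end Pairing

theorem lie_X_X_e (R : S.Realization n m e f h) {k : I} {β : P} (hβ : S.c k β = -1) :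
    ⁅e (S.s k), ⁅e (S.s k), e β⁆⁆ = 0 := by
  rw [R.lie_e_e, RingLie.sum]
  refine Finset.sum_eq_zero fun δ _ => ?_
  rw [RingLie.smul]
  by_cases h0 : m (S.s k) β δ = 0
  · rw [h0, zero_smul]
  · have h1 := R.c_of_add _ _ _ (R.m_supp _ _ _ h0) k
    rw [S.c_self, hβ] at h1
    rw [R.lie_e_e, Finset.sum_eq_zero, smul_zero]
    intro ε _
    rw [show m (S.s k) δ ε = 0 from by_contra fun h2 => ?_, zero_smul]
    have := S.c_eq_neg_one ((R.m_supp _ _ _ h2).trans (add_comm _ _))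
    omega

theorem lie_Y_e_eq_zero (R : S.Realization n m e f h) {k : I} {β : P} (hβ : S.c k β = -1) :
    ⁅f (S.s k), e β⁆ = 0 := by
  have hne : β ≠ S.s k := by rintro rfl; rw [S.c_self] at hβ; omega
  rw [R.symm.lie_X_f, if_neg hne, Finset.sum_eq_zero, sub_zero]
  intro δ _
  rw [show n (S.s k) δ β = 0 from by_contra fun h2 => ?_, zero_smul]
  have := S.c_eq_one ((R.n_supp _ _ _ h2).trans (add_comm _ _))
  omega

/-- Lifts `s i` of `h i` and `x k` of `e (s k)` to the next mode of a shifted Yangian. -/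
structure SecondModes (_R : S.Realization n m e f h) (s x : I → A) : Prop where
  lie_s_e : ∀ i k, ⁅s i, e (S.s k)⁆ = (S.c i (S.s k) : ℂ) • x k
  lie_x_e : ∀ k, ⁅x k, e (S.s k)⁆ = e (S.s k) * e (S.s k)
  lie_x_f : ∀ k, ⁅x k, f (S.s k)⁆ = s k + (1 / 2 : ℂ) • (h k * h k)

/-- The anticommutator, as a bilinear map. -/
def anticomm (A : Type*) [Ring A] [Algebra ℂ A] : A →ₗ[ℂ] A →ₗ[ℂ] A :=
  LinearMap.mul ℂ A + (LinearMap.mul ℂ A).flip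

theorem anticomm_apply (x y : A) : anticomm A x y = x * y + y * x := rfl

theorem anticomm_comm (x y : A) : anticomm A x y = anticomm A y x := add_comm _ _

theorem lie_anticomm (x y z : A) :
    ⁅x, anticomm A y z⁆ = anticomm A ⁅x, y⁆ z + anticomm A y ⁅x, z⁆ := by
  simp only [anticomm_apply, RingLie.add, RingLie.lie_mul]; abel

/-- `x ↦ ⁅x, y⁆` as a linear map. -/
def bracketRight (y : A) : A →ₗ[ℂ] A := (LinearMap.mul ℂ A).flip y - LinearMap.mul ℂ A y

theorem bracketRight_apply (x y : A) : bracketRight y x = ⁅x, y⁆ := rfl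

/-- The quadratic correction of the second mode of a simple root vector. -/
noncomputable def modeX (_R : S.Realization n m e f h) (x : I → A) (k : I) : A :=
  x k + (1 / 4 : ℂ) • ∑ γ, anticomm A ⁅f γ, e (S.s k)⁆ (e γ)

/-- The quadratic correction of the second Cartan mode. -/
noncomputable def modeJ (_R : S.Realization n m e f h) (s : I → A) (i : I) : A :=
  s i + (1 / 4 : ℂ) • ∑ γ, (S.c i γ : ℂ) • anticomm A (f γ) (e γ)

namespace SecondModes

variable {R : S.Realization n m e f h} {s x : I → A}

/-- With these corrections `modeJ` and `modeX` behave like J(h_i) and J(e_k), for which [J(h), x] =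
J([h, x]); the weighted invariance turns one correction into the other. -/
theorem lie_modeJ_e (D : R.SecondModes s x) (i k : I) :
    ⁅R.modeJ s i, e (S.s k)⁆ = (S.c i (S.s k) : ℂ) • R.modeX x k := by
  have h1 := R.sum_weighted R (anticomm A) i k
  simp only [← lie_anticomm, add_comm (anticomm A (f _) ⁅_, _⁆)] at h1
  rw [modeJ, modeX, RingLie.add_left, D.lie_s_e, RingLie.smul_left, RingLie.skew (∑ γ, _),
    RingLie.sum]
  simp only [RingLie.smul, h1]
  simp only [RingLie.skew (f _) (e (S.s k)), map_neg, LinearMap.neg_apply, Finset.sum_neg_distrib]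
  module

theorem lie_e_modeX (D : R.SecondModes s x) (k : I) : ⁅e (S.s k), R.modeX x k⁆ = 0 := by
  have h1 := R.sum_lie_X R ((anticomm A).comp (bracketRight (e (S.s k)))) k
  simp only [LinearMap.comp_apply, bracketRight_apply] at h1
  have h2 : ∀ γ, ⁅e (S.s k), anticomm A ⁅f γ, e (S.s k)⁆ (e γ)⁆ =
      anticomm A ⁅f γ, e (S.s k)⁆ ⁅e (S.s k), e γ⁆ +
        anticomm A ⁅⁅e (S.s k), f γ⁆, e (S.s k)⁆ (e γ) := by
    intro γ
    rw [lie_anticomm, RingLie.skew (e (S.s k)) ⁅f γ, _⁆, RingLie.skew (f γ), RingLie.neg_left,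
      neg_neg, add_comm]
  rw [modeX, RingLie.add, RingLie.smul, RingLie.sum, Finset.sum_congr rfl fun γ _ => h2 γ, h1,
    RingLie.skew, D.lie_x_e, R.lie_h_e, S.c_self, map_smul, LinearMap.smul_apply, anticomm_apply]
  push_cast; module

theorem lie_f_modeX (D : R.SecondModes s x) (k : I) :
    ⁅f (S.s k), R.modeX x k⁆ = -R.modeJ s k := by
  have h1 := R.sum_lie_Y R ((anticomm A).comp (bracketRight (e (S.s k)))) k
  simp only [LinearMap.comp_apply, bracketRight_apply] at h1
  have h2 : ∀ γ, ⁅f (S.s k), anticomm A ⁅f γ, e (S.s k)⁆ (e γ)⁆ =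
      (anticomm A ⁅f γ, e (S.s k)⁆ ⁅f (S.s k), e γ⁆ +
        anticomm A ⁅⁅f (S.s k), f γ⁆, e (S.s k)⁆ (e γ)) -
        (S.c k γ : ℂ) • anticomm A (f γ) (e γ) := by
    intro γ
    rw [lie_anticomm, RingLie.leibniz (f (S.s k)) (f γ), RingLie.skew (f (S.s k)) (e _),
      R.lie_e_f_simple, RingLie.neg, ← RingLie.skew (h k), R.lie_h_f, map_add, LinearMap.add_apply,
      map_smul, LinearMap.smul_apply]
    module
  rw [modeX, RingLie.add, RingLie.smul, RingLie.sum, Finset.sum_congr rfl fun γ _ => h2 γ,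
    Finset.sum_sub_distrib, h1, RingLie.skew, D.lie_x_f, RingLie.skew (f _), R.lie_e_f_simple,
    map_neg, LinearMap.neg_apply, anticomm_apply, modeJ]
  module

/-- The vector z plays the role of J(e_γ). The content is that it does not depend on i, which
without the corrections would be false up to quadratic terms; these are computed in `lie_s_e_sub`.
-/
theorem exists_lie_modeJ (D : R.SecondModes s x) (γ : P) :
    ∃ z, ∀ i, ⁅R.modeJ s i, e γ⁆ = (S.c i γ : ℂ) • z := by
  generalize hn : S.ht γ = N
  induction N using Nat.strong_induction_on generalizing γ with
  | _ N ih =>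
    rcases R.e_step γ with ⟨k, rfl⟩ | ⟨k, β, r, hγ, her⟩
    · exact ⟨_, fun i => D.lie_modeJ_e i k⟩
    have hβk := S.c_eq_neg_one hγ
    have hht := S.ht_add hγ
    obtain ⟨z, hz⟩ := ih (S.ht β) (by omega) β rfl
    -- The index i is chosen so that J_i + c_i(β) J_k kills e_β but multiplies the passage from e_k
    -- to `modeX` by t ≠ 0.
    obtain ⟨i, t, ht0, ht⟩ : ∃ (i : I) (t : ℤ), t ≠ 0 ∧ S.c i (S.s k) + 2 * S.c i β = t := by
      rcases S.simple_or β with ⟨i, rfl⟩ | ⟨i, hi⟩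
      · rw [S.c_symm] at hβk
        exact ⟨i, 3, by norm_num, by rw [hβk, S.c_self]; norm_num⟩
      · have hik : i ≠ k := by rintro rfl; omega
        refine ⟨i, _, ?_, rfl⟩
        rcases S.c_simple hik with h | h <;> omega
    set X := e (S.s k)
    set x' := R.modeX x k with hx'
    have hX2 : ⁅X, ⁅X, e β⁆⁆ = 0 := R.lie_X_X_e hβk
    have hxX : ∀ w, ⁅x', ⁅X, w⁆⁆ = ⁅X, ⁅x', w⁆⁆ := fun w => by
      rw [RingLie.leibniz x', RingLie.skew x', D.lie_e_modeX, neg_zero, RingLie.zero_left, zero_add]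
    -- Applying that combination to [X, [X, e_β]] = 0 gives 2t[x', [X, e_β]] = 0. Bracketing the
    -- result with f_k then yields [x', e_β] = [X, z].
    have e1 : ⁅x', ⁅X, e β⁆⁆ = 0 := by
      have h1 : ⁅R.modeJ s i + (S.c i β : ℂ) • R.modeJ s k, e β⁆ = 0 := by
        rw [RingLie.add_left, RingLie.smul_left, hz, hz, hβk]
        push_cast; module
      have h2 : ⁅R.modeJ s i + (S.c i β : ℂ) • R.modeJ s k, X⁆ = (t : ℂ) • x' := by
        rw [RingLie.add_left, RingLie.smul_left, D.lie_modeJ_e, D.lie_modeJ_e, S.c_self, ← ht]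
        push_cast; module
      have h3 : ⁅R.modeJ s i + (S.c i β : ℂ) • R.modeJ s k, ⁅X, ⁅X, e β⁆⁆⁆ = 0 := by
        rw [hX2, RingLie.zero]
      rw [RingLie.leibniz _ X ⁅X, e β⁆, RingLie.leibniz (R.modeJ s i + (S.c i β : ℂ) • R.modeJ s k) X (e β), h1, h2, RingLie.zero, add_zero,
        RingLie.smul_left, RingLie.smul_left, RingLie.smul, ← hxX, ← two_smul ℂ, smul_smul] at h3
      exact (smul_eq_zero.1 h3).resolve_left
        (mul_ne_zero two_ne_zero (Int.cast_ne_zero.2 ht0))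
    have e2 : ⁅f (S.s k), ⁅x', ⁅X, e β⁆⁆⁆ = 0 := by rw [e1, RingLie.zero]
    have e3 : ⁅f (S.s k), ⁅X, e β⁆⁆ = e β := by
      rw [RingLie.leibniz, R.lie_Y_e_eq_zero hβk, RingLie.zero, add_zero, RingLie.skew (f _),
        R.lie_e_f_simple, RingLie.neg_left, R.lie_h_e, hβk]
      push_cast; module
    have e4 : ⁅R.modeJ s k, ⁅X, e β⁆⁆ = (2 : ℂ) • ⁅x', e β⁆ - ⁅X, z⁆ := by
      rw [RingLie.leibniz, D.lie_modeJ_e, hz, S.c_self, hβk, RingLie.smul_left, RingLie.smul]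
      push_cast; module
    have e5 : ⁅x', e β⁆ = ⁅X, z⁆ := by
      rw [RingLie.leibniz, D.lie_f_modeX, e3, RingLie.neg_left, e4] at e2
      linear_combination (norm := module) -e2
    refine ⟨r • ⁅X, z⁆, fun j => ?_⟩
    rw [her, RingLie.smul, RingLie.leibniz, D.lie_modeJ_e, hz, RingLie.smul_left, e5, RingLie.smul,
      S.c_add hγ]
    push_cast; module

/-- The unknown z is eliminated between the indices i and j. The mixed terms of the corrections
cancel, and only products of two e's remain, in the shape in which they meet the bracket of two
weighted half Casimirs. -/
theorem lie_s_e_sub (D : R.SecondModes s x) (i j : I) (β : P) :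
    (S.c j β : ℂ) • ⁅s i, e β⁆ - (S.c i β : ℂ) • ⁅s j, e β⁆ =
      (1 / 2 : ℂ) • ∑ γ, ∑ δ, (S.c i γ * S.c j δ * n γ δ β : ℂ) • anticomm A (e γ) (e δ) := by
  classical
  obtain ⟨z, hz⟩ := D.exists_lie_modeJ β
  let w : P → ℂ := fun γ => S.c j β * S.c i γ - S.c i β * S.c j γ
  have h1 : ((S.c j β : ℂ) • ⁅s i, e β⁆ - (S.c i β : ℂ) • ⁅s j, e β⁆) +
      (1 / 4 : ℂ) • ∑ γ, w γ • ⁅anticomm A (f γ) (e γ), e β⁆ = 0 := by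
    have h2 : (S.c j β : ℂ) • ⁅R.modeJ s i, e β⁆ - (S.c i β : ℂ) • ⁅R.modeJ s j, e β⁆ = 0 := by
      rw [hz, hz]; module
    rw [← h2]
    simp only [modeJ, RingLie.add_left, RingLie.smul_left, RingLie.sum_left, w, sub_smul,
      Finset.sum_sub_distrib, mul_smul, ← Finset.smul_sum]
    module
  have h3 : ∀ γ, w γ • ⁅anticomm A (f γ) (e γ), e β⁆ =
      ((∑ δ, (w γ * m γ β δ) • anticomm A (f γ) (e δ)) +
        ∑ δ, (w γ * m β δ γ) • anticomm A (f δ) (e γ)) -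
        ∑ δ, (w γ * n γ δ β) • anticomm A (e γ) (e δ) := by
    intro γ
    by_cases hγ : γ = β
    · have : w γ = 0 := by simp only [w, hγ]; ring
      simp [this]
    · rw [RingLie.skew, lie_anticomm, RingLie.skew (e β), RingLie.skew (e β), R.lie_f_e _ _ hγ,
        R.lie_e_e]
      simp only [map_add, map_neg, map_sum, map_smul, LinearMap.add_apply, LinearMap.neg_apply,
        LinearMap.sum_apply, LinearMap.smul_apply, mul_smul, ← Finset.smul_sum,
        anticomm_comm (e γ)]
      module
  -- The weight w is additive where m is supported and vanishes at β, so antisymmetry of m cancels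
  -- the terms in pairs.
  have h4 : (∑ γ, ∑ δ, (w γ * m γ β δ) • anticomm A (f γ) (e δ)) +
      ∑ γ, ∑ δ, (w γ * m β δ γ) • anticomm A (f δ) (e γ) = 0 := by
    rw [Finset.sum_comm (f := fun γ δ => (w γ * m β δ γ) • anticomm A (f δ) (e γ)),
      ← Finset.sum_add_distrib]
    refine Finset.sum_eq_zero fun γ _ => ?_
    rw [← Finset.sum_add_distrib]
    refine Finset.sum_eq_zero fun δ _ => ?_
    rw [← add_smul, R.m_antisymm γ β δ]
    by_cases h0 : m β γ δ = 0
    · rw [h0]; simp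
    · have hc := R.c_of_add _ _ _ (R.m_supp _ _ _ h0)
      simp only [w, hc i, hc j]
      push_cast
      rw [show ((S.c j β * S.c i γ - S.c i β * S.c j γ) * -m β γ δ +
        (S.c j β * (S.c i β + S.c i γ) - S.c i β * (S.c j β + S.c j γ)) * m β γ δ : ℂ) = 0 by ring,
        zero_smul]
  -- For β = γ + δ the weight is c_i γ c_j δ − c_i δ c_j γ; antisymmetry of n makes the two parts
  -- contribute equally.
  have h5 : ∑ γ, ∑ δ, (w γ * n γ δ β) • anticomm A (e γ) (e δ) =
      (2 : ℂ) • ∑ γ, ∑ δ, (S.c i γ * S.c j δ * n γ δ β : ℂ) • anticomm A (e γ) (e δ) := by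
    have h6 : ∑ γ, ∑ δ, (S.c i γ * S.c j δ * n γ δ β : ℂ) • anticomm A (e γ) (e δ) =
        ∑ γ, ∑ δ, (-(S.c i δ * S.c j γ * n γ δ β) : ℂ) • anticomm A (e γ) (e δ) := by
      rw [Finset.sum_comm]
      refine Finset.sum_congr rfl fun γ _ => Finset.sum_congr rfl fun δ _ => ?_
      rw [R.n_antisymm, anticomm_comm]
      congr 1; ring
    rw [two_smul]
    nth_rewrite 2 [h6]
    rw [← Finset.sum_add_distrib]
    refine Finset.sum_congr rfl fun γ _ => ?_
    rw [← Finset.sum_add_distrib]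
    refine Finset.sum_congr rfl fun δ _ => ?_
    rw [← add_smul]
    by_cases h0 : n γ δ β = 0
    · rw [h0]; simp
    · have hc := R.c_of_add _ _ _ (R.n_supp _ _ _ h0)
      simp only [w, hc i, hc j]
      push_cast
      congr 1; ring
  simp only [h3, Finset.sum_sub_distrib, Finset.sum_add_distrib, h4, h5] at h1
  linear_combination (norm := module) h1

end SecondModes

end PosSystem.Realization

/-! ### One half of the coproduct as an abstract construction. -/

namespace Levendorskii

/-- The data from which one half of the comultiplication is built: `p j n + q₀ j` is the image of
the generator of degree `n = d j`, with the next modes `p j (n + 1)` and `q₁ j`; the tensor `Ω`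
provides the corrections. -/
structure HalfCoproduct {I T : Type*} [Ring T] [Algebra ℂ T] (α : I → I → ℂ) (Ω : T) (σ w : I → T)
    (d : I → ℕ) (p K : I → ℕ → T) (q₀ q₁ : I → T) : Prop where
  diag_ne : ∀ i, α i i ≠ 0
  lie_pq_Ω : ∀ j n, n ≤ d j → ⁅p j n + (if n = d j then q₀ j else 0), Ω⁆ = K j n
  K_eq : ∀ j n, n < d j → K j n = if n + 1 = d j then q₀ j else 0
  lie_w_p : ∀ i j n, ⁅w i, p j n⁆ = 0
  lie_w_q : ∀ i j, ⁅w i, q₀ j⁆ = α i j • q₀ j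
  lie_w_K : ∀ i j n, ⁅w i, K j n⁆ = α i j • K j n
  lie_σ_p : ∀ i j n, ⁅σ i, p j n⁆ = α i j • p j (n + 1)
  lie_σ_q : ∀ i j, ⁅σ i, q₀ j⁆ = α i j • q₁ j
  lie_p_p : ∀ i j, ⁅p i 1, p j 0⁆ - ⁅p i 0, p j 1⁆ = (α i j / 2) • (p i 0 * p j 0 + p j 0 * p i 0)
  lie_q_q : ∀ i j, ⁅q₁ i, q₀ j⁆ - ⁅q₀ i, q₁ j⁆ = (α i j / 2) • (q₀ i * q₀ j + q₀ j * q₀ i)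
  lie_p_q₀ : ∀ i j n, ⁅p i n, q₀ j⁆ = 0
  lie_p_q₁ : ∀ i j n, ⁅p i n, q₁ j⁆ = 0
  lie_p_K : ∀ i j, ⁅p i 0, K j 0⁆ = -α i j • (p i 0 * if 0 = d j then q₀ j else 0)
  symm : ∀ i j, α i j = α j i

/-- The modes `x_0, x_1, …` obtained from `x_0` by repeated brackets with `s`. -/
noncomputable def ladder {T : Type*} [Ring T] [Algebra ℂ T] (κ : ℂ) (s x : T) : ℕ → T
  | 0 => x
  | n + 1 => κ⁻¹ • ⁅s, ladder κ s x n⁆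

theorem lie_ladder {T : Type*} [Ring T] [Algebra ℂ T] {κ : ℂ} {s t x : T} {r : ℂ}
    (hst : ⁅t, s⁆ = 0) (h0 : ⁅t, x⁆ = r • ladder κ s x 1) (n : ℕ) :
    ⁅t, ladder κ s x n⁆ = r • ladder κ s x (n + 1) := by
  induction n with
  | zero => exact h0
  | succ n ih =>
    rw [ladder, RingLie.smul, RingLie.leibniz, hst, RingLie.zero_left, zero_add, ih, RingLie.smul,
      ladder.eq_def κ s x (n + 1 + 1)]
    module

/-- Two uses of the Jacobi identity reduce the terms with Ω to −[a, K'] − [c, K]. By the last two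
hypotheses this is exactly the cross term 2r(ad + cb) of the product. -/
theorem quadratic_of_lie {T : Type*} [Ring T] [Algebra ℂ T] {a a' b b' c c' d d' Ω K K' : T} {r : ℂ}
    (h1 : ⁅a + b, Ω⁆ = K) (h2 : ⁅c + d, Ω⁆ = K') (h3 : ⁅a, d⁆ = 0) (h4 : ⁅c, b⁆ = 0)
    (h5 : ⁅a', d⁆ = 0) (h6 : ⁅c', b⁆ = 0) (h7 : ⁅a, d'⁆ = 0) (h8 : ⁅c, b'⁆ = 0)
    (h9 : ⁅a', c⁆ - ⁅a, c'⁆ = r • (a * c + c * a)) (h10 : ⁅b', d⁆ - ⁅b, d'⁆ = r • (b * d + d * b))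
    (h11 : ⁅a, K'⁆ = -(2 * r) • (a * d)) (h12 : ⁅c, K⁆ = -(2 * r) • (c * b)) :
    ⁅a' + b' + ⁅a, Ω⁆, c + d⁆ - ⁅a + b, c' + d' + ⁅c, Ω⁆⁆ =
      r • ((a + b) * (c + d) + (c + d) * (a + b)) := by
  have e1 := RingLie.leibniz a (c + d) Ω
  have e2 := RingLie.leibniz (a + b) c Ω
  rw [h2, h11, RingLie.add a, h3, add_zero] at e1
  rw [h1, h12, RingLie.add_left a b c, RingLie.skew b c, h4, neg_zero, add_zero] at e2
  have e3 : a * d = d * a := by rwa [Ring.lie_def, sub_eq_zero] at h3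
  have e4 : c * b = b * c := by rwa [Ring.lie_def, sub_eq_zero] at h4
  rw [RingLie.add_left, RingLie.add_left, RingLie.skew ⁅a, Ω⁆, RingLie.add (a + b), RingLie.add _ c',
    RingLie.add a', RingLie.add b', RingLie.add_left a b c', RingLie.add_left a b d', h5, h7,
    RingLie.skew b' c, h8, RingLie.skew b c', h6]
  simp only [mul_add, add_mul, ← e3, ← e4]
  linear_combination (norm := module) h9 + h10 + e1 - e2

namespace HalfCoproduct

variable {I T : Type*} [Ring T] [Algebra ℂ T] {α : I → I → ℂ} {Ω : T} {σ w : I → T}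
    {d : I → ℕ} {p K : I → ℕ → T} {q₀ q₁ : I → T}

/-- The images of the generators. -/
noncomputable def x (_D : HalfCoproduct α Ω σ w d p K q₀ q₁) (j : I) : ℕ → T :=
  ladder (α j j) (σ j - ⁅w j, Ω⁆) (p j 0 + if 0 = d j then q₀ j else 0)

/-- The Jacobi identity for w_i, the n-th mode and Ω trades [w_i, Ω] for K; the parts coming from q₀
cancel and [p_n, Ω] is left. -/
theorem lie_s (D : HalfCoproduct α Ω σ w d p K q₀ q₁) (i : I) {j : I} {n : ℕ} (hn : n ≤ d j) :
    ⁅σ i - ⁅w i, Ω⁆, p j n + (if n = d j then q₀ j else 0)⁆ =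
      α i j • (p j (n + 1) + (if n = d j then q₁ j else 0) + ⁅p j n, Ω⁆) := by
  have hK := D.lie_pq_Ω j n hn
  have hw : ⁅w i, p j n + (if n = d j then q₀ j else 0)⁆ =
      α i j • (if n = d j then q₀ j else 0) := by
    rw [RingLie.add, D.lie_w_p, zero_add]
    split_ifs
    · exact D.lie_w_q i j
    · rw [RingLie.zero, smul_zero]
  have hσ : ⁅σ i, p j n + (if n = d j then q₀ j else 0)⁆ =
      α i j • (p j (n + 1) + (if n = d j then q₁ j else 0)) := by
    rw [RingLie.add, D.lie_σ_p, smul_add]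
    split_ifs
    · rw [D.lie_σ_q]
    · rw [RingLie.zero, smul_zero]
  have h1 := RingLie.leibniz (w i) (p j n + (if n = d j then q₀ j else 0)) Ω
  rw [hw, hK, D.lie_w_K, ← hK, RingLie.smul_left, RingLie.add_left (p j n)] at h1
  rw [RingLie.sub_left, hσ, RingLie.skew ⁅w i, Ω⁆]
  linear_combination (norm := module) -h1

theorem x_zero (D : HalfCoproduct α Ω σ w d p K q₀ q₁) (j : I) :
    D.x j 0 = p j 0 + if 0 = d j then q₀ j else 0 := rfl

theorem x_succ (D : HalfCoproduct α Ω σ w d p K q₀ q₁) (j : I) (n : ℕ) :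
    D.x j (n + 1) = (α j j)⁻¹ • ⁅σ j - ⁅w j, Ω⁆, D.x j n⁆ := rfl

/-- Before degree d the correction [p_n, Ω] is zero except just below d, where it equals q₀; in this
way the other tensor factor enters. -/
theorem x_eq (D : HalfCoproduct α Ω σ w d p K q₀ q₁) {j : I} {n : ℕ} (hn : n ≤ d j) :
    D.x j n = p j n + if n = d j then q₀ j else 0 := by
  induction n with
  | zero => rfl
  | succ n ih =>
    have hn' : n < d j := hn
    rw [D.x_succ, ih hn'.le, D.lie_s j hn'.le, smul_smul, inv_mul_cancel₀ (D.diag_ne j), one_smul,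
      if_neg hn'.ne, add_zero, ← D.K_eq j n hn', ← D.lie_pq_Ω j n hn'.le, if_neg hn'.ne, add_zero]

theorem x_succ_eq (D : HalfCoproduct α Ω σ w d p K q₀ q₁) {j : I} {n : ℕ} (hn : n ≤ d j) :
    D.x j (n + 1) = p j (n + 1) + (if n = d j then q₁ j else 0) + ⁅p j n, Ω⁆ := by
  rw [D.x_succ, D.x_eq hn, D.lie_s j hn, smul_smul, inv_mul_cancel₀ (D.diag_ne j), one_smul]

/-- The modes are defined with the operator of their own node; when all these operators commute, the
other ones shift them as well. -/
theorem lie_s_x (D : HalfCoproduct α Ω σ w d p K q₀ q₁)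
    (hs : ∀ i j, ⁅σ i - ⁅w i, Ω⁆, σ j - ⁅w j, Ω⁆⁆ = 0) (i j : I) (n : ℕ) :
    ⁅σ i - ⁅w i, Ω⁆, D.x j n⁆ = α i j • D.x j (n + 1) := by
  refine lie_ladder (hs i j) ?_ n
  rw [D.lie_s i (Nat.zero_le _)]
  exact congrArg _ (D.x_succ_eq (Nat.zero_le _)).symm

theorem lie_x_x (D : HalfCoproduct α Ω σ w d p K q₀ q₁) (i j : I) :
    ⁅D.x i 1, D.x j 0⁆ - ⁅D.x i 0, D.x j 1⁆ =
      (α i j / 2) • (D.x i 0 * D.x j 0 + D.x j 0 * D.x i 0) := by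
  have hK := fun j => D.lie_pq_Ω j 0 (Nat.zero_le _)
  have hpK := D.lie_p_K
  have hqq : ∀ i j, ⁅(if 0 = d i then q₁ i else 0), (if 0 = d j then q₀ j else 0)⁆ -
      ⁅(if 0 = d i then q₀ i else 0), (if 0 = d j then q₁ j else 0)⁆ = (α i j / 2) •
      ((if 0 = d i then q₀ i else 0) * (if 0 = d j then q₀ j else 0) +
        (if 0 = d j then q₀ j else 0) * (if 0 = d i then q₀ i else 0)) := by
    intro i j
    split_ifs
    · exact D.lie_q_q i j
    all_goals simp only [RingLie.zero, RingLie.zero_left, mul_zero, zero_mul, add_zero, sub_zero,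
      smul_zero]
  have hp0 : ∀ i j n, ⁅p i n, (if 0 = d j then q₀ j else 0)⁆ = 0 := by
    intro i j n; split_ifs; exacts [D.lie_p_q₀ i j n, RingLie.zero _]
  have hp1 : ∀ i j n, ⁅p i n, (if 0 = d j then q₁ j else 0)⁆ = 0 := by
    intro i j n; split_ifs; exacts [D.lie_p_q₁ i j n, RingLie.zero _]
  have hx1 : ∀ j, D.x j 1 = p j 1 + (if 0 = d j then q₁ j else 0) + ⁅p j 0, Ω⁆ :=
    fun j => D.x_succ_eq (Nat.zero_le _)
  rw [hx1, hx1, D.x_zero, D.x_zero]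
  refine quadratic_of_lie (hK i) (hK j) (hp0 i j 0) (hp0 j i 0) (hp0 i j 1) (hp0 j i 1)
    (hp1 i j 0) (hp1 j i 0) (D.lie_p_p i j) (hqq i j) ?_ ?_
  · rw [hpK]; congr 1; ring
  · rw [hpK, D.symm j i]; congr 1; ring

end HalfCoproduct
end Levendorskii

/-! ### Brackets in a tensor product. -/

namespace RingLie

variable {A B : Type*} [Ring A] [Algebra ℂ A] [Ring B] [Algebra ℂ B]

theorem tmul_tmul (a c : A) (b d : B) : ⁅a ⊗ₜ[ℂ] b, c ⊗ₜ[ℂ] d⁆ =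
    (1 / 2 : ℂ) • (⁅a, c⁆ ⊗ₜ[ℂ] (b * d + d * b) + (a * c + c * a) ⊗ₜ[ℂ] ⁅b, d⁆) := by
  simp only [Ring.lie_def, Algebra.TensorProduct.tmul_mul_tmul, TensorProduct.add_tmul,
    TensorProduct.sub_tmul, TensorProduct.tmul_add, TensorProduct.tmul_sub]
  module

theorem left_tmul (a c : A) (d : B) : ⁅a ⊗ₜ[ℂ] (1 : B), c ⊗ₜ[ℂ] d⁆ = ⁅a, c⁆ ⊗ₜ[ℂ] d := by
  simp only [Ring.lie_def, Algebra.TensorProduct.tmul_mul_tmul, TensorProduct.sub_tmul, one_mul,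
    mul_one]

theorem right_tmul (b d : B) (c : A) : ⁅(1 : A) ⊗ₜ[ℂ] b, c ⊗ₜ[ℂ] d⁆ = c ⊗ₜ[ℂ] ⁅b, d⁆ := by
  simp only [Ring.lie_def, Algebra.TensorProduct.tmul_mul_tmul, TensorProduct.tmul_sub, one_mul,
    mul_one]

theorem tmul_left (a c : A) (d : B) : ⁅c ⊗ₜ[ℂ] d, a ⊗ₜ[ℂ] (1 : B)⁆ = ⁅c, a⁆ ⊗ₜ[ℂ] d := by
  rw [skew, left_tmul, ← TensorProduct.neg_tmul, ← skew]

theorem tmul_right (b d : B) (c : A) : ⁅c ⊗ₜ[ℂ] d, (1 : A) ⊗ₜ[ℂ] b⁆ = c ⊗ₜ[ℂ] ⁅d, b⁆ := by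
  rw [skew, right_tmul, ← TensorProduct.tmul_neg, ← skew]

theorem left_right (a : A) (b : B) : ⁅a ⊗ₜ[ℂ] (1 : B), (1 : A) ⊗ₜ[ℂ] b⁆ = 0 := by
  rw [left_tmul, one, TensorProduct.zero_tmul]

theorem right_left (a : A) (b : B) : ⁅(1 : A) ⊗ₜ[ℂ] b, a ⊗ₜ[ℂ] (1 : B)⁆ = 0 := by
  rw [right_tmul, one, TensorProduct.tmul_zero]

end RingLie

/-- If `y` has central brackets with the simple root vectors, then it commutes with the other
root vectors. -/
theorem PosSystem.Realization.lie_f_eq_zero {I P M : Type*} [AddCommGroup M] {S : PosSystem I P M}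
    [Fintype P] {n m : P → P → P → ℂ} {A : Type*} [Ring A] [Algebra ℂ A] {e f : P → A} {h : I → A}
    (R : S.Realization n m e f h) {y : A} (hy : ∀ k (z : A), ⁅⁅y, f (S.s k)⁆, z⁆ = 0) {γ : P}
    (hγ : ∀ i, γ ≠ S.s i) : ⁅y, f γ⁆ = 0 := by
  have key : ∀ γ, (∀ z : A, ⁅⁅y, f γ⁆, z⁆ = 0) ∧ ((∀ i, γ ≠ S.s i) → ⁅y, f γ⁆ = 0) := by
    intro γ
    generalize hN : S.ht γ = N
    induction N using Nat.strong_induction_on generalizing γ with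
    | _ N ih =>
      rcases R.f_step γ with ⟨k, rfl⟩ | ⟨k, β, r, hβ, hf⟩
      · exact ⟨hy k, fun h0 => absurd rfl (h0 k)⟩
      · have hht := S.ht_add hβ
        have h0 : ⁅y, f γ⁆ = 0 := by
          rw [hf, RingLie.smul, RingLie.leibniz, hy, RingLie.skew (f _),
            (ih _ (by omega) β rfl).1, neg_zero, add_zero, smul_zero]
        exact ⟨fun z => by rw [h0, RingLie.zero_left], fun _ => h0⟩
  exact (key γ).2 hγ

/-! ### The half Casimir of two shifted Yangians. -/

namespace ShiftedYangian

variable {I : Type*} {A : Matrix I I ℤ}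

theorem H_low {m : I → ℤ} {i : I} {a n : ℕ} (ha : (a : ℤ) = -m i) (hn : n < a) :
    H A m i ((n : ℤ) + 1) = if n + 1 = a then 1 else 0 := by
  split_ifs with h
  · rw [← H_neg A m i, ← ha, ← h]; push_cast; rfl
  · exact H_of_lt A m i (by omega)

theorem lie_e_f_zero {m : I → ℤ} {i : I} {a n : ℕ} (ha : (a : ℤ) = -m i) (hn : n < a) (k : I)
    (z : ShiftedYangian A m) : ⁅⁅e A m i n, f A m k 0⁆, z⁆ = 0 := by
  by_cases hik : i = k
  · subst hik
    rw [lie_e_f, Nat.cast_zero, add_zero, H_low ha hn]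
    split_ifs
    · exact RingLie.one_left z
    · exact RingLie.zero_left z
  · rw [lie_e_f_ne A m hik, RingLie.zero_left]

theorem lie_f_e_zero {m : I → ℤ} {i : I} {a n : ℕ} (ha : (a : ℤ) = -m i) (hn : n < a) (k : I)
    (z : ShiftedYangian A m) : ⁅⁅f A m i n, e A m k 0⁆, z⁆ = 0 := by
  by_cases hik : k = i
  · subst hik
    rw [RingLie.skew (f _ _ _ _), lie_e_f, Nat.cast_zero, zero_add, H_low ha hn, RingLie.neg_left]
    split_ifs
    · rw [RingLie.one_left, neg_zero]
    · rw [RingLie.zero_left, neg_zero]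
  · rw [RingLie.skew (f _ _ _ _), lie_e_f_ne A m hik, neg_zero, RingLie.zero_left]

variable {P M : Type*} [AddCommGroup M] [Fintype P]

/-- Root vectors in two shifted Yangians, extending `E_i^{(a_i+1)}`, `F_i^{(1)}` in the first one
and `E_i^{(1)}`, `F_i^{(b_i+1)}` in the second one. -/
structure CoproductData (S : PosSystem I P M) (n m : P → P → P → ℂ) (A : Matrix I I ℤ)
    (m₁ m₂ : I → ℤ) (a b : I → ℕ) (e₁ f₁ : P → ShiftedYangian A m₁)
    (e₂ f₂ : P → ShiftedYangian A m₂) : Prop where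
  entry : ∀ i j, S.c i (S.s j) = A i j
  a_eq : ∀ i, (a i : ℤ) = -m₁ i
  b_eq : ∀ i, (b i : ℤ) = -m₂ i
  left : S.Realization n m e₁ f₁ (S₁ A m₁)
  right : S.Realization n m e₂ f₂ (S₁ A m₂)
  e₁_simple : ∀ i, e₁ (S.s i) = e A m₁ i (a i)
  f₁_simple : ∀ i, f₁ (S.s i) = f A m₁ i 0
  e₂_simple : ∀ i, e₂ (S.s i) = e A m₂ i 0
  f₂_simple : ∀ i, f₂ (S.s i) = f A m₂ i (b i)

namespace CoproductData

variable {S : PosSystem I P M} {n m : P → P → P → ℂ} {m₁ m₂ : I → ℤ} {a b : I → ℕ}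
  {e₁ f₁ : P → ShiftedYangian A m₁} {e₂ f₂ : P → ShiftedYangian A m₂}

/-- The half Casimir tensor. -/
noncomputable def omega (_D : CoproductData S n m A m₁ m₂ a b e₁ f₁ e₂ f₂) :
    ShiftedYangian A m₁ ⊗[ℂ] ShiftedYangian A m₂ := ∑ γ, f₁ γ ⊗ₜ[ℂ] e₂ γ

/-- The half Casimir tensor weighted by the inner products with `α_i`. -/
noncomputable def omegaWeighted (_D : CoproductData S n m A m₁ m₂ a b e₁ f₁ e₂ f₂) (i : I) :
    ShiftedYangian A m₁ ⊗[ℂ] ShiftedYangian A m₂ := ∑ γ, (S.c i γ : ℂ) • (f₁ γ ⊗ₜ[ℂ] e₂ γ)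

/-- The image of `S_i^{(N_i+1)}`. -/
noncomputable def s₁ (_D : CoproductData S n m A m₁ m₂ a b e₁ f₁ e₂ f₂) (i : I) :
    ShiftedYangian A m₁ ⊗[ℂ] ShiftedYangian A m₂ := S₁ A m₁ i ⊗ₜ[ℂ] 1 + 1 ⊗ₜ[ℂ] S₁ A m₂ i

/-- The image of `S_i^{(N_i+2)}`. -/
noncomputable def s₂ (D : CoproductData S n m A m₁ m₂ a b e₁ f₁ e₂ f₂) (i : I) :
    ShiftedYangian A m₁ ⊗[ℂ] ShiftedYangian A m₂ :=
  S₂ A m₁ i ⊗ₜ[ℂ] 1 + 1 ⊗ₜ[ℂ] S₂ A m₂ i - D.omegaWeighted i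

variable (D : CoproductData S n m A m₁ m₂ a b e₁ f₁ e₂ f₂)
include D

theorem diag (i : I) : A i i = 2 := by rw [← D.entry, S.c_self]

theorem symm (i j : I) : A i j = A j i := by rw [← D.entry, ← D.entry, S.c_symm]

theorem lie_right_omega (i : I) : ⁅(1 : ShiftedYangian A m₁) ⊗ₜ[ℂ] S₁ A m₂ i, D.omega⁆ =
    D.omegaWeighted i := by
  rw [omega, RingLie.sum]
  exact Finset.sum_congr rfl fun γ _ => by
    rw [RingLie.right_tmul, D.right.lie_h_e, TensorProduct.tmul_smul]

theorem lie_left_omega (i : I) : ⁅S₁ A m₁ i ⊗ₜ[ℂ] (1 : ShiftedYangian A m₂), D.omega⁆ =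
    -D.omegaWeighted i := by
  rw [omega, RingLie.sum, omegaWeighted, ← Finset.sum_neg_distrib]
  exact Finset.sum_congr rfl fun γ _ => by
    rw [RingLie.left_tmul, D.left.lie_h_f, neg_smul, TensorProduct.neg_tmul,
      TensorProduct.smul_tmul']

/-- Below degree a the brackets with F_i^{(1)} are 0 or 1, hence central, so the brackets with
nonsimple root vectors vanish and one term survives. -/
theorem lie_e_omega {j : I} {k : ℕ} (hk : k < a j) :
    ⁅e A m₁ j k ⊗ₜ[ℂ] (1 : ShiftedYangian A m₂), D.omega⁆ =
      H A m₁ j ((k : ℤ) + 1) ⊗ₜ[ℂ] e A m₂ j 0 := by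
  have h1 : ∀ i (z : ShiftedYangian A m₁), ⁅⁅e A m₁ j k, f₁ (S.s i)⁆, z⁆ = 0 := fun i z => by
    rw [D.f₁_simple, lie_e_f_zero (D.a_eq j) hk]
  rw [omega, RingLie.sum, Finset.sum_eq_single (S.s j)]
  · rw [RingLie.left_tmul, D.f₁_simple, D.e₂_simple, lie_e_f, Nat.cast_zero, add_zero]
  · intro γ _ hγ
    rw [RingLie.left_tmul]
    by_cases hs : ∃ i, γ = S.s i
    · obtain ⟨i, rfl⟩ := hs
      rw [D.f₁_simple, lie_e_f_ne A m₁ (fun hji => hγ (by rw [hji])), TensorProduct.zero_tmul]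
    · rw [D.left.lie_f_eq_zero h1 (not_exists.1 hs), TensorProduct.zero_tmul]
  · intro h0; exact absurd (Finset.mem_univ _) h0

theorem lie_f_omega {j : I} {k : ℕ} (hk : k < b j) :
    ⁅(1 : ShiftedYangian A m₁) ⊗ₜ[ℂ] f A m₂ j k, D.omega⁆ =
      -f A m₁ j 0 ⊗ₜ[ℂ] H A m₂ j ((k : ℤ) + 1) := by
  have h1 : ∀ i (z : ShiftedYangian A m₂), ⁅⁅f A m₂ j k, e₂ (S.s i)⁆, z⁆ = 0 := fun i z => by
    rw [D.e₂_simple, lie_f_e_zero (D.b_eq j) hk]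
  rw [omega, RingLie.sum, Finset.sum_eq_single (S.s j)]
  · rw [RingLie.right_tmul, D.f₁_simple, D.e₂_simple, RingLie.skew (f _ _ _ _), lie_e_f,
      Nat.cast_zero, zero_add, TensorProduct.tmul_neg]
  · intro γ _ hγ
    rw [RingLie.right_tmul]
    by_cases hs : ∃ i, γ = S.s i
    · obtain ⟨i, rfl⟩ := hs
      rw [D.e₂_simple, RingLie.skew (f _ _ _ _), lie_e_f_ne A m₂ (fun hji => hγ (by rw [hji])),
        neg_zero, TensorProduct.tmul_zero]
    · rw [D.right.symm.lie_f_eq_zero h1 (not_exists.1 hs), TensorProduct.tmul_zero]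
  · intro h0; exact absurd (Finset.mem_univ _) h0

theorem lie_X_omega (j : I) :
    ⁅e A m₁ j (a j) ⊗ₜ[ℂ] (1 : ShiftedYangian A m₂) + 1 ⊗ₜ[ℂ] e A m₂ j 0, D.omega⁆ =
      S₁ A m₁ j ⊗ₜ[ℂ] e A m₂ j 0 := by
  have h1 := D.left.sum_lie_X D.right (TensorProduct.mk ℂ _ _) j
  simp only [TensorProduct.mk_apply, D.e₁_simple, D.e₂_simple] at h1
  rw [← h1, omega, RingLie.sum]
  exact Finset.sum_congr rfl fun γ _ => by
    rw [RingLie.add_left, RingLie.left_tmul, RingLie.right_tmul, add_comm]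

theorem lie_Y_omega (j : I) :
    ⁅f A m₁ j 0 ⊗ₜ[ℂ] (1 : ShiftedYangian A m₂) + 1 ⊗ₜ[ℂ] f A m₂ j (b j), D.omega⁆ =
      -(f A m₁ j 0 ⊗ₜ[ℂ] S₁ A m₂ j) := by
  have h1 := D.left.sum_lie_Y D.right (TensorProduct.mk ℂ _ _) j
  simp only [TensorProduct.mk_apply, D.f₁_simple, D.f₂_simple] at h1
  rw [← h1, omega, RingLie.sum]
  exact Finset.sum_congr rfl fun γ _ => by
    rw [RingLie.add_left, RingLie.left_tmul, RingLie.right_tmul, add_comm]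

theorem halfE : Levendorskii.HalfCoproduct (fun i j => (A i j : ℂ)) D.omega
    (fun i => S₂ A m₁ i ⊗ₜ[ℂ] 1 + 1 ⊗ₜ[ℂ] S₂ A m₂ i) (fun i => 1 ⊗ₜ[ℂ] S₁ A m₂ i) a
    (fun j k => e A m₁ j k ⊗ₜ[ℂ] 1) (fun j k => H A m₁ j ((k : ℤ) + 1) ⊗ₜ[ℂ] e A m₂ j 0)
    (fun j => 1 ⊗ₜ[ℂ] e A m₂ j 0) (fun j => 1 ⊗ₜ[ℂ] e A m₂ j 1) where
  diag_ne i := by rw [D.diag]; norm_num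
  lie_pq_Ω j k hk := by
    split_ifs with h
    · rw [h, D.lie_X_omega, S₁, D.a_eq]
    · rw [add_zero, D.lie_e_omega (by omega)]
  K_eq j k hk := by
    rw [H_low (D.a_eq j) hk]
    split_ifs
    · rfl
    · exact TensorProduct.zero_tmul _ _
  lie_w_p i j k := RingLie.right_left _ _
  lie_w_q i j := by rw [RingLie.right_tmul, lie_S₁_e, TensorProduct.tmul_smul]
  lie_w_K i j k := by rw [RingLie.right_tmul, lie_S₁_e, TensorProduct.tmul_smul]
  lie_σ_p i j k := by
    rw [RingLie.add_left, RingLie.left_tmul, RingLie.right_left, lie_S₂_e, add_zero,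
      TensorProduct.smul_tmul']
  lie_σ_q i j := by
    rw [RingLie.add_left, RingLie.left_right, RingLie.right_tmul, lie_S₂_e, zero_add,
      TensorProduct.tmul_smul]
  lie_p_p i j := by
    simp only [RingLie.left_tmul, Algebra.TensorProduct.tmul_mul_tmul, one_mul,
      ← TensorProduct.sub_tmul, ← TensorProduct.add_tmul]
    rw [e_e A m₁ i j 0 0, TensorProduct.smul_tmul']
  lie_q_q i j := by
    simp only [RingLie.right_tmul, Algebra.TensorProduct.tmul_mul_tmul, one_mul,
      ← TensorProduct.tmul_sub, ← TensorProduct.tmul_add]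
    rw [e_e A m₂ i j 0 0, TensorProduct.tmul_smul]
  lie_p_q₀ i j k := RingLie.left_right _ _
  lie_p_q₁ i j k := RingLie.left_right _ _
  lie_p_K i j := by
    rw [RingLie.left_tmul, RingLie.skew]
    split_ifs with h
    · have h1 : H A m₁ j (((0 : ℕ) : ℤ) + 1) = S₁ A m₁ j := by rw [S₁, ← D.a_eq, ← h]
      rw [h1, lie_S₁_e, D.symm, Algebra.TensorProduct.tmul_mul_tmul, mul_one, one_mul, ← neg_smul,
        TensorProduct.smul_tmul']
    · rw [H_low (D.a_eq j) (by omega), mul_zero, smul_zero]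
      split_ifs
      · rw [RingLie.one_left, neg_zero, TensorProduct.zero_tmul]
      · rw [RingLie.zero_left, neg_zero, TensorProduct.zero_tmul]
  symm i j := by rw [D.symm]

/-- The two factors exchange roles and Ω changes sign, yet the operator σ − [w, Ω] is the same as
for E: see `s₂_eq_E` and `s₂_eq_F`. -/
theorem halfF : Levendorskii.HalfCoproduct (fun i j => -(A i j : ℂ)) (-D.omega)
    (fun i => S₂ A m₁ i ⊗ₜ[ℂ] 1 + 1 ⊗ₜ[ℂ] S₂ A m₂ i) (fun i => S₁ A m₁ i ⊗ₜ[ℂ] 1) b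
    (fun j k => 1 ⊗ₜ[ℂ] f A m₂ j k) (fun j k => f A m₁ j 0 ⊗ₜ[ℂ] H A m₂ j ((k : ℤ) + 1))
    (fun j => f A m₁ j 0 ⊗ₜ[ℂ] 1) (fun j => f A m₁ j 1 ⊗ₜ[ℂ] 1) where
  diag_ne i := by rw [D.diag]; norm_num
  lie_pq_Ω j k hk := by
    rw [RingLie.neg]
    split_ifs with h
    · rw [h, add_comm, D.lie_Y_omega, neg_neg, S₁, D.b_eq]
    · rw [add_zero, D.lie_f_omega (by omega), neg_neg]
  K_eq j k hk := by
    rw [H_low (D.b_eq j) hk]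
    split_ifs
    · rfl
    · exact TensorProduct.tmul_zero _ _
  lie_w_p i j k := RingLie.left_right _ _
  lie_w_q i j := by rw [RingLie.left_tmul, lie_S₁_f, TensorProduct.smul_tmul']
  lie_w_K i j k := by rw [RingLie.left_tmul, lie_S₁_f, TensorProduct.smul_tmul']
  lie_σ_p i j k := by
    rw [RingLie.add_left, RingLie.left_right, RingLie.right_tmul, lie_S₂_f, zero_add,
      TensorProduct.tmul_smul]
  lie_σ_q i j := by
    rw [RingLie.add_left, RingLie.left_tmul, RingLie.right_left, lie_S₂_f, add_zero,
      TensorProduct.smul_tmul']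
  lie_p_p i j := by
    simp only [RingLie.right_tmul, Algebra.TensorProduct.tmul_mul_tmul, one_mul,
      ← TensorProduct.tmul_sub, ← TensorProduct.tmul_add]
    rw [f_f A m₂ i j 0 0, TensorProduct.tmul_smul, neg_div]
  lie_q_q i j := by
    simp only [RingLie.left_tmul, Algebra.TensorProduct.tmul_mul_tmul, one_mul,
      ← TensorProduct.sub_tmul, ← TensorProduct.add_tmul]
    rw [f_f A m₁ i j 0 0, TensorProduct.smul_tmul', neg_div]
  lie_p_q₀ i j k := RingLie.right_left _ _
  lie_p_q₁ i j k := RingLie.right_left _ _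
  lie_p_K i j := by
    rw [RingLie.right_tmul, RingLie.skew]
    split_ifs with h
    · have h1 : H A m₂ j (((0 : ℕ) : ℤ) + 1) = S₁ A m₂ j := by rw [S₁, ← D.b_eq, ← h]
      rw [h1, lie_S₁_f, D.symm, Algebra.TensorProduct.tmul_mul_tmul, mul_one, one_mul, ← neg_smul,
        TensorProduct.tmul_smul]
    · rw [H_low (D.b_eq j) (by omega), mul_zero, smul_zero]
      split_ifs
      · rw [RingLie.one_left, neg_zero, TensorProduct.tmul_zero]
      · rw [RingLie.zero_left, neg_zero, TensorProduct.tmul_zero]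
  symm i j := by rw [D.symm]

end CoproductData

end ShiftedYangian

/-! ### Commutativity of the images of S₂, and the Cartan values in low degree. -/

namespace ShiftedYangian.CoproductData

variable {I : Type*} {A : Matrix I I ℤ} {P M : Type*} [AddCommGroup M] [Fintype P]
  {S : PosSystem I P M} {n m : P → P → P → ℂ} {m₁ m₂ : I → ℤ} {a b : I → ℕ}
  {e₁ f₁ : P → ShiftedYangian A m₁} {e₂ f₂ : P → ShiftedYangian A m₂}
  (D : CoproductData S n m A m₁ m₂ a b e₁ f₁ e₂ f₂)

include D

theorem secondModes_right : D.right.SecondModes (S₂ A m₂) (fun k => e A m₂ k 1) where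
  lie_s_e i k := by rw [D.e₂_simple, lie_S₂_e, D.entry]
  lie_x_e k := by rw [D.e₂_simple, e_e_self A m₂ D.diag k 0]
  lie_x_f k := by
    rw [D.f₂_simple, lie_e_f, ← H_two, D.b_eq]; congr 1; push_cast; ring

/-- Exchanging e and f changes the sign of the Cartan elements, and −F^{(2)} takes the place of
E^{(2)}; the identities for e_γ then apply to f_γ. -/
theorem secondModes_left : D.left.symm.SecondModes (S₂ A m₁) (fun k => -f A m₁ k 1) where
  lie_s_e i k := by rw [D.f₁_simple, lie_S₂_f, D.entry, neg_smul, smul_neg]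
  lie_x_e k := by rw [D.f₁_simple, RingLie.neg_left, f_f_self A m₁ D.diag k 0, neg_neg]
  lie_x_f k := by
    rw [D.e₁_simple, RingLie.neg_left, ← RingLie.skew, lie_e_f,
      neg_mul_neg, ← H_two, D.a_eq]
    congr 1; push_cast; ring

theorem lie_omegaWeighted (i j : I) :
    ⁅D.omegaWeighted i, D.omegaWeighted j⁆ =
      ∑ γ, ∑ δ, (S.c i γ * S.c j δ : ℂ) • ⁅f₁ γ ⊗ₜ[ℂ] e₂ γ, f₁ δ ⊗ₜ[ℂ] e₂ δ⁆ := by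
  simp only [omegaWeighted, RingLie.sum_left, RingLie.sum, RingLie.smul_left, RingLie.smul,
    Finset.smul_sum, smul_smul]
  rw [Finset.sum_comm]
  exact Finset.sum_congr rfl fun γ _ => Finset.sum_congr rfl fun δ _ => by rw [mul_comm]

/-- The cross terms are given by `lie_s_e_sub` in each factor, as anticommutators weighted by
structure constants. The bracket of two pure tensors splits into a commutator in one factor and an
anticommutator in the other, and matches them term by term. -/
theorem lie_s₂_s₂ (i j : I) : ⁅D.s₂ i, D.s₂ j⁆ = 0 := by
  have h1 := D.secondModes_left.lie_s_e_sub i j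
  have h2 := D.secondModes_right.lie_s_e_sub i j
  have h3 : ∀ i j, ⁅S₂ A m₁ i ⊗ₜ[ℂ] (1 : ShiftedYangian A m₂) + 1 ⊗ₜ[ℂ] S₂ A m₂ i,
      D.omegaWeighted j⁆ = ∑ β, (S.c j β : ℂ) • (⁅S₂ A m₁ i, f₁ β⁆ ⊗ₜ[ℂ] e₂ β +
        f₁ β ⊗ₜ[ℂ] ⁅S₂ A m₂ i, e₂ β⁆) := by
    intro i j
    rw [omegaWeighted, RingLie.sum]
    refine Finset.sum_congr rfl fun β _ => ?_
    rw [RingLie.smul, RingLie.add_left, RingLie.left_tmul, RingLie.right_tmul]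
  have h4 : ⁅S₂ A m₁ i ⊗ₜ[ℂ] (1 : ShiftedYangian A m₂) + 1 ⊗ₜ[ℂ] S₂ A m₂ i,
      S₂ A m₁ j ⊗ₜ[ℂ] (1 : ShiftedYangian A m₂) + 1 ⊗ₜ[ℂ] S₂ A m₂ j⁆ = 0 := by
    simp only [RingLie.add, RingLie.add_left, RingLie.left_tmul, RingLie.right_tmul, lie_S₂_S₂,
      RingLie.one, TensorProduct.zero_tmul, TensorProduct.tmul_zero, add_zero]
  have h5 : ∑ β, ((S.c j β : ℂ) • (⁅S₂ A m₁ i, f₁ β⁆ ⊗ₜ[ℂ] e₂ β + f₁ β ⊗ₜ[ℂ] ⁅S₂ A m₂ i, e₂ β⁆) -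
      (S.c i β : ℂ) • (⁅S₂ A m₁ j, f₁ β⁆ ⊗ₜ[ℂ] e₂ β + f₁ β ⊗ₜ[ℂ] ⁅S₂ A m₂ j, e₂ β⁆)) =
      ⁅D.omegaWeighted i, D.omegaWeighted j⁆ := by
    have h6 : ∀ β, (S.c j β : ℂ) • (⁅S₂ A m₁ i, f₁ β⁆ ⊗ₜ[ℂ] e₂ β + f₁ β ⊗ₜ[ℂ] ⁅S₂ A m₂ i, e₂ β⁆) -
      (S.c i β : ℂ) • (⁅S₂ A m₁ j, f₁ β⁆ ⊗ₜ[ℂ] e₂ β + f₁ β ⊗ₜ[ℂ] ⁅S₂ A m₂ j, e₂ β⁆) =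
      ∑ γ, ∑ δ, (S.c i γ * S.c j δ : ℂ) • (1 / 2 : ℂ) •
        (m γ δ β • ((f₁ γ * f₁ δ + f₁ δ * f₁ γ) ⊗ₜ[ℂ] e₂ β) +
          n γ δ β • (f₁ β ⊗ₜ[ℂ] (e₂ γ * e₂ δ + e₂ δ * e₂ γ))) := by
      intro β
      have e1 := congrArg (fun z => z ⊗ₜ[ℂ] e₂ β) (h1 β)
      have e2 := congrArg (fun z => f₁ β ⊗ₜ[ℂ] z) (h2 β)
      simp only [TensorProduct.sub_tmul, TensorProduct.tmul_sub, TensorProduct.tmul_smul,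
        ← TensorProduct.smul_tmul', TensorProduct.sum_tmul, TensorProduct.tmul_sum,
        PosSystem.Realization.anticomm_apply] at e1 e2
      have e3 : ∀ γ δ, (S.c i γ * S.c j δ : ℂ) • (1 / 2 : ℂ) •
        (m γ δ β • ((f₁ γ * f₁ δ + f₁ δ * f₁ γ) ⊗ₜ[ℂ] e₂ β) +
          n γ δ β • (f₁ β ⊗ₜ[ℂ] (e₂ γ * e₂ δ + e₂ δ * e₂ γ))) =
          (1 / 2 : ℂ) • ((S.c i γ * S.c j δ * m γ δ β : ℂ) •
            ((f₁ γ * f₁ δ + f₁ δ * f₁ γ) ⊗ₜ[ℂ] e₂ β)) +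
          (1 / 2 : ℂ) • ((S.c i γ * S.c j δ * n γ δ β : ℂ) •
            (f₁ β ⊗ₜ[ℂ] (e₂ γ * e₂ δ + e₂ δ * e₂ γ))) := by
        intro γ δ; module
      simp only [e3, Finset.sum_add_distrib, ← Finset.smul_sum]
      rw [← e1, ← e2]
      module
    simp only [h6]
    rw [D.lie_omegaWeighted, Finset.sum_comm]
    refine Finset.sum_congr rfl fun γ _ => ?_
    rw [Finset.sum_comm]
    refine Finset.sum_congr rfl fun δ _ => ?_
    rw [← Finset.smul_sum, ← Finset.smul_sum, RingLie.tmul_tmul, D.left.lie_f_f, D.right.lie_e_e,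
      Finset.sum_add_distrib, TensorProduct.sum_tmul, TensorProduct.tmul_sum]
    simp only [TensorProduct.tmul_smul, ← TensorProduct.smul_tmul']
    rw [add_comm]
  rw [s₂, s₂, RingLie.sub_left, RingLie.sub, RingLie.sub, h4, RingLie.skew (D.omegaWeighted i), h3,
    h3, ← h5, Finset.sum_sub_distrib]
  abel

theorem lie_s₁_omegaWeighted (i j : I) : ⁅D.s₁ i, D.omegaWeighted j⁆ = 0 := by
  rw [omegaWeighted, RingLie.sum]
  refine Finset.sum_eq_zero fun γ _ => ?_
  rw [RingLie.smul, s₁, RingLie.add_left, RingLie.left_tmul, RingLie.right_tmul, D.left.lie_h_f,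
    D.right.lie_h_e, TensorProduct.tmul_smul, ← TensorProduct.smul_tmul']
  module

theorem s₂_eq_E (i : I) : S₂ A m₁ i ⊗ₜ[ℂ] 1 + 1 ⊗ₜ[ℂ] S₂ A m₂ i -
    ⁅(1 : ShiftedYangian A m₁) ⊗ₜ[ℂ] S₁ A m₂ i, D.omega⁆ = D.s₂ i := by
  rw [D.lie_right_omega, s₂]

theorem s₂_eq_F (i : I) : S₂ A m₁ i ⊗ₜ[ℂ] 1 + 1 ⊗ₜ[ℂ] S₂ A m₂ i -
    ⁅S₁ A m₁ i ⊗ₜ[ℂ] (1 : ShiftedYangian A m₂), -D.omega⁆ = D.s₂ i := by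
  rw [RingLie.neg, D.lie_left_omega, neg_neg, s₂]

theorem xE_zero (j : I) : D.halfE.x j 0 = e A m₁ j 0 ⊗ₜ[ℂ] 1 +
    (if 0 = a j then (1 : ℂ) else 0) • ((1 : ShiftedYangian A m₁) ⊗ₜ[ℂ] e A m₂ j 0) := by
  rw [D.halfE.x_zero, ite_smul, one_smul, zero_smul]

theorem xF_zero (j : I) : D.halfF.x j 0 = 1 ⊗ₜ[ℂ] f A m₂ j 0 +
    (if 0 = b j then (1 : ℂ) else 0) • (f A m₁ j 0 ⊗ₜ[ℂ] (1 : ShiftedYangian A m₂)) := by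
  rw [D.halfF.x_zero, ite_smul, one_smul, zero_smul]

theorem xE_of_lt {j : I} {k : ℕ} (hk : k < a j) : D.halfE.x j k = e A m₁ j k ⊗ₜ[ℂ] 1 := by
  rw [D.halfE.x_eq hk.le, if_neg hk.ne, add_zero]

theorem xF_of_lt {j : I} {k : ℕ} (hk : k < b j) : D.halfF.x j k = 1 ⊗ₜ[ℂ] f A m₂ j k := by
  rw [D.halfF.x_eq hk.le, if_neg hk.ne, add_zero]

theorem xE_eq (j : I) : D.halfE.x j (a j) = e A m₁ j (a j) ⊗ₜ[ℂ] 1 + 1 ⊗ₜ[ℂ] e A m₂ j 0 := by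
  rw [D.halfE.x_eq le_rfl, if_pos rfl]

theorem xF_eq (j : I) : D.halfF.x j (b j) = 1 ⊗ₜ[ℂ] f A m₂ j (b j) + f A m₁ j 0 ⊗ₜ[ℂ] 1 := by
  rw [D.halfF.x_eq le_rfl, if_pos rfl]

theorem xE_succ_eq (j : I) : D.halfE.x j (a j + 1) = e A m₁ j (a j + 1) ⊗ₜ[ℂ] 1 +
    1 ⊗ₜ[ℂ] e A m₂ j 1 + ⁅e A m₁ j (a j) ⊗ₜ[ℂ] (1 : ShiftedYangian A m₂), D.omega⁆ := by
  rw [D.halfE.x_succ_eq le_rfl, if_pos rfl]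

theorem xF_succ_eq (j : I) : D.halfF.x j (b j + 1) = 1 ⊗ₜ[ℂ] f A m₂ j (b j + 1) +
    f A m₁ j 1 ⊗ₜ[ℂ] 1 - ⁅(1 : ShiftedYangian A m₁) ⊗ₜ[ℂ] f A m₂ j (b j), D.omega⁆ := by
  rw [D.halfF.x_succ_eq le_rfl, if_pos rfl, RingLie.neg, sub_eq_add_neg]

theorem H_a_add_two (i : I) : H A m₁ i (((a i + 1 : ℕ) : ℤ) + (0 : ℕ) + 1) =
    S₂ A m₁ i + (1 / 2 : ℂ) • (S₁ A m₁ i * S₁ A m₁ i) := by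
  rw [← H_two, ← D.a_eq]; congr 1

theorem H_b_add_two (i : I) : H A m₂ i (((1 : ℕ) : ℤ) + (b i : ℕ) + 1) =
    S₂ A m₂ i + (1 / 2 : ℂ) • (S₁ A m₂ i * S₁ A m₂ i) := by
  rw [← H_two, ← D.b_eq]; congr 1; push_cast; ring

/-- The pair is chosen so that at most one index reaches the degree where corrections appear: (k−1,
0) up to a, (a, k−a−1) up to a + b, then (a, b) and (a+1, b). Only the last involves a bracket with
Ω. -/
theorem lie_xE_xF_low (i : I) (k : ℕ) (hk1 : 1 ≤ k) (hk : k ≤ a i + b i + 2) :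
    ∃ p q, p + q + 1 = k ∧ ⁅D.halfE.x i p, D.halfF.x i q⁆ =
      Levendorskii.lowCartan (a i + b i) (D.s₁ i) (D.s₂ i) k := by
  have hXY : ⁅D.halfE.x i (a i), D.halfF.x i (b i)⁆ = D.s₁ i := by
    rw [D.xE_eq, D.xF_eq]
    simp only [RingLie.add, RingLie.add_left, RingLie.left_tmul, RingLie.right_tmul, RingLie.one, lie_e_f,
      TensorProduct.zero_tmul, TensorProduct.tmul_zero, Nat.cast_zero, zero_add, add_zero]
    rw [s₁, S₁, S₁, ← D.a_eq, ← D.b_eq, add_comm]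
  obtain h | h | h | h : k ≤ a i ∨ (a i < k ∧ k ≤ a i + b i) ∨ k = a i + b i + 1 ∨
      k = a i + b i + 2 := by omega
  · refine ⟨k - 1, 0, by omega, ?_⟩
    have h1 : ⁅e A m₁ i (k - 1), f A m₁ i 0⁆ = if k = a i then 1 else 0 := by
      rw [lie_e_f, Nat.cast_zero, add_zero, H_low (D.a_eq i) (by omega),
        if_congr (show k - 1 + 1 = a i ↔ k = a i by omega) rfl rfl]
    rw [D.xE_of_lt (by omega), D.xF_zero, RingLie.add, RingLie.left_right, RingLie.smul,
      RingLie.left_tmul, h1, zero_add, Levendorskii.lowCartan]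
    by_cases hb : 0 = b i
    · rw [if_pos hb, one_smul, ← hb, add_zero]
      by_cases hka : k = a i
      · rw [if_pos hka, if_neg (by omega), if_pos hka]; rfl
      · rw [if_neg hka, if_pos (by omega), TensorProduct.zero_tmul]
    · rw [if_neg hb, zero_smul, if_pos (by omega)]
  · refine ⟨a i, k - a i - 1, by omega, ?_⟩
    have h1 : ⁅e A m₂ i 0, f A m₂ i (k - a i - 1)⁆ = if k = a i + b i then 1 else 0 := by
      rw [lie_e_f, Nat.cast_zero, zero_add, H_low (D.b_eq i) (by omega),
        if_congr (show k - a i - 1 + 1 = b i ↔ k = a i + b i by omega) rfl rfl]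
    rw [D.xE_eq, D.xF_of_lt (by omega), RingLie.add_left, RingLie.left_right, zero_add,
      RingLie.right_tmul, h1, Levendorskii.lowCartan]
    by_cases hka : k = a i + b i
    · rw [if_pos hka, if_neg (by omega), if_pos hka]; rfl
    · rw [if_neg hka, if_pos (by omega), TensorProduct.tmul_zero]
  · refine ⟨a i, b i, h.symm, ?_⟩
    rw [hXY, Levendorskii.lowCartan, if_neg (by omega), if_neg (by omega), if_pos h]
  · refine ⟨a i + 1, b i, by omega, ?_⟩
    rw [Levendorskii.lowCartan, if_neg (by omega), if_neg (by omega), if_neg (by omega),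
      D.xE_succ_eq]
    have h1 : ⁅⁅e A m₁ i (a i) ⊗ₜ[ℂ] (1 : ShiftedYangian A m₂), D.omega⁆, D.halfF.x i (b i)⁆ =
        S₁ A m₁ i ⊗ₜ[ℂ] S₁ A m₂ i - D.omegaWeighted i := by
      have e1 := RingLie.leibniz (D.halfF.x i (b i)) (e A m₁ i (a i) ⊗ₜ[ℂ] (1 : ShiftedYangian A m₂))
        D.omega
      have e2 : ⁅D.halfF.x i (b i), e A m₁ i (a i) ⊗ₜ[ℂ] (1 : ShiftedYangian A m₂)⁆ =
          -(S₁ A m₁ i ⊗ₜ[ℂ] (1 : ShiftedYangian A m₂)) := by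
        rw [RingLie.skew, D.xF_eq, RingLie.add, RingLie.left_right, RingLie.left_tmul, lie_e_f, S₁,
          ← D.a_eq, Nat.cast_zero, add_zero, zero_add]
      have e3 : ⁅D.halfF.x i (b i), D.omega⁆ = -(f A m₁ i 0 ⊗ₜ[ℂ] S₁ A m₂ i) := by
        rw [D.xF_eq, add_comm, D.lie_Y_omega]
      have e4 : ⁅e A m₁ i (a i), f A m₁ i 0⁆ = S₁ A m₁ i := by
        rw [lie_e_f, S₁, ← D.a_eq, Nat.cast_zero, add_zero]
      rw [e2, e3, RingLie.neg_left, D.lie_left_omega, RingLie.neg, RingLie.left_tmul, e4] at e1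
      rw [RingLie.skew, e1]; abel
    rw [RingLie.add_left, RingLie.add_left, h1, D.xF_eq]
    simp only [RingLie.add, RingLie.left_tmul, RingLie.right_tmul, RingLie.one, lie_e_f,
      TensorProduct.zero_tmul, TensorProduct.tmul_zero, zero_add, add_zero]
    rw [D.H_a_add_two, D.H_b_add_two, s₁, s₂]
    simp only [add_mul, mul_add, Algebra.TensorProduct.tmul_mul_tmul, mul_one, one_mul,
      TensorProduct.add_tmul, TensorProduct.tmul_add, TensorProduct.tmul_smul,
      ← TensorProduct.smul_tmul']
    module

end ShiftedYangian.CoproductData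

/-- The rank one computation showing that the coproduct of the third Cartan mode commutes with that
of the second one. -/
theorem lie_tmul_third_mode {B C : Type*} [Ring B] [Algebra ℂ B] [Ring C] [Algebra ℂ C]
    {σ s k₂ k₃ f f' f'' x : B} {σ' s' l₂ l₃ e e' e'' y : C}
    (hsf : ⁅s, f⁆ = (-2 : ℂ) • f) (hsf' : ⁅s, f'⁆ = (-2 : ℂ) • f')
    (hsf'' : ⁅s, f''⁆ = (-2 : ℂ) • f'')
    (hkf : ⁅k₂, f⁆ - ⁅s, f'⁆ = -(s * f + f * s)) (hkf' : ⁅k₂, f'⁆ - ⁅s, f''⁆ = -(s * f' + f' * s))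
    (hlf : ⁅k₃, f⁆ - ⁅k₂, f'⁆ = -(k₂ * f + f * k₂)) (hff : ⁅f', f⁆ = -(f * f))
    (hσf : ⁅σ, f⁆ = (-2 : ℂ) • f') (hσf' : ⁅σ, f'⁆ = (-2 : ℂ) • f'') (hσs : ⁅σ, s⁆ = 0)
    (hσk₂ : ⁅σ, k₂⁆ = 0) (hσk₃ : ⁅σ, k₃⁆ = 0) (hxf : ⁅x, f⁆ = k₂) (hxf' : ⁅x, f'⁆ = k₃)
    (hse : ⁅s', e⁆ = (2 : ℂ) • e) (hse' : ⁅s', e'⁆ = (2 : ℂ) • e')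
    (hse'' : ⁅s', e''⁆ = (2 : ℂ) • e'')
    (hke : ⁅l₂, e⁆ - ⁅s', e'⁆ = s' * e + e * s') (hke' : ⁅l₂, e'⁆ - ⁅s', e''⁆ = s' * e' + e' * s')
    (hle : ⁅l₃, e⁆ - ⁅l₂, e'⁆ = l₂ * e + e * l₂) (hee : ⁅e', e⁆ = e * e)
    (hσe : ⁅σ', e⁆ = (2 : ℂ) • e') (hσe' : ⁅σ', e'⁆ = (2 : ℂ) • e'') (hσs' : ⁅σ', s'⁆ = 0)
    (hσl₂ : ⁅σ', l₂⁆ = 0) (hσl₃ : ⁅σ', l₃⁆ = 0) (hey : ⁅e, y⁆ = l₂) (hey' : ⁅e', y⁆ = l₃) :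
    ⁅σ ⊗ₜ[ℂ] (1 : C) + (1 : B) ⊗ₜ[ℂ] σ' - (2 : ℂ) • (f ⊗ₜ[ℂ] e),
      ⁅x ⊗ₜ[ℂ] (1 : C) + (1 : B) ⊗ₜ[ℂ] e' + s ⊗ₜ[ℂ] e,
        (1 : B) ⊗ₜ[ℂ] y + f' ⊗ₜ[ℂ] (1 : C) + f ⊗ₜ[ℂ] s'⁆⁆ = 0 := by
  have rsf : s * f = f * s - (2 : ℂ) • f := by
    rw [Ring.lie_def] at hsf; linear_combination (norm := module) hsf
  have rkf : k₂ * f = f * k₂ - (2 : ℂ) • f' - (2 : ℂ) • (f * s) + (2 : ℂ) • f := by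
    rw [hsf', rsf, Ring.lie_def] at hkf; linear_combination (norm := module) hkf
  have rsf' : s * f' = f' * s - (2 : ℂ) • f' := by
    rw [Ring.lie_def] at hsf'; linear_combination (norm := module) hsf'
  have rlf : k₃ * f = f * k₃ - (2 : ℂ) • f'' - (2 : ℂ) • (f' * s) + (4 : ℂ) • f' -
      (2 : ℂ) • (f * k₂) + (2 : ℂ) • (f * s) - (2 : ℂ) • f := by
    rw [hsf'', rsf'] at hkf'
    rw [rkf, Ring.lie_def] at hlf
    linear_combination (norm := module) hlf + hkf'
  have rff : f' * f = f * f' - f * f := by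
    rw [Ring.lie_def] at hff; linear_combination (norm := module) hff
  have rse : s' * e = e * s' + (2 : ℂ) • e := by
    rw [Ring.lie_def] at hse; linear_combination (norm := module) hse
  have rke : l₂ * e = e * l₂ + (2 : ℂ) • e' + (2 : ℂ) • (e * s') + (2 : ℂ) • e := by
    rw [hse', rse, Ring.lie_def] at hke; linear_combination (norm := module) hke
  have rse' : s' * e' = e' * s' + (2 : ℂ) • e' := by
    rw [Ring.lie_def] at hse'; linear_combination (norm := module) hse'
  have rle : l₃ * e = e * l₃ + (2 : ℂ) • e'' + (2 : ℂ) • (e' * s') + (4 : ℂ) • e' +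
      (2 : ℂ) • (e * l₂) + (2 : ℂ) • (e * s') + (2 : ℂ) • e := by
    rw [hse'', rse'] at hke'
    rw [rke, Ring.lie_def] at hle
    linear_combination (norm := module) hle + hke'
  have ree : e' * e = e * e' + e * e := by
    rw [Ring.lie_def] at hee; linear_combination (norm := module) hee
  have hQ : ⁅x ⊗ₜ[ℂ] (1 : C) + (1 : B) ⊗ₜ[ℂ] e' + s ⊗ₜ[ℂ] e,
        (1 : B) ⊗ₜ[ℂ] y + f' ⊗ₜ[ℂ] (1 : C) + f ⊗ₜ[ℂ] s'⁆ =
      k₃ ⊗ₜ[ℂ] 1 + k₂ ⊗ₜ[ℂ] s' + 1 ⊗ₜ[ℂ] l₃ - (2 : ℂ) • (f ⊗ₜ[ℂ] e') + s ⊗ₜ[ℂ] l₂ -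
        (2 : ℂ) • (f' ⊗ₜ[ℂ] e) - (2 : ℂ) • ((f * s) ⊗ₜ[ℂ] e) - (2 : ℂ) • (f ⊗ₜ[ℂ] (e * s')) := by
    have h1 : ⁅s ⊗ₜ[ℂ] e, f ⊗ₜ[ℂ] s'⁆ = (4 : ℂ) • (f ⊗ₜ[ℂ] e) - (2 : ℂ) • ((f * s) ⊗ₜ[ℂ] e) -
        (2 : ℂ) • (f ⊗ₜ[ℂ] (s' * e)) := by
      have : e * s' = s' * e - (2 : ℂ) • e := by rw [rse]; module
      rw [Ring.lie_def, Algebra.TensorProduct.tmul_mul_tmul, Algebra.TensorProduct.tmul_mul_tmul,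
        rsf, this]
      simp only [TensorProduct.sub_tmul, TensorProduct.tmul_sub, ← TensorProduct.smul_tmul',
        TensorProduct.tmul_smul]
      module
    have h2 : ⁅s, f'⁆ = (-2 : ℂ) • f' := hsf'
    have h3 : ⁅e', s'⁆ = (-2 : ℂ) • e' := by rw [RingLie.skew, hse']; module
    simp only [RingLie.add, RingLie.add_left, h1, rse]
    simp only [RingLie.left_tmul, RingLie.right_tmul, RingLie.tmul_left, RingLie.tmul_right,
      RingLie.one_left, hxf, hxf', hey, hey', h2, h3, TensorProduct.tmul_add,
      ← TensorProduct.smul_tmul', TensorProduct.tmul_smul, TensorProduct.zero_tmul,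
      TensorProduct.tmul_zero]
    module
  rw [hQ]
  have h4 : ⁅σ, f * s⁆ = (-2 : ℂ) • (f' * s) := by
    rw [RingLie.lie_mul, hσf, hσs, mul_zero, add_zero, smul_mul_assoc]
  have h5 : ⁅σ', e * s'⁆ = (2 : ℂ) • (e' * s') := by
    rw [RingLie.lie_mul, hσe, hσs', mul_zero, add_zero, smul_mul_assoc]
  rw [RingLie.sub_left, RingLie.smul_left, RingLie.add_left]
  have h6 : ∀ u : B ⊗[ℂ] C, ⁅f ⊗ₜ[ℂ] e, u⁆ = f ⊗ₜ[ℂ] e * u - u * f ⊗ₜ[ℂ] e := fun u => rfl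
  simp only [h6, RingLie.add, RingLie.sub, RingLie.smul, RingLie.left_tmul, RingLie.right_tmul,
    RingLie.one, hσf, hσf', hσs, hσk₂, hσk₃, h4, hσe, hσe', hσs', hσl₂, hσl₃, h5, mul_add, mul_sub,
    add_mul, sub_mul, Algebra.TensorProduct.tmul_mul_tmul, mul_assoc, rsf, rkf, rlf, rff, rse, rke,
    rle, ree, mul_one, one_mul, smul_mul_assoc, mul_smul_comm, TensorProduct.tmul_add,
    TensorProduct.add_tmul, TensorProduct.sub_tmul,
    ← TensorProduct.smul_tmul', TensorProduct.tmul_smul, TensorProduct.zero_tmul,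
    TensorProduct.tmul_zero]
  module

/-- Building a root upwards, α_i could only be attached to, or extended by, a neighbour, and there
is none. -/
theorem PosSystem.eq_simple_or {I P M : Type*} [AddCommGroup M] (S : PosSystem I P M) {i : I}
    (hi : ∀ j, j ≠ i → S.c i (S.s j) = 0) (γ : P) : γ = S.s i ∨ S.c i γ = 0 := by
  induction γ using S.induction with
  | simple j =>
    rcases eq_or_ne j i with rfl | h
    · exact Or.inl rfl
    · exact Or.inr (hi j h)
  | step β γ k hβ ih =>
    have h1 := S.c_eq_neg_one hβ
    have hki : k ≠ i := by
      rintro rfl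
      rcases ih with rfl | h
      · rw [S.c_self] at h1; omega
      · omega
    rcases ih with rfl | h
    · rw [S.c_symm, hi k hki] at h1; omega
    · exact Or.inr (by rw [S.c_add hβ, h, hi k hki]; rfl)

theorem PosSystem.Realization.lie_X_f_eq_zero {I P M : Type*} [AddCommGroup M]
    {S : PosSystem I P M} [Fintype P] {n m : P → P → P → ℂ} {A : Type*} [Ring A] [Algebra ℂ A]
    {e f : P → A} {h : I → A} (R : S.Realization n m e f h) {i : I} {γ : P} (hγ : S.c i γ = 0) :
    ⁅e (S.s i), f γ⁆ = 0 := by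
  have hne : γ ≠ S.s i := by rintro rfl; rw [S.c_self] at hγ; omega
  rw [R.lie_X_f, if_neg hne, Finset.sum_eq_zero, sub_zero]
  intro δ _
  rw [show m (S.s i) δ γ = 0 from by_contra fun h0 => ?_, zero_smul]
  have := S.c_eq_one ((R.m_supp _ _ _ h0).trans (add_comm _ _))
  omega

/-! ### Isolated nodes and verification of all low relations. -/

namespace ShiftedYangian.CoproductData

variable {I : Type*} {A : Matrix I I ℤ} {P M : Type*} [AddCommGroup M] [Fintype P]
  {S : PosSystem I P M} {n m : P → P → P → ℂ} {m₁ m₂ : I → ℤ} {a b : I → ℕ}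
  {e₁ f₁ : P → ShiftedYangian A m₁} {e₂ f₂ : P → ShiftedYangian A m₂}
  (D : CoproductData S n m A m₁ m₂ a b e₁ f₁ e₂ f₂)

include D

theorem off {i j : I} (hij : i ≠ j) : A i j = 0 ∨ A i j = -1 := by
  rw [← D.entry]; exact S.c_simple hij

/-- At an isolated node every positive root other than α_i is orthogonal to α_i, so only the simple
term of Ω matters and the claim is the rank one computation. -/
theorem lie_s₂_lie_xE_xF {i : I} (hi : ∀ j, A i j ≠ -1) :
    ⁅D.s₂ i, ⁅D.halfE.x i (a i + 1), D.halfF.x i (b i + 1)⁆⁆ = 0 := by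
  have hor := S.eq_simple_or (i := i) fun j hj => by
    rw [D.entry]; exact (D.off hj.symm).resolve_right (hi j)
  have h1 : D.omegaWeighted i = (2 : ℂ) • (f A m₁ i 0 ⊗ₜ[ℂ] e A m₂ i 0) := by
    rw [omegaWeighted, Finset.sum_eq_single (S.s i), S.c_self, D.f₁_simple, D.e₂_simple]
    · push_cast; rfl
    · intro γ _ hγ
      rw [(hor γ).resolve_left hγ, Int.cast_zero, zero_smul]
    · intro h0; exact absurd (Finset.mem_univ _) h0
  have h2 : ⁅e A m₁ i (a i) ⊗ₜ[ℂ] (1 : ShiftedYangian A m₂), D.omega⁆ =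
      S₁ A m₁ i ⊗ₜ[ℂ] e A m₂ i 0 := by
    rw [omega, RingLie.sum, Finset.sum_eq_single (S.s i), RingLie.left_tmul, ← D.e₁_simple,
      D.left.lie_e_f_simple, D.e₂_simple]
    · intro γ _ hγ
      rw [RingLie.left_tmul, ← D.e₁_simple, D.left.lie_X_f_eq_zero ((hor γ).resolve_left hγ),
        TensorProduct.zero_tmul]
    · intro h0; exact absurd (Finset.mem_univ _) h0
  have h3 : ⁅(1 : ShiftedYangian A m₁) ⊗ₜ[ℂ] f A m₂ i (b i), D.omega⁆ =
      -(f A m₁ i 0 ⊗ₜ[ℂ] S₁ A m₂ i) := by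
    rw [omega, RingLie.sum, Finset.sum_eq_single (S.s i), RingLie.right_tmul, ← D.f₂_simple,
      RingLie.skew (f₂ _), D.right.lie_e_f_simple, D.f₁_simple, TensorProduct.tmul_neg]
    · intro γ _ hγ
      rw [RingLie.right_tmul, ← D.f₂_simple,
        D.right.symm.lie_X_f_eq_zero ((hor γ).resolve_left hγ), TensorProduct.tmul_zero]
    · intro h0; exact absurd (Finset.mem_univ _) h0
  have hf : ∀ p k, ⁅H A m₁ i (p + 1), f A m₁ i k⁆ - ⁅H A m₁ i p, f A m₁ i (k + 1)⁆ =
      -(H A m₁ i p * f A m₁ i k + f A m₁ i k * H A m₁ i p) := by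
    intro p k
    rw [H_f, D.diag]; push_cast; module
  have he : ∀ p k, ⁅H A m₂ i (p + 1), e A m₂ i k⁆ - ⁅H A m₂ i p, e A m₂ i (k + 1)⁆ =
      H A m₂ i p * e A m₂ i k + e A m₂ i k * H A m₂ i p := by
    intro p k
    rw [H_e, D.diag]; push_cast; module
  rw [D.xE_succ_eq, D.xF_succ_eq, h2, h3, sub_neg_eq_add, s₂, h1]
  refine lie_tmul_third_mode (k₂ := H A m₁ i (-m₁ i + 1 + 1)) (k₃ := H A m₁ i (-m₁ i + 1 + 1 + 1))
    (f'' := f A m₁ i 2) (l₂ := H A m₂ i (-m₂ i + 1 + 1)) (l₃ := H A m₂ i (-m₂ i + 1 + 1 + 1))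
    (e'' := e A m₂ i 2)
    ?_ ?_ ?_ (hf _ _) (hf _ _) (hf _ _) (f_f_self A m₁ D.diag i 0) ?_ ?_ (lie_S₂_S₁ A m₁ i i)
    (lie_S₂_H A m₁ i i _) (lie_S₂_H A m₁ i i _) ?_ ?_
    ?_ ?_ ?_ (he _ _) (he _ _) (he _ _) (e_e_self A m₂ D.diag i 0) ?_ ?_ (lie_S₂_S₁ A m₂ i i)
    (lie_S₂_H A m₂ i i _) (lie_S₂_H A m₂ i i _) ?_ ?_
  all_goals first
    | rw [lie_S₁_f, D.diag]; norm_num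
    | rw [lie_S₁_e, D.diag]; norm_num
    | rw [lie_S₂_f, D.diag]; norm_num
    | rw [lie_S₂_e, D.diag]; norm_num
    | rw [lie_e_f]; exact congrArg _ (by have := D.a_eq i; push_cast; omega)
    | rw [lie_e_f]; exact congrArg _ (by have := D.b_eq i; push_cast; omega)

theorem lowRelations : Levendorskii.LowRelations (fun i j => A i j) (fun i => a i + b i) D.s₁ D.s₂
    D.halfE.x D.halfF.x where
  symm := D.symm
  diag := D.diag
  off _ _ := D.off
  s₂_s₂ := D.lie_s₂_s₂
  s₂_s₁ i j := by
    rw [s₂, RingLie.sub_left, RingLie.skew (D.omegaWeighted i), D.lie_s₁_omegaWeighted, s₁]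
    simp only [RingLie.add, RingLie.add_left, RingLie.left_tmul, RingLie.right_tmul, lie_S₂_S₁,
      RingLie.one, TensorProduct.zero_tmul, TensorProduct.tmul_zero, add_zero, neg_zero, sub_zero]
  s₁_e i j := by
    rw [s₁, D.xE_zero]
    simp only [RingLie.add, RingLie.add_left, RingLie.smul, RingLie.left_tmul, RingLie.right_tmul,
      lie_S₁_e, RingLie.one, TensorProduct.zero_tmul, TensorProduct.tmul_zero,
      TensorProduct.tmul_smul, ← TensorProduct.smul_tmul']
    module
  s₁_f i j := by
    rw [s₁, D.xF_zero]
    simp only [RingLie.add, RingLie.add_left, RingLie.smul, RingLie.left_tmul, RingLie.right_tmul,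
      lie_S₁_f, RingLie.one, TensorProduct.zero_tmul, TensorProduct.tmul_zero,
      TensorProduct.tmul_smul, ← TensorProduct.smul_tmul']
    module
  s₂_e i j k := by
    have h := D.halfE.lie_s_x (fun i j => by rw [D.s₂_eq_E, D.s₂_eq_E, D.lie_s₂_s₂]) i j k
    rwa [D.s₂_eq_E] at h
  s₂_f i j k := by
    have h := D.halfF.lie_s_x (fun i j => by rw [D.s₂_eq_F, D.s₂_eq_F, D.lie_s₂_s₂]) i j k
    rwa [D.s₂_eq_F] at h
  ee := D.halfE.lie_x_x
  ff i j := by rw [← neg_div]; exact D.halfF.lie_x_x i j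
  serre_e i j h := by
    rw [D.xE_zero, D.xE_zero]
    simp only [RingLie.add, RingLie.add_left, RingLie.smul, RingLie.smul_left, RingLie.left_tmul,
      RingLie.right_tmul, RingLie.one, lie_e_e_e A _ D.diag h, TensorProduct.zero_tmul,
      TensorProduct.tmul_zero, RingLie.zero, smul_zero, add_zero]
  serre_f i j h := by
    rw [D.xF_zero, D.xF_zero]
    simp only [RingLie.add, RingLie.add_left, RingLie.smul, RingLie.smul_left, RingLie.left_tmul,
      RingLie.right_tmul, RingLie.one, lie_f_f_f A _ D.diag h, TensorProduct.zero_tmul,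
      TensorProduct.tmul_zero, RingLie.zero, smul_zero, add_zero]
  comm_e i j h := by
    rw [D.xE_zero, D.xE_zero]
    simp only [RingLie.add, RingLie.add_left, RingLie.smul, RingLie.smul_left, RingLie.left_tmul,
      RingLie.right_tmul, RingLie.one, lie_e_e A _ D.diag h, TensorProduct.zero_tmul,
      TensorProduct.tmul_zero, smul_zero, add_zero]
  comm_f i j h := by
    rw [D.xF_zero, D.xF_zero]
    simp only [RingLie.add, RingLie.add_left, RingLie.smul, RingLie.smul_left, RingLie.left_tmul,
      RingLie.right_tmul, RingLie.one, lie_f_f A _ D.diag h, TensorProduct.zero_tmul,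
      TensorProduct.tmul_zero, smul_zero, add_zero]
  ef_ne i j hij := by
    rw [D.xE_zero, D.xF_zero]
    simp only [RingLie.add, RingLie.add_left, RingLie.smul, RingLie.smul_left, RingLie.left_tmul,
      RingLie.right_tmul, RingLie.one, lie_e_f_ne A _ hij, TensorProduct.zero_tmul,
      TensorProduct.tmul_zero, smul_zero, add_zero]
  ef_low := D.lie_xE_xF_low
  ef_top i := by
    by_cases h : ∃ j, A i j = -1
    · exact Or.inl h
    · exact Or.inr ⟨a i + 1, b i + 1, by omega, D.lie_s₂_lie_xE_xF (not_exists.1 h)⟩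

end ShiftedYangian.CoproductData
open LieAlgebra LieAlgebra.IsKilling

/-! ### The comultiplication. -/

namespace ShiftedYangian.CoproductData

variable {I : Type*} {A : Matrix I I ℤ} {P M : Type*} [AddCommGroup M] [Fintype P]
  {S : PosSystem I P M} {n m : P → P → P → ℂ} {m₁ m₂ : I → ℤ} {a b : I → ℕ}
  {e₁ f₁ : P → ShiftedYangian A m₁} {e₂ f₂ : P → ShiftedYangian A m₂}
  (D : CoproductData S n m A m₁ m₂ a b e₁ f₁ e₂ f₂)

include D

/-- The intertwining property of Ω exchanges the bracket in the first factor for S₁ ⊗ E^{(1)} minus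
the bracket in the second. -/
theorem xE_succ_eq_sum (j : I) : D.halfE.x j (a j + 1) = e A m₁ j (a j + 1) ⊗ₜ[ℂ] 1 +
    1 ⊗ₜ[ℂ] e A m₂ j 1 + S₁ A m₁ j ⊗ₜ[ℂ] e A m₂ j 0 - ∑ γ, f₁ γ ⊗ₜ[ℂ] ⁅e A m₂ j 0, e₂ γ⁆ := by
  have h := D.lie_X_omega j
  have h1 : ⁅(1 : ShiftedYangian A m₁) ⊗ₜ[ℂ] e A m₂ j 0, D.omega⁆ =
      ∑ γ, f₁ γ ⊗ₜ[ℂ] ⁅e A m₂ j 0, e₂ γ⁆ := by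
    rw [omega, RingLie.sum]; simp only [RingLie.right_tmul]
  rw [RingLie.add_left, h1] at h
  rw [D.xE_succ_eq, ← h]; abel

theorem xF_succ_eq_sum (j : I) : D.halfF.x j (b j + 1) = 1 ⊗ₜ[ℂ] f A m₂ j (b j + 1) +
    f A m₁ j 1 ⊗ₜ[ℂ] 1 + f A m₁ j 0 ⊗ₜ[ℂ] S₁ A m₂ j + ∑ γ, ⁅f A m₁ j 0, f₁ γ⁆ ⊗ₜ[ℂ] e₂ γ := by
  have h := D.lie_Y_omega j
  have h1 : ⁅f A m₁ j 0 ⊗ₜ[ℂ] (1 : ShiftedYangian A m₂), D.omega⁆ =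
      ∑ γ, ⁅f A m₁ j 0, f₁ γ⁆ ⊗ₜ[ℂ] e₂ γ := by
    rw [omega, RingLie.sum]; simp only [RingLie.left_tmul]
  rw [RingLie.add_left, h1] at h
  rw [D.xF_succ_eq, ← neg_eq_iff_eq_neg.2 h]; abel

/-- The comultiplication of shifted Yangians with antidominant shifts. -/
theorem existsUnique_comul {m₀ : I → ℤ} (hm : ∀ i, m₀ i = m₁ i + m₂ i) :
    ∃! Δ : ShiftedYangian A m₀ →ₐ[ℂ] (ShiftedYangian A m₁ ⊗[ℂ] ShiftedYangian A m₂), ∀ i,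
      (∀ r : ℕ+, (r : ℤ) ≤ -m₁ i → Δ (E A m₀ i r) = E A m₁ i r ⊗ₜ[ℂ] 1) ∧
      (∀ r : ℕ+, (r : ℤ) = -m₁ i + 1 →
        Δ (E A m₀ i r) = E A m₁ i r ⊗ₜ[ℂ] 1 + 1 ⊗ₜ[ℂ] E A m₂ i 1) ∧
      (∀ r : ℕ+, (r : ℤ) = -m₁ i + 2 →
        Δ (E A m₀ i r) = E A m₁ i r ⊗ₜ[ℂ] 1 + 1 ⊗ₜ[ℂ] E A m₂ i 2 + S₁ A m₁ i ⊗ₜ[ℂ] E A m₂ i 1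
          - ∑ γ, f₁ γ ⊗ₜ[ℂ] ⁅E A m₂ i 1, e₂ γ⁆) ∧
      (∀ r : ℕ+, (r : ℤ) ≤ -m₂ i → Δ (F A m₀ i r) = 1 ⊗ₜ[ℂ] F A m₂ i r) ∧
      (∀ r : ℕ+, (r : ℤ) = -m₂ i + 1 →
        Δ (F A m₀ i r) = 1 ⊗ₜ[ℂ] F A m₂ i r + F A m₁ i 1 ⊗ₜ[ℂ] 1) ∧
      (∀ r : ℕ+, (r : ℤ) = -m₂ i + 2 →
        Δ (F A m₀ i r) = 1 ⊗ₜ[ℂ] F A m₂ i r + F A m₁ i 2 ⊗ₜ[ℂ] 1 + F A m₁ i 1 ⊗ₜ[ℂ] S₁ A m₂ i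
          + ∑ γ, ⁅F A m₁ i 1, f₁ γ⁆ ⊗ₜ[ℂ] e₂ γ) ∧
      Δ (S₁ A m₀ i) = S₁ A m₁ i ⊗ₜ[ℂ] 1 + 1 ⊗ₜ[ℂ] S₁ A m₂ i ∧
      Δ (S₂ A m₀ i) = S₂ A m₁ i ⊗ₜ[ℂ] 1 + 1 ⊗ₜ[ℂ] S₂ A m₂ i
        - ∑ γ, (S.c i γ : ℂ) • (f₁ γ ⊗ₜ[ℂ] e₂ γ) := by
  have ha := D.a_eq
  have hb := D.b_eq
  obtain ⟨Δ, hE, hF, hS₁, hS₂⟩ := exists_algHom m₀ D.lowRelations fun i => by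
    push_cast; rw [ha, hb, hm]; ring
  have one₁ : ∀ i, E A m₂ i 1 = e A m₂ i 0 := fun _ => rfl
  have two₁ : ∀ i, E A m₂ i 2 = e A m₂ i 1 := fun _ => rfl
  have one₂ : ∀ i, F A m₁ i 1 = f A m₁ i 0 := fun _ => rfl
  have two₂ : ∀ i, F A m₁ i 2 = f A m₁ i 1 := fun _ => rfl
  refine ⟨Δ, fun i => ⟨fun r hr => ?_, fun r hr => ?_, fun r hr => ?_, fun r hr => ?_,
    fun r hr => ?_, fun r hr => ?_, hS₁ i, hS₂ i⟩, fun Δ' hΔ' => ?_⟩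
  · have := ha i
    have := PNat.natPred_add_one r
    rw [hE, D.xE_of_lt (by omega), ← E_eq]
  · have := ha i
    have := PNat.natPred_add_one r
    have hr' : r.natPred = a i := by omega
    rw [hE, hr', D.xE_eq, ← hr', ← E_eq, one₁]
  · have := ha i
    have := PNat.natPred_add_one r
    have hr' : r.natPred = a i + 1 := by omega
    rw [hE, hr', D.xE_succ_eq_sum, ← hr', ← E_eq, one₁, two₁]
  · have := hb i
    have := PNat.natPred_add_one r
    rw [hF, D.xF_of_lt (by omega), ← F_eq]
  · have := hb i
    have := PNat.natPred_add_one r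
    have hr' : r.natPred = b i := by omega
    rw [hF, hr', D.xF_eq, ← hr', ← F_eq, one₂]
  · have := hb i
    have := PNat.natPred_add_one r
    have hr' : r.natPred = b i + 1 := by omega
    rw [hF, hr', D.xF_succ_eq_sum, ← hr', ← F_eq, one₂, two₂]
  · refine algHom_ext A m₀ D.diag (fun i => by have := ha i; have := hb i; have := hm i; omega)
      (fun i => ?_) (fun i => ?_) (fun i => ((hΔ' i).2.2.2.2.2.2.2).trans (hS₂ i).symm)
    · have := ha i
      rw [hE, PNat.natPred, PNat.one_coe, Nat.sub_self]
      -- E_i^{(1)} is covered by the first formula when ⟨μ₁, α_i⟩ < 0 and by the second when it is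
      -- 0.
      rcases (Nat.zero_le (a i)).lt_or_eq with h1 | h1
      · rw [D.xE_of_lt h1]
        exact (hΔ' i).1 1 (by rw [PNat.one_coe]; push_cast; omega)
      · have h2 := D.xE_eq i
        rw [← h1] at h2
        exact ((hΔ' i).2.1 1 (by rw [PNat.one_coe]; push_cast; omega)).trans h2.symm
    · have := hb i
      rw [hF, PNat.natPred, PNat.one_coe, Nat.sub_self]
      rcases (Nat.zero_le (b i)).lt_or_eq with h1 | h1
      · rw [D.xF_of_lt h1]
        exact (hΔ' i).2.2.2.1 1 (by rw [PNat.one_coe]; push_cast; omega)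
      · have h2 := D.xF_eq i
        rw [← h1] at h2
        exact ((hΔ' i).2.2.2.2.1 1 (by rw [PNat.one_coe]; push_cast; omega)).trans h2.symm

end ShiftedYangian.CoproductData

namespace RootVectors

variable {g : Type*} [LieRing g] [LieAlgebra ℂ g] [FiniteDimensional ℂ g]
  [LieAlgebra.IsSemisimple ℂ g] {h : LieSubalgebra ℂ g} [h.IsCartanSubalgebra]
  {b : (rootSystem h).Base} (v : RootVectors b)

/-- The shift is carried by E in the first factor and by F in the second, so the unshifted root
vectors `v.F μ₁` and `v.E μ₂` are the ones entering Ω. Both realizations use the same structure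
constants. -/
theorem exists_coproductData (hb : b.cartanMatrix.IsSimplyLaced) {μ₁ μ₂ : Coweight (rootSystem h)}
    {p q : b.support → ℕ} (hp : ∀ i : b.support, (p i : ℤ) = -μ₁.pair i)
    (hq : ∀ i : b.support, (q i : ℤ) = -μ₂.pair i) :
    ∃ n m e₁ f₂, ShiftedYangian.CoproductData (RootPairing.Base.posSystem hb) n m b.cartanMatrix
      (fun i => μ₁.pair (i : h.root)) (fun i => μ₂.pair (i : h.root)) p q e₁ (v.F μ₁) (v.E μ₂)
      f₂ := by
  obtain ⟨n, m, hR⟩ := v.exists_realization hb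
  have hdiag : ∀ i, b.cartanMatrix i i = 2 := fun i => (RootPairing.Base.posSystem hb).c_self i
  obtain ⟨R₁, hX₁, hY₁⟩ := hR _ _ _ _ (ShiftedYangian.assocChevalleySerre b.cartanMatrix
    (fun i => μ₁.pair (i : h.root)) hdiag (p := p) (q := fun _ => 0) (by simpa using hp))
  obtain ⟨R₂, hX₂, hY₂⟩ := hR _ _ _ _ (ShiftedYangian.assocChevalleySerre b.cartanMatrix
    (fun i => μ₂.pair (i : h.root)) hdiag (p := fun _ => 0) (q := q) (by simpa using hq))
  exact ⟨n, m, _, _,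
    { entry := fun i j => rfl
      a_eq := hp
      b_eq := hq
      left := R₁
      right := R₂
      e₁_simple := hX₁
      f₁_simple := hY₁
      e₂_simple := hX₂
      f₂_simple := hY₂ }⟩

end RootVectors
theorem mainTheorem3 {g : Type*} [LieRing g] [LieAlgebra ℂ g] [FiniteDimensional ℂ g]
    [LieAlgebra.IsSemisimple ℂ g] (h : LieSubalgebra ℂ g) [h.IsCartanSubalgebra]
    (b : (LieAlgebra.IsKilling.rootSystem h).Base)
    (hb : b.cartanMatrix.IsSimplyLaced)
    (v : RootVectors b)
    (μ μ₁ μ₂ : Coweight (LieAlgebra.IsKilling.rootSystem h))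
    (hμ : μ = μ₁ + μ₂)
    (hμ₁ : μ₁.IsAntidominant b) (hμ₂ : μ₂.IsAntidominant b) :
    ∃! Δ : Yangian b μ →ₐ[ℂ] (Yangian b μ₁ ⊗[ℂ] Yangian b μ₂), ∀ i : b.support,
      (∀ r : ℕ+, (r : ℤ) ≤ -μ₁.pair i →
        Δ (Yangian.E b μ i r) = Yangian.E b μ₁ i r ⊗ₜ[ℂ] 1) ∧
      (∀ r : ℕ+, (r : ℤ) = -μ₁.pair i + 1 →
        Δ (Yangian.E b μ i r) = Yangian.E b μ₁ i r ⊗ₜ[ℂ] 1 + 1 ⊗ₜ[ℂ] Yangian.E b μ₂ i 1) ∧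
      (∀ r : ℕ+, (r : ℤ) = -μ₁.pair i + 2 →
        Δ (Yangian.E b μ i r) =
          Yangian.E b μ₁ i r ⊗ₜ[ℂ] 1 + 1 ⊗ₜ[ℂ] Yangian.E b μ₂ i 2
            + Yangian.S₁ b μ₁ i ⊗ₜ[ℂ] Yangian.E b μ₂ i 1
            - ∑ γ : PosRoot b, v.F μ₁ γ ⊗ₜ[ℂ] ⁅Yangian.E b μ₂ i 1, v.E μ₂ γ⁆) ∧
      (∀ r : ℕ+, (r : ℤ) ≤ -μ₂.pair i →
        Δ (Yangian.F b μ i r) = 1 ⊗ₜ[ℂ] Yangian.F b μ₂ i r) ∧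
      (∀ r : ℕ+, (r : ℤ) = -μ₂.pair i + 1 →
        Δ (Yangian.F b μ i r) = 1 ⊗ₜ[ℂ] Yangian.F b μ₂ i r + Yangian.F b μ₁ i 1 ⊗ₜ[ℂ] 1) ∧
      (∀ r : ℕ+, (r : ℤ) = -μ₂.pair i + 2 →
        Δ (Yangian.F b μ i r) =
          1 ⊗ₜ[ℂ] Yangian.F b μ₂ i r + Yangian.F b μ₁ i 2 ⊗ₜ[ℂ] 1
            + Yangian.F b μ₁ i 1 ⊗ₜ[ℂ] Yangian.S₁ b μ₂ i
            + ∑ γ : PosRoot b, ⁅Yangian.F b μ₁ i 1, v.F μ₁ γ⁆ ⊗ₜ[ℂ] v.E μ₂ γ) ∧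
      Δ (Yangian.S₁ b μ i) =
        Yangian.S₁ b μ₁ i ⊗ₜ[ℂ] 1 + 1 ⊗ₜ[ℂ] Yangian.S₁ b μ₂ i ∧
      Δ (Yangian.S₂ b μ i) =
        Yangian.S₂ b μ₁ i ⊗ₜ[ℂ] 1 + 1 ⊗ₜ[ℂ] Yangian.S₂ b μ₂ i
          - ∑ γ : PosRoot b,
              (((LieAlgebra.IsKilling.rootSystem h).pairingIn ℤ i γ.1 : ℤ) : ℂ) •
                (v.F μ₁ γ ⊗ₜ[ℂ] v.E μ₂ γ) := by
  have hp : ∀ i : b.support, ((-μ₁.pair i).toNat : ℤ) = -μ₁.pair i := fun i =>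
    Int.toNat_of_nonneg (neg_nonneg.2 (hμ₁ i i.2))
  have hq : ∀ i : b.support, ((-μ₂.pair i).toNat : ℤ) = -μ₂.pair i := fun i =>
    Int.toNat_of_nonneg (neg_nonneg.2 (hμ₂ i i.2))
  obtain ⟨n, m, e₁, f₂, D⟩ := v.exists_coproductData hb hp hq
  exact D.existsUnique_comul (m₀ := fun i : b.support => μ.pair (i : h.root)) fun i => by
    rw [hμ]; rfl
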